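/- Let $\mathfrak g$ be a finite-dimensional simple Lie algebra over $\mathbb C$ with Cartan subalgebra $\mathfrak h$ and root system $\Delta$, let $\langle\cdot,\cdot\rangle$ be the Killing form normalized so that long roots have squared length $2$, put $\epsilon_\alpha=2/\langle\alpha,\alpha\rangle\in\{1,2,3\}$ for $\alpha\in\Delta$, and fix $\mu\in\mathbb C$. Let $\mathcal R=\mathbb C[t_0^{\pm1},t_1^{\pm1}]$, $\mathrm k_i=t_i^{-1}dt_i$, $\mathrm d_i=t_i\,\partial/\partial t_i$, $\mathcal K=\Omega^1_{\mathcal R}/d\mathcal R$. The full toroidal Lie algebra is $\mathcal T(\mathfrak g,\mu)=(\mathcal R\otimes\mathfrak g)\oplus\mathcal K\oplus\mathrm{Der}(\mathcal R)$ with the following brackets, where $t^m=t_0^{m_0}t_1^{m_1}$ and $\mathcal R\otimes\mathfrak g$ commutes with $\mathcal K$, which is abelian: $$[t^m\otimes u,t^n\otimes v]=t^{m+n}\otimes[u,v]+\langle u,v\rangle t^{m+n}(m_0\mathrm k_0+m_1\mathrm k_1),\qquad [t^m\mathrm d_i,t^n\otimes u]=n_i\,t^{m+n}\otimes u,$$ $$[t^m\mathrm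 d_i,t^n\mathrm k_j]=n_it^{m+n}\mathrm k_j+\delta_{ij}t^{m+n}(m_0\mathrm k_0+m_1\mathrm k_1),$$ $$[t^m\mathrm d_i,t^n\mathrm d_j]=n_it^{m+n}\mathrm d_j-m_jt^{m+n}\mathrm d_i-\mu m_jn_i\,t^{m+n}(m_0\mathrm k_0+m_1\mathrm k_1).$$ Put $\bar{\mathrm d}_{n,m}=(n+1)t_0^nt_1^m\mathrm d_1-m\,t_0^nt_1^m\mathrm d_0$ and $\mathrm d_{n,m}=\bar{\mathrm d}_{n,m}+\mu m(n+\tfrac12)t_0^nt_1^m\mathrm k_0$; let $\mathrm k_{m,n}$ be $\frac1n t_0^mt_1^n\mathrm k_0$ if $n\neq0$, $-\frac1m t_0^m\mathrm k_1$ if $n=0\ne m$, and $0$ if $m=n=0$. Let $\widehat{\mathfrak t}(\mathfrak g,\mu)^o$ be the Lie subalgebra $\mathcal R\otimes\mathfrak g+\mathcal K+\mathbb C\,t_0^{-1}\mathrm d_1+\sum_{m,n\in\mathbb Z}\mathbb C\,\bar{\mathrm d}_{m,n}$. Let $$\mathcal A_{\mathfrak g}=\widetilde{\mathfrak g}_1\oplus\bigoplus_{n\ne0}(\mathbb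 C\mathrm K_n\oplus\mathbb C\mathrm D_n),\qquad \widetilde{\mathfrak g}_1=\mathbb C[t_1^{\pm1}]\otimes\mathfrak g+\mathbb C\mathrm k_1+\mathbb C\mathrm d_1,$$ and for $a\in\mathcal A_{\mathfrak g}$ let $a(z)=\sum_{n\in\mathbb Z}a(n)z^{-n-1}$, where $a(n)$ is linear in $a$ with $u(n)=t_0^nu$ for $u\in\widetilde{\mathfrak g}_1$, $\mathrm K_m(n)=\mathrm k_{n+1,m}$ and $\mathrm D_m(n)=\mathrm d_{n-1,m}$. A $\widehat{\mathfrak t}(\mathfrak g,\mu)^o$-module $W$ is *restricted* if $a(z)\in\mathrm{Hom}(W,W((z)))$ for all $a\in\mathcal A_{\mathfrak g}$, *of level $\ell$* if $\mathrm k_0$ acts as the scalar $\ell$, and *integrable* if $t_0^{m_0}t_1^{m_1}\otimes\mathfrak g_\alpha$ acts locally nilpotently on $W$ for all $m_0,m_1\in\mathbb Z$, $\alpha\in\Delta$. For $\ell\in\mathbb C$ let $V(\ell)=V_{\widehat{\mathfrak t}(\mathfrak g,\mu)^o}(\ell)$ be the $\widehat{\mathfrak t}(\mathfrak g,\mu)^o$-module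 induced from the one-dimensional module on which $\mathrm k_0$ acts as $\ell$ and $t_0^nu$, $\mathrm k_{n+1,m}$, $\mathrm d_{n-1,m}$ ($n\ge0$, $m\in\mathbb Z$, $u\in\widetilde{\mathfrak g}_1$) act as $0$; let $\mathbf 1$ be its canonical generator, and map $\mathcal A_{\mathfrak g}$ to $V(\ell)$ by $a\mapsto a(-1)\mathbf 1$. For $\ell\in\mathbb N$ let $J(\ell)\subset V(\ell)$ be the $\widehat{\mathfrak t}(\mathfrak g,\mu)^o$-submodule generated by all $(t_0^{-1}a)^{\epsilon_\alpha\ell+1}\mathbf 1$ with $a\in t_1^m\otimes\mathfrak g_\alpha$, $m\in\mathbb Z$, $\alpha\in\Delta$, and put $V^{\rm int}(\ell)=V^{\rm int}_{\widehat{\mathfrak t}(\mathfrak g,\mu)^o}(\ell)=V(\ell)/J(\ell)$. Then: 1. For every $\ell\in\mathbb C$ there is a unique vertex algebra structure on $V(\ell)$ with vacuum vector $\mathbf 1$ and $Y(a,z)=a(z)$ for $a\in\mathcal A_{\mathfrak g}$. For every vector space $W$, restricted $\widehat{\mathfrak t}(\mathfrak g,\mu)^o$-module structures of level $\ell$ on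 $W$ are in bijection with $V(\ell)$-module structures $Y_W$ on $W$, in such a way that $Y_W(a,z)=a(z)$ for all $a\in\mathcal A_{\mathfrak g}$. 2. If a nonzero restricted $\widehat{\mathfrak t}(\mathfrak g,\mu)^o$-module of level $\ell\in\mathbb C$ is integrable, then $\ell$ is a nonnegative integer. 3. For every nonnegative integer $\ell$ there is a unique vertex algebra structure on $V^{\rm int}(\ell)$ for which the quotient map $V(\ell)\to V^{\rm int}(\ell)$ is a homomorphism of vertex algebras. For every vector space $W$, restricted and integrable $\widehat{\mathfrak t}(\mathfrak g,\mu)^o$-module structures of level $\ell$ on $W$ are in bijection with $V^{\rm int}(\ell)$-module structures $Y_W$ on $W$, in such a way that $Y_W(a,z)=a(z)$ for all $a\in\mathcal A_{\mathfrak g}$ (with $a$ identified with its image in $V^{\rm int}(\ell)$). -/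

import Mathlib

noncomputable section

attribute [local instance 100] LieRing.ofAssociativeRing

namespace Toroidal

open VertexOperator (ncoeff)

/-! ## Vertex algebras and their modules -/

/-- A (complex) vertex algebra structure on a vector space `V`: a vacuum vector and a linear map
`Y(·, z) : V → Hom(V, V((z)))`, `Y(u, z) = ∑ₙ uₙ z⁻ⁿ⁻¹`, where `uₙ = ncoeff (Y u) n`, subject to the
vacuum property, the creation property and the Jacobi (Borcherds) identity, written in
components.  All sums occurring in the identity are finite. -/
@[ext]
structure VertexAlgebra (V : Type*) [AddCommGroup V] [Module ℂ V] where
  /-- the vacuum vector -/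
  vac : V
  /-- the vertex operator map -/
  Y : V →ₗ[ℂ] VertexOperator ℂ V
  vac_mode : ∀ n : ℤ, ncoeff (Y vac) n = if n = -1 then 1 else 0
  creation : ∀ (u : V) (n : ℤ), 0 ≤ n → ncoeff (Y u) n vac = 0
  creation_neg_one : ∀ u : V, ncoeff (Y u) (-1) vac = u
  borcherds : ∀ (u v w : V) (p q r : ℤ),
    ∑ᶠ i : ℕ, Ring.choose p i • ncoeff (Y (ncoeff (Y u) (r + i) v)) (p + q - i) w =
      ∑ᶠ i : ℕ, ((-1) ^ i * Ring.choose r i) •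
        (ncoeff (Y u) (p + r - i) (ncoeff (Y v) (q + i) w) -
          (r.negOnePow : ℤ) • ncoeff (Y v) (q + r - i) (ncoeff (Y u) (p + i) w))

/-- A module structure on a vector space `W` for a vertex algebra `A`: a linear map
`Y_W(·, z) : V → Hom(W, W((z)))` with `Y_W(𝟏, z) = 1` satisfying the Jacobi identity. -/
@[ext]
structure VAModule {V : Type*} [AddCommGroup V] [Module ℂ V] (A : VertexAlgebra V)
    (W : Type*) [AddCommGroup W] [Module ℂ W] where
  /-- the vertex operator map of the module -/
  Y : V →ₗ[ℂ] VertexOperator ℂ W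
  vac_mode : ∀ n : ℤ, ncoeff (Y A.vac) n = if n = -1 then 1 else 0
  borcherds : ∀ (u v : V) (w : W) (p q r : ℤ),
    ∑ᶠ i : ℕ, Ring.choose p i • ncoeff (Y (ncoeff (A.Y u) (r + i) v)) (p + q - i) w =
      ∑ᶠ i : ℕ, ((-1) ^ i * Ring.choose r i) •
        (ncoeff (Y u) (p + r - i) (ncoeff (Y v) (q + i) w) -
          (r.negOnePow : ℤ) • ncoeff (Y v) (q + r - i) (ncoeff (Y u) (p + i) w))

/-! ## The full toroidal Lie algebra of nullity 2 -/

/-- A symmetric invariant bilinear form on a complex Lie algebra. -/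
structure InvForm (g : Type*) [LieRing g] [LieAlgebra ℂ g] where
  /-- the form -/
  form : LinearMap.BilinForm ℂ g
  symm : ∀ u v, form u v = form v u
  inv : ∀ u v w, form ⁅u, v⁆ w = form u ⁅v, w⁆

variable {g : Type*} [LieRing g] [LieAlgebra ℂ g]

/-- The component of degree `m ∈ ℤ²` before dividing by the exact forms: the triple
`(u, (a₀, a₁), (b₀, b₁))` in degree `m` stands for
`t^m ⊗ u + t^m (a₀ k₀ + a₁ k₁) + t^m (b₀ d₀ + b₁ d₁)`, where `k_i = t_i⁻¹ dt_i` and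
`d_i = t_i ∂/∂t_i`. -/
abbrev Comp (g : Type*) : Type _ := g × (ℂ × ℂ) × (ℂ × ℂ)

/-- `(R ⊗ g) ⊕ Ω¹_R ⊕ Der R`, where `R = ℂ[t₀^{±1}, t₁^{±1}]`; the element `t^m X` is
`Finsupp.single m X`. -/
abbrev Pre (g : Type*) [LieRing g] : Type _ := (ℤ × ℤ) →₀ Comp g

/-- `a₀ m₀ + a₁ m₁`, the pairing of coefficient vectors with degrees. -/
def dot (a : ℂ × ℂ) (m : ℤ × ℤ) : ℂ := a.1 * m.1 + a.2 * m.2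

/-- `a₀ b₀ + a₁ b₁`. -/
def pair (a b : ℂ × ℂ) : ℂ := a.1 * b.1 + a.2 * b.2

/-- The degree `m` as a coefficient vector; `t^m (m₀ k₀ + m₁ k₁) = d(t^m)`. -/
def vec (m : ℤ × ℤ) : ℂ × ℂ := (m.1, m.2)

/-- The bracket of `t^m x` and `t^n y`, as the coefficient of `t^(m+n)`.  It combines
* `[t^m ⊗ u, t^n ⊗ v] = t^(m+n) ⊗ [u,v] + ⟨u,v⟩ t^(m+n) (m₀ k₀ + m₁ k₁)`,
* `[t^m d_i, t^n ⊗ u] = n_i t^(m+n) ⊗ u`,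
* `[t^m d_i, t^n k_j] = n_i t^(m+n) k_j + δ_ij t^(m+n) (m₀ k₀ + m₁ k₁)`,
* `[t^m d_i, t^n d_j] = n_i t^(m+n) d_j - m_j t^(m+n) d_i
    - μ m_j n_i t^(m+n) (m₀ k₀ + m₁ k₁)`. -/
def compBracket (κ : InvForm g) (μ : ℂ) (m n : ℤ × ℤ) : Comp g →ₗ[ℂ] Comp g →ₗ[ℂ] Comp g :=
  LinearMap.mk₂ ℂ
    (fun x y =>
      (⁅x.1, y.1⁆ + dot x.2.2 n • y.1 - dot y.2.2 m • x.1,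
       κ.form x.1 y.1 • vec m
         + (dot x.2.2 n • y.2.1 + pair x.2.2 y.2.1 • vec m)
         - (dot y.2.2 m • x.2.1 + pair y.2.2 x.2.1 • vec n)
         - (μ * dot x.2.2 n * dot y.2.2 m) • vec m,
       dot x.2.2 n • y.2.2 - dot y.2.2 m • x.2.2))
    (by
      intro x x' y
      ext <;> simp [dot, pair, vec] <;> first | ring1 | module)
    (by
      intro c x y
      ext <;> simp [dot, pair, vec] <;> first | ring1 | module)
    (by
      intro x y y'
      ext <;> simp [dot, pair, vec] <;> first | ring1 | module)
    (by
      intro c x y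
      ext <;> simp [dot, pair, vec] <;> first | ring1 | module)

/-- The bilinear extension of `compBracket`. -/
def preBracket (κ : InvForm g) (μ : ℂ) : Pre g →ₗ[ℂ] Pre g →ₗ[ℂ] Pre g :=
  Finsupp.lsum ℂ fun m => LinearMap.flip <|
    Finsupp.lsum ℂ fun n => LinearMap.flip <|
      (compBracket κ μ m n).compr₂ (Finsupp.lsingle (m + n))

theorem preBracket_single (κ : InvForm g) (μ : ℂ) (m n : ℤ × ℤ) (x y : Comp g) :
    preBracket κ μ (Finsupp.single m x) (Finsupp.single n y) =
      Finsupp.single (m + n) (compBracket κ μ m n x y) := by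
  simp [preBracket]

/-- The space `d(R)` of exact forms, spanned by `d(t^m) = t^m (m₀ k₀ + m₁ k₁)`. -/
def exactForms (g : Type*) [LieRing g] [LieAlgebra ℂ g] : Submodule ℂ (Pre g) :=
  Submodule.span ℂ (Set.range fun m : ℤ × ℤ => Finsupp.single m (0, vec m, 0))

/-- The full toroidal Lie algebra `𝒯(g, μ) = (R ⊗ g) ⊕ 𝒦 ⊕ 𝒟` with `𝒦 = Ω¹_R / d(R)` and
`𝒟 = Der R`. -/
def Full (_κ : InvForm g) (_μ : ℂ) : Type _ :=
  Pre g ⧸ exactForms g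

variable (κ : InvForm g) (μ : ℂ)

instance : AddCommGroup (Full κ μ) := inferInstanceAs (AddCommGroup (Pre g ⧸ exactForms g))

instance : Module ℂ (Full κ μ) := inferInstanceAs (Module ℂ (Pre g ⧸ exactForms g))

/-- The projection onto the quotient by exact forms. -/
def toFull : Pre g →ₗ[ℂ] Full κ μ := (exactForms g).mkQ

/-- The homogeneous element `t^m x`. -/
def hom (m : ℤ × ℤ) (x : Comp g) : Full κ μ := toFull κ μ (Finsupp.single m x)

theorem hom_exact (m : ℤ × ℤ) : hom κ μ m (0, vec m, 0) = 0 :=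
  (Submodule.Quotient.mk_eq_zero _).2 (Submodule.subset_span ⟨m, rfl⟩)

theorem hom_add (m : ℤ × ℤ) (x y : Comp g) : hom κ μ m (x + y) = hom κ μ m x + hom κ μ m y := by
  simp [hom]

theorem hom_smul (m : ℤ × ℤ) (c : ℂ) (x : Comp g) : hom κ μ m (c • x) = c • hom κ μ m x := by
  rw [hom, hom, ← Finsupp.smul_single, map_smul]

theorem hom_zero (m : ℤ × ℤ) : hom κ μ m 0 = 0 := by simp [hom]

theorem hom_eq (m : ℤ × ℤ) (x y : Comp g) (c : ℂ) (h1 : x.1 = y.1) (h3 : x.2.2 = y.2.2)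
    (h2 : x.2.1 = y.2.1 + c • vec m) : hom κ μ m x = hom κ μ m y := by
  have : x = y + c • ((0, vec m, 0) : Comp g) := by
    ext <;> simp [h1, h2, h3]
  rw [this, hom_add, hom_smul, hom_exact, smul_zero, add_zero]

theorem full_induction {p : Full κ μ → Prop} (h0 : p 0) (ha : ∀ x y, p x → p y → p (x + y))
    (hs : ∀ m x, p (hom κ μ m x)) (x : Full κ μ) : p x := by
  obtain ⟨x, rfl⟩ := (exactForms g).mkQ_surjective x
  induction x using Finsupp.induction_linear with
  | zero => rw [map_zero]; exact h0
  | add f f' hf hf' => rw [map_add]; exact ha _ _ hf hf'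
  | single m x => exact hs m x

/-- The bracket of `𝒯(g, μ)` as a bilinear map. -/
def fullBracket : Full κ μ →ₗ[ℂ] Full κ μ →ₗ[ℂ] Full κ μ :=
  LinearMap.liftQ₂ (exactForms g) (exactForms g) ((preBracket κ μ).compr₂ (toFull κ μ))
    (by
      refine Submodule.span_le.2 ?_
      rintro _ ⟨m, rfl⟩
      refine LinearMap.mem_ker.2 (Finsupp.lhom_ext fun n y => ?_)
      simp only [LinearMap.compr₂_apply, preBracket_single, LinearMap.zero_apply]
      refine (hom_eq κ μ (m + n) _ 0 (-dot y.2.2 m) ?_ ?_ ?_).trans (hom_zero κ μ _) <;>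
        simp [compBracket, dot, pair, vec]
      constructor <;> ring)
    (by
      refine Submodule.span_le.2 ?_
      rintro _ ⟨m, rfl⟩
      refine LinearMap.mem_ker.2 (Finsupp.lhom_ext fun n y => ?_)
      simp only [LinearMap.compr₂_apply, LinearMap.flip_apply, preBracket_single,
        LinearMap.zero_apply]
      refine (hom_eq κ μ (n + m) _ 0 (dot y.2.2 m) ?_ ?_ ?_).trans (hom_zero κ μ _) <;>
        simp [compBracket, dot, pair, vec]
      constructor <;> ring)

instance : Bracket (Full κ μ) (Full κ μ) := ⟨fun x y => fullBracket κ μ x y⟩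

theorem bracket_def (x y : Full κ μ) : ⁅x, y⁆ = fullBracket κ μ x y := rfl

theorem hom_bracket (m n : ℤ × ℤ) (x y : Comp g) :
    ⁅hom κ μ m x, hom κ μ n y⁆ = hom κ μ (m + n) (compBracket κ μ m n x y) := by
  change toFull κ μ (preBracket κ μ (Finsupp.single m x) (Finsupp.single n y)) = _
  rw [preBracket_single]; rfl

theorem full_skew (x y : Full κ μ) : ⁅x, y⁆ = -⁅y, x⁆ := by
  simp only [bracket_def]
  induction x using full_induction with
  | h0 => simp
  | ha x x' hx hx' => rw [map_add, LinearMap.add_apply, hx, hx', map_add]; abel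
  | hs m x =>
    induction y using full_induction with
    | h0 => simp
    | ha y y' hy hy' => rw [map_add, hy, hy', map_add, LinearMap.add_apply]; abel
    | hs n y =>
      simp only [← bracket_def]
      rw [hom_bracket, hom_bracket, add_comm n m, ← neg_one_smul ℂ, ← hom_smul]
      refine hom_eq κ μ (m + n) _ _
        (κ.form x.1 y.1 - μ * dot x.2.2 n * dot y.2.2 m) ?_ ?_ ?_
      · simp only [compBracket, LinearMap.mk₂_apply, Prod.smul_fst]
        rw [← lie_skew]; module
      · simp only [compBracket, LinearMap.mk₂_apply, Prod.smul_snd]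
        module
      · simp only [compBracket, LinearMap.mk₂_apply, Prod.smul_snd, Prod.smul_fst, κ.symm y.1 x.1]
        ext <;> simp [dot, pair, vec] <;> ring

theorem full_leibniz (x y z : Full κ μ) : ⁅x, ⁅y, z⁆⁆ = ⁅⁅x, y⁆, z⁆ + ⁅y, ⁅x, z⁆⁆ := by
  simp only [bracket_def]
  induction x using full_induction with
  | h0 => simp
  | ha x x' hx hx' => simp only [map_add, LinearMap.add_apply, hx, hx']; abel
  | hs m x =>
    induction y using full_induction with
    | h0 => simp
    | ha y y' hy hy' => simp only [map_add, LinearMap.add_apply, hy, hy']; abel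
    | hs n y =>
      induction z using full_induction with
      | h0 => simp
      | ha z z' hz hz' => simp only [map_add, hz, hz']; abel
      | hs p z =>
        simp only [← bracket_def]
        simp only [hom_bracket]
        rw [← add_assoc m n p, show n + (m + p) = m + n + p by abel, ← hom_add]
        refine hom_eq κ μ (m + n + p) _ _
          (dot z.2.2 m * κ.form x.1 y.1 - μ * dot x.2.2 n * dot y.2.2 m * dot z.2.2 m) ?_ ?_ ?_
        · simp only [compBracket, LinearMap.mk₂_apply, Prod.fst_add]
          simp only [lie_add, lie_sub, add_lie, sub_lie, lie_smul, smul_lie, leibniz_lie x.1 y.1]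
          simp only [dot, Prod.fst_add, Prod.snd_add, Prod.fst_sub, Prod.snd_sub, Prod.smul_fst,
            Prod.smul_snd, smul_eq_mul, Int.cast_add]
          rw [← lie_skew y.1 x.1]
          module
        · simp only [compBracket, LinearMap.mk₂_apply, Prod.snd_add]
          ext <;> simp [dot] <;> ring
        · have h : κ.form y.1 ⁅x.1, z.1⁆ = -κ.form x.1 ⁅y.1, z.1⁆ := by
            rw [← κ.inv, ← κ.inv, ← lie_skew, map_neg, LinearMap.neg_apply]
          simp only [compBracket, LinearMap.mk₂_apply, Prod.snd_add, Prod.fst_add]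
          simp only [map_add, map_sub, map_smul, LinearMap.add_apply, LinearMap.sub_apply,
            LinearMap.smul_apply, κ.inv, h, κ.symm y.1 x.1]
          ext <;> simp [dot, pair, vec] <;> ring

instance : LieRing (Full κ μ) where
  add_lie x y z := by simp [bracket_def]
  lie_add x y z := by simp [bracket_def]
  lie_self x := by
    have h : (2 : ℂ) • ⁅x, x⁆ = 0 := by
      rw [two_smul]
      nth_rewrite 1 [full_skew κ μ x x]
      exact neg_add_cancel _
    exact (smul_eq_zero.1 h).resolve_left two_ne_zero
  leibniz_lie := full_leibniz κ μ

instance : LieAlgebra ℂ (Full κ μ) where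
  lie_smul c x y := by simp [bracket_def]

/-! ## Distinguished elements and the subalgebra -/

/-- `t₀^m t₁^n ⊗ u`, linear in `u`. -/
def loop (m n : ℤ) : g →ₗ[ℂ] Full κ μ where
  toFun u := hom κ μ (m, n) (u, 0, 0)
  map_add' u v := by rw [← hom_add]; simp
  map_smul' c u := by rw [RingHom.id_apply, ← hom_smul]; simp

/-- `t₀^m t₁^n (a k₀ + b k₁)`. -/
def kform (m n : ℤ) (a b : ℂ) : Full κ μ := hom κ μ (m, n) (0, (a, b), 0)

/-- `t₀^m t₁^n (a d₀ + b d₁)`. -/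
def der (m n : ℤ) (a b : ℂ) : Full κ μ := hom κ μ (m, n) (0, 0, (a, b))

/-- `k_{m,n}`, which is `(1/n) t₀^m t₁^n k₀` if `n ≠ 0`, `-(1/m) t₀^m k₁` if `n = 0 ≠ m`, and `0`
if `m = n = 0`. -/
def kk (m n : ℤ) : Full κ μ :=
  if n ≠ 0 then kform κ μ m n (1 / n) 0 else if m ≠ 0 then kform κ μ m 0 0 (-1 / m) else 0

/-- `d̄_{n,m} = (n + 1) t₀^n t₁^m d₁ - m t₀^n t₁^m d₀`. -/
def dbar (n m : ℤ) : Full κ μ := der κ μ n m (-m) (n + 1)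

/-- `d_{n,m} = d̄_{n,m} + μ m (n + 1/2) t₀^n t₁^m k₀`. -/
def dd (n m : ℤ) : Full κ μ := dbar κ μ n m + kform κ μ n m (μ * m * (n + 1 / 2)) 0

/-- The spanning set of `t̂(g, μ)ᵒ`: `R ⊗ g`, `𝒦`, `t₀⁻¹ d₁` and all `d̄_{n,m}`. -/
def hatGens : Set (Full κ μ) :=
  {x | ∃ m n u, x = loop κ μ m n u} ∪ {x | ∃ m n a b, x = kform κ μ m n a b} ∪
    {der κ μ (-1) 0 0 1} ∪ {x | ∃ n m, x = dbar κ μ n m}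

theorem loop_mem_span (m n : ℤ) (u : g) : loop κ μ m n u ∈ Submodule.span ℂ (hatGens κ μ) :=
  Submodule.subset_span (Or.inl (Or.inl (Or.inl ⟨m, n, u, rfl⟩)))

theorem kform_mem_span (m n : ℤ) (a b : ℂ) :
    kform κ μ m n a b ∈ Submodule.span ℂ (hatGens κ μ) :=
  Submodule.subset_span (Or.inl (Or.inl (Or.inr ⟨m, n, a, b, rfl⟩)))

theorem dbar_mem_span (n m : ℤ) : dbar κ μ n m ∈ Submodule.span ℂ (hatGens κ μ) :=
  Submodule.subset_span (Or.inr ⟨n, m, rfl⟩)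

theorem der_smul (m n : ℤ) (c a b : ℂ) : der κ μ m n (c * a) (c * b) = c • der κ μ m n a b := by
  rw [der, der, ← hom_smul]; simp

theorem der_mem_span (m n : ℤ) (a b : ℂ) (h : a * (m + 1) + b * n = 0)
    (h' : m = -1 → n = 0 → a = 0) : der κ μ m n a b ∈ Submodule.span ℂ (hatGens κ μ) := by
  by_cases hm : m = -1
  · subst hm
    by_cases hn : n = 0
    · subst hn
      rw [h' rfl rfl]
      have := der_smul κ μ (-1) 0 b 0 1
      rw [mul_zero, mul_one] at this
      rw [this]
      exact Submodule.smul_mem _ _ (Submodule.subset_span (Or.inl (Or.inr rfl)))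
    · have hn' : (n : ℂ) ≠ 0 := Int.cast_ne_zero.2 hn
      have hb : b = 0 := by
        have : b * n = 0 := by simpa using h
        exact (mul_eq_zero.1 this).resolve_right hn'
      have := der_smul κ μ (-1) n (-a / n) (-n) ((-1 : ℤ) + 1)
      rw [show (-a / n * (-n) : ℂ) = a by field_simp, show (-a / n * ((-1 : ℤ) + 1) : ℂ) = 0 by
        simp] at this
      rw [hb, this]
      exact Submodule.smul_mem _ _ (dbar_mem_span κ μ (-1) n)
  · have hm' : (m + 1 : ℂ) ≠ 0 := by
      have : m + 1 ≠ 0 := fun h => hm (by omega)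
      exact_mod_cast this
    have := der_smul κ μ m n (b / (m + 1)) (-n) (m + 1)
    have ha : (b / (m + 1) * (-n) : ℂ) = a := by
      field_simp; linear_combination -h
    rw [ha, div_mul_cancel₀ _ hm'] at this
    rw [this]
    exact Submodule.smul_mem _ _ (dbar_mem_span κ μ m n)

theorem hom_mem_span (m n : ℤ) (x : Comp g) (h : x.2.2.1 * (m + 1) + x.2.2.2 * n = 0)
    (h' : m = -1 → n = 0 → x.2.2.1 = 0) :
    hom κ μ (m, n) x ∈ Submodule.span ℂ (hatGens κ μ) := by
  have : hom κ μ (m, n) x =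
      loop κ μ m n x.1 + kform κ μ m n x.2.1.1 x.2.1.2 + der κ μ m n x.2.2.1 x.2.2.2 := by
    change _ = hom κ μ (m, n) _ + hom κ μ (m, n) _ + hom κ μ (m, n) _
    rw [← hom_add, ← hom_add]; simp
  rw [this]
  exact add_mem (add_mem (loop_mem_span κ μ m n _) (kform_mem_span κ μ m n _ _))
    (der_mem_span κ μ m n _ _ h h')

theorem hatGens_hom (x : Full κ μ) (hx : x ∈ hatGens κ μ) :
    ∃ (m n : ℤ) (y : Comp g), x = hom κ μ (m, n) y ∧
      y.2.2.1 * (m + 1) + y.2.2.2 * n = 0 ∧ (m = -1 → n = 0 → y.2.2.1 = 0) := by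
  rcases hx with ((⟨m, n, u, rfl⟩ | ⟨m, n, a, b, rfl⟩) | rfl) | ⟨n, m, rfl⟩
  · exact ⟨m, n, _, rfl, by simp, by simp⟩
  · exact ⟨m, n, _, rfl, by simp, by simp⟩
  · exact ⟨-1, 0, _, rfl, by simp, by simp⟩
  · refine ⟨n, m, _, rfl, ?_, ?_⟩
    · simp only; ring
    · rintro - rfl; simp

theorem hat_bracket_gens (x y : Full κ μ) (hx : x ∈ hatGens κ μ) (hy : y ∈ hatGens κ μ) :
    ⁅x, y⁆ ∈ Submodule.span ℂ (hatGens κ μ) := by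
  obtain ⟨m, n, x, rfl, hx, hx'⟩ := hatGens_hom κ μ x hx
  obtain ⟨p, q, y, rfl, hy, hy'⟩ := hatGens_hom κ μ y hy
  rw [hom_bracket]
  refine hom_mem_span κ μ (m + p) (n + q) _ ?_ ?_
  · simp only [compBracket, LinearMap.mk₂_apply, Prod.snd_sub, Prod.fst_sub, Prod.smul_fst,
      Prod.smul_snd, smul_eq_mul, dot, Int.cast_add]
    linear_combination (y.2.2.1 * m + y.2.2.2 * n) * (-hx) + (x.2.2.1 * p + x.2.2.2 * q) * hy
  · intro h1 h2
    have ha : (p : ℂ) = -1 - m := by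
      rw [show p = -1 - m by omega]; push_cast; ring
    have hb : (q : ℂ) = -n := by
      rw [show q = -n by omega]; push_cast; ring
    rw [ha, hb] at hy
    simp only [compBracket, LinearMap.mk₂_apply, Prod.fst_sub, Prod.smul_fst, smul_eq_mul,
      dot, ha, hb]
    linear_combination -y.2.2.1 * hx + x.2.2.1 * hy

/-- The Lie algebra `t̂(g, μ)ᵒ = R ⊗ g + 𝒦 + ℂ t₀⁻¹ d₁ + ∑ ℂ d̄_{n,m}`. -/
def HatO : LieSubalgebra ℂ (Full κ μ) where
  __ := Submodule.span ℂ (hatGens κ μ)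
  lie_mem' {x y} hx hy := by
    change x ∈ Submodule.span ℂ (hatGens κ μ) at hx
    change y ∈ Submodule.span ℂ (hatGens κ μ) at hy
    change ⁅x, y⁆ ∈ Submodule.span ℂ (hatGens κ μ)
    induction hx, hy using Submodule.span_induction₂ with
    | mem_mem x y hx hy => exact hat_bracket_gens κ μ x y hx hy
    | zero_left y hy => simp
    | zero_right x hx => simp
    | add_left x y z _ _ _ h1 h2 => rw [add_lie]; exact add_mem h1 h2
    | add_right x y z _ _ _ h1 h2 => rw [lie_add]; exact add_mem h1 h2
    | smul_left c x y _ _ h => rw [smul_lie]; exact Submodule.smul_mem _ _ h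
    | smul_right c x y _ _ h => rw [lie_smul]; exact Submodule.smul_mem _ _ h

/-- `t₀^m t₁^n ⊗ u` as an element of `t̂(g, μ)ᵒ`. -/
def hLoop (m n : ℤ) : g →ₗ[ℂ] HatO κ μ where
  toFun u := ⟨loop κ μ m n u, loop_mem_span κ μ m n u⟩
  map_add' u v := Subtype.ext (map_add _ u v)
  map_smul' c u := Subtype.ext (map_smul _ c u)

/-- `k₀` as an element of `t̂(g, μ)ᵒ`. -/
def hK0 : HatO κ μ := ⟨kform κ μ 0 0 1 0, kform_mem_span κ μ 0 0 1 0⟩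

/-- `t₀^m k₁` as an element of `t̂(g, μ)ᵒ`. -/
def hK1 (m : ℤ) : HatO κ μ := ⟨kform κ μ m 0 0 1, kform_mem_span κ μ m 0 0 1⟩

/-- `t₀^m d₁` as an element of `t̂(g, μ)ᵒ`. -/
def hD1 (m : ℤ) : HatO κ μ :=
  ⟨der κ μ m 0 0 1, der_mem_span κ μ m 0 0 1 (by simp) (by simp)⟩

theorem kk_mem_span (m n : ℤ) : kk κ μ m n ∈ Submodule.span ℂ (hatGens κ μ) := by
  unfold kk
  split_ifs
  · exact kform_mem_span κ μ _ _ _ _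
  · exact kform_mem_span κ μ _ _ _ _
  · exact zero_mem _

/-- `k_{m,n}` as an element of `t̂(g, μ)ᵒ`. -/
def hKK (m n : ℤ) : HatO κ μ := ⟨kk κ μ m n, kk_mem_span κ μ m n⟩

/-- `d_{n,m}` as an element of `t̂(g, μ)ᵒ`. -/
def hDD (n m : ℤ) : HatO κ μ :=
  ⟨dd κ μ n m, add_mem (dbar_mem_span κ μ n m) (kform_mem_span κ μ n m _ _)⟩

/-- The space `𝒜_g = ℂ[t₁^{±1}] ⊗ g ⊕ ℂ k₁ ⊕ ℂ d₁ ⊕ ∑_{n ≠ 0} (ℂ K_n ⊕ ℂ D_n)`, where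
`t₁^n ⊗ u` is `Finsupp.single n u`. -/
abbrev GenSpace (g : Type*) [LieRing g] : Type _ :=
  (ℤ →₀ g) × ℂ × ℂ × ({n : ℤ // n ≠ 0} →₀ ℂ × ℂ)

/-- The coefficient `a(n)` of `z^{-n-1}` in `a(z)`, linear in `a ∈ 𝒜_g`.  On the generators:
`(t₁^m ⊗ u)(n) = t₀^n t₁^m ⊗ u`, `k₁(n) = t₀^n k₁`, `d₁(n) = t₀^n d₁`, `K_m(n) = k_{n+1,m}`,
`D_m(n) = d_{n-1,m}`. -/
def mode (n : ℤ) : GenSpace g →ₗ[ℂ] HatO κ μ :=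
  (Finsupp.lsum ℂ fun m => hLoop κ μ n m).coprod <|
    (LinearMap.toSpanSingleton ℂ (HatO κ μ) (hK1 κ μ n)).coprod <|
      (LinearMap.toSpanSingleton ℂ (HatO κ μ) (hD1 κ μ n)).coprod <|
        Finsupp.lsum ℂ fun m : {m : ℤ // m ≠ 0} =>
          (LinearMap.toSpanSingleton ℂ (HatO κ μ) (hKK κ μ (n + 1) m)).coprod
            (LinearMap.toSpanSingleton ℂ (HatO κ μ) (hDD κ μ (n - 1) m))

/-! ## The induced module -/

/-- The spanning set of `t̂(g, μ)ᵒ₊`: all `t₀^n u`, `k_{n+1,m}`, `d_{n-1,m}` for `n ≥ 0`, `m ∈ ℤ`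
and `u ∈ ℂ[t₁^{±1}] ⊗ g + ℂ k₁ + ℂ d₁`. -/
def plusGens : Set (HatO κ μ) :=
  {x | ∃ (n : ℕ) (m : ℤ) (u : g), x = hLoop κ μ n m u} ∪
    {x | ∃ n : ℕ, x = hK1 κ μ n ∨ x = hD1 κ μ n} ∪
    {x | ∃ (n : ℕ) (m : ℤ), x = hKK κ μ (n + 1) m ∨ x = hDD κ μ (n - 1) m}

/-- The universal enveloping algebra of `t̂(g, μ)ᵒ`. -/
abbrev Env : Type _ := UniversalEnvelopingAlgebra ℂ (HatO κ μ)

/-- The canonical map of `t̂(g, μ)ᵒ` into its enveloping algebra. -/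
def emb (x : HatO κ μ) : Env κ μ := UniversalEnvelopingAlgebra.ι ℂ x

/-- The left ideal of the enveloping algebra generated by `t̂(g, μ)ᵒ₊` and `k₀ - ℓ`. -/
def inducedIdeal (ℓ : ℂ) : Submodule (Env κ μ) (Env κ μ) :=
  Submodule.span (Env κ μ)
    (emb κ μ '' plusGens κ μ ∪ {emb κ μ (hK0 κ μ) - algebraMap ℂ (Env κ μ) ℓ})

/-- The induced module `V(ℓ) = 𝒰(t̂ᵒ) ⊗_{𝒰(t̂ᵒ₊ + ℂ k₀)} ℂ`, with `t̂ᵒ₊` acting on `ℂ` trivially and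
`k₀` as `ℓ`, realized as the quotient of `𝒰(t̂ᵒ)` by the left ideal generated by `t̂ᵒ₊` and
`k₀ - ℓ`. -/
abbrev VSpace (ℓ : ℂ) : Type _ := Env κ μ ⧸ inducedIdeal κ μ ℓ

/-- The vector `𝟏 = 1 ⊗ 1`. -/
def one (ℓ : ℂ) : VSpace κ μ ℓ := (inducedIdeal κ μ ℓ).mkQ 1

/-- The embedding `𝒜_g → V(ℓ)`, `a ↦ a(-1) 𝟏`. -/
def genVec (ℓ : ℂ) (a : GenSpace g) : VSpace κ μ ℓ := emb κ μ (mode κ μ (-1) a) • one κ μ ℓ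

/-- The characterization of the vertex algebra structure of `V(ℓ)`: the vacuum vector is `𝟏` and
`Y(a, z) = a(z)` for `a ∈ 𝒜_g`. -/
def IsCanonical {ℓ : ℂ} (A : VertexAlgebra (VSpace κ μ ℓ)) : Prop :=
  A.vac = one κ μ ℓ ∧
    ∀ (a : GenSpace g) (n : ℤ) (v : VSpace κ μ ℓ),
      ncoeff (A.Y (genVec κ μ ℓ a)) n v = emb κ μ (mode κ μ n a) • v

/-! ## Modules for the Lie algebra -/

/-- A `t̂(g, μ)ᵒ`-module structure on a vector space `W`, given as a homomorphism of Lie algebras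
into `End W`. -/
abbrev HatRep (W : Type*) [AddCommGroup W] [Module ℂ W] : Type _ :=
  HatO κ μ →ₗ⁅ℂ⁆ Module.End ℂ W

variable {κ μ} {W : Type*} [AddCommGroup W] [Module ℂ W]

/-- A `t̂(g, μ)ᵒ`-module `W` is restricted if `a(z) ∈ Hom(W, W((z)))` for all `a ∈ 𝒜_g`. -/
def IsRestricted (ρ : HatRep κ μ W) : Prop :=
  ∀ a : GenSpace g, ∃ F : VertexOperator ℂ W, ∀ n : ℤ, ncoeff F n = ρ (mode κ μ n a)

/-- A `t̂(g, μ)ᵒ`-module is of level `ℓ` if `k₀` acts as the scalar `ℓ`. -/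
def HasLevel (ρ : HatRep κ μ W) (ℓ : ℂ) : Prop :=
  ∀ w : W, ρ (hK0 κ μ) w = ℓ • w

section Simple

variable [FiniteDimensional ℂ g] [LieAlgebra.IsSimple ℂ g]
  (H : LieSubalgebra ℂ g) [H.IsCartanSubalgebra]

/-- A `t̂(g, μ)ᵒ`-module is integrable if `t₀^{m₀} t₁^{m₁} ⊗ g_α` acts locally nilpotently for all
`m₀, m₁ ∈ ℤ` and all roots `α`. -/
def IsIntegrable (ρ : HatRep κ μ W) : Prop :=
  ∀ (m₀ m₁ : ℤ), ∀ α ∈ H.root, ∀ a ∈ LieAlgebra.rootSpace H α, ∀ w : W,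
    ∃ N : ℕ, (ρ (hLoop κ μ m₀ m₁ a) ^ N) w = 0

/-- The square length of a root with respect to the Killing form: `α(h)` for the element `h` of the
Cartan subalgebra that represents `α` through the Killing form (a positive rational number). -/
def killingSq (α : LieModule.Weight ℂ H g) : ℂ :=
  α ((LieAlgebra.IsKilling.cartanEquivDual H).symm α)

/-- The Killing square length of the long roots. -/
def longSq : ℝ := ⨆ α : H.root, (killingSq H α).re

/-- The Killing form, normalized such that the square length of the long roots is `2`. (If the form
is multiplied by `c`, then the induced form on the dual of the Cartan subalgebra is divided by
`c`.) -/
def normalizedForm : InvForm g where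
  form := ((longSq H / 2 : ℝ) : ℂ) • killingForm ℂ g
  symm u v := by
    simp only [LinearMap.smul_apply]
    rw [LieModule.traceForm_comm]
  inv u v w := by
    simp only [LinearMap.smul_apply]
    rw [LieModule.traceForm_apply_lie_apply]

/-- `⟨α, α⟩` for the normalized form. -/
def rootSq (α : LieModule.Weight ℂ H g) : ℂ := killingSq H α / (longSq H / 2 : ℝ)

/-- `ε_α = 2 / ⟨α, α⟩ ∈ {1, 2, 3}`. -/
def eps (α : LieModule.Weight ℂ H g) : ℂ := 2 / rootSq H α

variable (μ)

/-- The submodule `J(ℓ)` of `V(ℓ)`, generated by the vectors `(t₀⁻¹ a)^{ε_α ℓ + 1} 𝟏` for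
`a ∈ t₁^m g_α`, `m ∈ ℤ`, `α` a root. -/
def JSub (ℓ : ℕ) :
    Submodule (Env (normalizedForm H) μ) (VSpace (normalizedForm H) μ (ℓ : ℂ)) :=
  Submodule.span _
    {v | ∃ α ∈ H.root, ∃ a ∈ LieAlgebra.rootSpace H α, ∃ (m : ℤ) (N : ℕ),
      (N : ℂ) = eps H α * ℓ + 1 ∧
        v = emb _ μ (hLoop (normalizedForm H) μ (-1) m a) ^ N • one _ μ (ℓ : ℂ)}

/-- The quotient space `V^int(ℓ) = V(ℓ) / J(ℓ)`. -/
abbrev VInt (ℓ : ℕ) : Type _ := VSpace (normalizedForm H) μ (ℓ : ℂ) ⧸ JSub μ H ℓ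

variable {μ H}

/-- `B` is the quotient vertex algebra structure on `V^int(ℓ)` induced by the vertex algebra
structure `A` on `V(ℓ)`. -/
def IsQuotientStructure {ℓ : ℕ} (A : VertexAlgebra (VSpace (normalizedForm H) μ (ℓ : ℂ)))
    (B : VertexAlgebra (VInt μ H ℓ)) : Prop :=
  B.vac = (JSub μ H ℓ).mkQ A.vac ∧
    ∀ (u v : VSpace (normalizedForm H) μ (ℓ : ℂ)) (n : ℤ),
      ncoeff (B.Y ((JSub μ H ℓ).mkQ u)) n ((JSub μ H ℓ).mkQ v) =
        (JSub μ H ℓ).mkQ (ncoeff (A.Y u) n v)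

end Simple

end Toroidal

end

open Toroidal

universe u w

/-!
The proof has three layers: general vertex algebra theory, the Lie algebra `t̂(g, μ)ᵒ`, and the
integrability argument, which is carried by affine `sl₂`.

**Fields and vertex algebras.** Two fields on a space are compared through the Borcherds
expression `bor`, whose value at `p = 0` defines the `n`-th product `nprod`. For mutually local
fields the Borcherds identity holds (`borcherds_of_local`), and Dong's lemma `IsLocal.nprod` says
that `n`-th products of pairwise local fields stay local. The operators `H ↦ F_n H` on fields
inherit locality (`nab_pow_nprod_comm`), so by Goddard's uniqueness argument
(`StateField.eq_zero_of_vac`, `StateField.Y_nprod`) every space of pairwise local fields that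
contains the identity and is closed under all products is a vertex algebra
(`IsFieldAlgebra.vertexAlgebra`).

**The modules of level `ℓ`.** The modes of the elements of `𝒜_g`, together with `k₀`, form a basis
of `t̂(g, μ)ᵒ`: they span it (`hat_induction`), and linear maps can be prescribed on them
(`liftHat`). The bracket of two generating series is a finite sum of derivatives of delta
functions, with poles of order at most four, whose coefficients are generating series, their
derivatives and multiples of `k₀` (`IsOPE`, the lemmas `ope_*`, and `ope_induction`). On a
restricted module the fields `a(z)` are therefore mutually local (`isLocal_fld`) and generate a
vertex algebra `fieldVA`, in which their nonnegative products are the expected ones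
(`hasGenOPE_fieldVA`). Conversely, on a module of any vertex algebra in which vectors `f a` have
these products (`HasGenOPE`), the commutator formula makes the modes of the `f a` a representation
of `t̂(g, μ)ᵒ` (`repOfModule`). Applied to the adjoint module and combined with the universal
property of the induced module (`vLift`), this gives a canonical map `phi` from `V(ℓ)` to every
such vertex algebra. For the fields on `V(ℓ)` itself this map is bijective with inverse `F ↦
F_{-1} 𝟏`, which transports the vertex algebra structure to `V(ℓ)` (`exists_canonical`). It is
unique because `V(ℓ)` is generated by `𝒜_g` (`canonical_unique`). For an arbitrary restricted `W`,
the map `phi` to the fields on `W` is the module structure, whence `repEquivModule`.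

**The level is a natural number.** A long root has `ε_α = 1` (`eps_spec`) and yields on `W` an
integrable module of affine `sl₂` of level `ℓ` (`RootTriple.affine`). Such a module contains a
nonzero vector killed by all positive modes: if all modes of index greater than `m ≥ 1` are
discarded, those of index `m` commute, `e(m)` and `f(m)` are locally nilpotent by assumption and
`h(m)` is a derivative of `e(m)`, so it is nilpotent by the principle that the radical of a
differential ideal is differential (`pow_eq_zero_of_derivation`, `AffineSl2.omega_descend`).
Finite-dimensional `sl₂` theory for `e(0)`, `f(0)` and for `e(1)`, `f(-1)` then shows that the
weight is `-l` and that `ℓ - l` is natural for some natural `l` (`AffineSl2.exists_lowest`,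
`AffineSl2.weight_add_level`), and so `ℓ` is natural.

**The integrable quotient.** Let `e` be a root vector and `c = ε_α ℓ`. The modes of the field of
`e(-1)^{c+1} 𝟏` commute with affine `sl₂` like those of `e(z)^{c+1}`, and on an integrable module
of level `c` such a family vanishes, for otherwise it would produce a vector violating the bound
on the weights (`AffineSl2.eq_zero_of_power_like`, `Y_pow_eq_zero`, `Y_JSub_eq_zero`). Conversely,
if `e(z)^{c+1} = 0`, every mode of `e(z)` is locally nilpotent (`nilpotent_of_fieldPow_eq_zero`,
`isIntegrable_of_Y_JSub`). Hence integrable modules of level `ℓ` are the `V(ℓ)`-modules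
annihilated by `J(ℓ)`. Finally `V(ℓ) / J(ℓ)` is itself integrable: `J(ℓ)` gives nilpotency of
`t₀⁻¹ t₁^m ⊗ e` on `𝟏`, the element `d_{-1,1}` propagates it to the other powers of `t₀`
(`loop_nilpotent_vac`), and local nilpotency of `ad (t^m ⊗ e)` extends it to all vectors
(`isIntegrable_vInt`). Therefore `J(ℓ)` annihilates the quotient, so that it is an ideal, the
quotient is a vertex algebra (`exists_quotient`), and its modules are the integrable ones
(`integrableEquivModule`).
-/

noncomputable section

attribute [local instance 100] LieRing.ofAssociativeRing

set_option linter.unusedSectionVars false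

namespace Toroidal

open VertexOperator (ncoeff)

/-! ### Eventually zero sequences and signed binomial coefficients -/

/-- A sequence with only finitely many nonzero terms. -/
def EvZero {M : Type*} [Zero M] (f : ℕ → M) : Prop := ∃ I, ∀ i, I ≤ i → f i = 0

section EvZero

variable {M M' : Type*} [AddCommGroup M] [AddCommGroup M']

theorem EvZero.finite {f : ℕ → M} (h : EvZero f) : (Function.support f).Finite := by
  obtain ⟨I, hI⟩ := h
  refine (Set.finite_lt_nat I).subset fun i hi => ?_
  by_contra h
  exact hi (hI i (not_lt.1 h))

theorem finsum_eq_range {f : ℕ → M} {I : ℕ} (h : ∀ i, I ≤ i → f i = 0) :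
    ∑ᶠ i, f i = ∑ i ∈ Finset.range I, f i := by
  refine finsum_eq_sum_of_support_subset f fun i hi => ?_
  by_contra h'
  simp only [Finset.coe_range, Set.mem_Iio, not_lt] at h'
  exact hi (h i h')

theorem EvZero.add {f g : ℕ → M} (hf : EvZero f) (hg : EvZero g) : EvZero fun i => f i + g i := by
  obtain ⟨I, hI⟩ := hf
  obtain ⟨J, hJ⟩ := hg
  exact ⟨max I J, fun i hi => by
    beta_reduce
    rw [hI i (le_of_max_le_left hi), hJ i (le_of_max_le_right hi), add_zero]⟩

theorem EvZero.smul {f : ℕ → M} (hf : EvZero f) (c : ℕ → ℤ) : EvZero fun i => c i • f i := by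
  obtain ⟨I, hI⟩ := hf
  exact ⟨I, fun i hi => by simp [hI i hi]⟩

theorem EvZero.succ {f : ℕ → M} (hf : EvZero f) : EvZero fun i => f (i + 1) := by
  obtain ⟨I, hI⟩ := hf
  exact ⟨I, fun i hi => hI _ (by omega)⟩

theorem finsum_succ {f : ℕ → M} (hf : EvZero f) : ∑ᶠ i, f i = f 0 + ∑ᶠ i, f (i + 1) := by
  obtain ⟨I, hI⟩ := hf
  rw [finsum_eq_range (I := I + 1) fun i hi => hI i (by omega),
    finsum_eq_range (I := I) fun i hi => hI (i + 1) (by omega), Finset.sum_range_succ', add_comm]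

theorem finsum_add' {f g : ℕ → M} (hf : EvZero f) (hg : EvZero g) :
    ∑ᶠ i, (f i + g i) = ∑ᶠ i, f i + ∑ᶠ i, g i := finsum_add_distrib hf.finite hg.finite

theorem finsum_sub' {f g : ℕ → M} (hf : EvZero f) (hg : EvZero g) :
    ∑ᶠ i, (f i - g i) = ∑ᶠ i, f i - ∑ᶠ i, g i := finsum_sub_distrib hf.finite hg.finite

theorem map_finsum' {F : Type*} [FunLike F M M'] [AddMonoidHomClass F M M'] (T : F) {f : ℕ → M}
    (hf : EvZero f) : T (∑ᶠ i, f i) = ∑ᶠ i, T (f i) :=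
  map_finsum T hf.finite

/-- The coefficient `(-1)^i (n choose i)` of `y^{n-i} z^i` in `(y - z)^n`. -/
def cf (n : ℤ) (i : ℕ) : ℤ := (-1) ^ i * Ring.choose n i

theorem cf_zero (n : ℤ) : cf n 0 = 1 := by simp [cf]

theorem choose_succ' (n : ℤ) (i : ℕ) :
    Ring.choose (n + 1) (i + 1) = Ring.choose n i + Ring.choose n (i + 1) :=
  Ring.choose_succ_succ n i

theorem cf_succ (n : ℤ) (i : ℕ) : cf (n + 1) (i + 1) = cf n (i + 1) - cf n i := by
  rw [cf, cf, cf, choose_succ', pow_succ]; ring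

theorem choose_zero_left (i : ℕ) : Ring.choose (0 : ℤ) (i + 1) = 0 := by
  simp

theorem cf_zero_left (i : ℕ) : cf 0 (i + 1) = 0 := by rw [cf, choose_zero_left, mul_zero]

theorem cf_nat_eq_zero (n i : ℕ) (h : n < i) : cf n i = 0 := by
  rw [cf, Ring.choose_natCast, Nat.choose_eq_zero_of_lt h]; simp

theorem choose_mul_succ (n : ℤ) (i : ℕ) :
    (i + 1) * Ring.choose n (i + 1) = n * Ring.choose (n - 1) i := by
  induction i generalizing n with
  | zero => simp
  | succ i ih =>
    -- both sides have the same difference in `n` and agree at `n = 0`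
    have key : ∀ m : ℤ, (((i + 1 : ℕ) : ℤ) + 1) * Ring.choose (m + 1) (i + 1 + 1)
        - (m + 1) * Ring.choose (m + 1 - 1) (i + 1) =
        (((i + 1 : ℕ) : ℤ) + 1) * Ring.choose m (i + 1 + 1) - m * Ring.choose (m - 1) (i + 1) := by
      intro m
      have h1 := choose_succ' m (i + 1)
      have h2 := choose_succ' (m - 1) i
      rw [sub_add_cancel] at h2
      have h3 := ih m
      rw [add_sub_cancel_right, h1]
      push_cast
      linear_combination h3 - m * h2
    suffices h : (((i + 1 : ℕ) : ℤ) + 1) * Ring.choose n (i + 1 + 1)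
        - n * Ring.choose (n - 1) (i + 1) = 0 from sub_eq_zero.1 h
    induction n using Int.induction_on with
    | zero => rw [choose_zero_left]; ring
    | succ k hk => rw [key]; exact hk
    | pred k hk =>
      have := key (-(k : ℤ) - 1)
      rw [sub_add_cancel] at this
      rw [← this]; exact hk

theorem cf_mul_succ (n : ℤ) (i : ℕ) : (i + 1) * cf n (i + 1) = -n * cf (n - 1) i := by
  have := choose_mul_succ n i
  rw [cf, cf, pow_succ]
  linear_combination (-1) ^ i * (-1) * this

theorem cf_sub_mul (n : ℤ) (i : ℕ) : (n - i) * cf n i = n * cf (n - 1) i := by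
  cases i with
  | zero => simp [cf_zero]
  | succ i =>
    have h1 := cf_succ (n - 1) i
    rw [sub_add_cancel] at h1
    have h2 := cf_mul_succ n i
    push_cast
    linear_combination n * h1 - h2

theorem cf_neg_one (i : ℕ) : cf (-1) i = 1 := by
  induction i with
  | zero => exact cf_zero _
  | succ i ih =>
    have := cf_succ (-1) i
    rw [neg_add_cancel, cf_zero_left, ih] at this
    omega

theorem negOnePow_succ' (n : ℤ) : ((n + 1).negOnePow : ℤ) = -(n.negOnePow : ℤ) := by
  rw [Int.negOnePow_succ]; simp

theorem finsum_cf_succ {f : ℕ → M} (hf : EvZero f) (n : ℤ) :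
    ∑ᶠ i, cf (n + 1) i • f i = ∑ᶠ i, cf n i • (f i - f (i + 1)) := by
  have e : ∀ i, cf n i • (f i - f (i + 1)) = cf n i • f i - cf n i • f (i + 1) :=
    fun i => smul_sub _ _ _
  rw [finsum_congr e, finsum_sub' (hf.smul _) (hf.succ.smul _), finsum_succ (hf.smul _),
    finsum_succ (hf.smul (cf n)), cf_zero, cf_zero, add_sub_assoc,
    ← finsum_sub' (hf.smul (cf n)).succ (hf.succ.smul _)]
  congr 1
  refine finsum_congr fun i => ?_
  rw [cf_succ, sub_smul]

theorem finsum_choose_succ {f : ℕ → M} (hf : EvZero f) (n : ℤ) :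
    ∑ᶠ i, Ring.choose (n + 1) i • f i = ∑ᶠ i, Ring.choose n i • (f i + f (i + 1)) := by
  have e : ∀ i, Ring.choose n i • (f i + f (i + 1)) =
      Ring.choose n i • f i + Ring.choose n i • f (i + 1) := fun i => smul_add _ _ _
  rw [finsum_congr e, finsum_add' (hf.smul _) (hf.succ.smul _),
    finsum_succ (hf.smul _), finsum_succ (hf.smul fun i => Ring.choose n i),
    Ring.choose_zero_right, Ring.choose_zero_right, add_assoc,
    ← finsum_add' (hf.smul fun i => Ring.choose n i).succ (hf.succ.smul _)]
  congr 1
  refine finsum_congr fun i => ?_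
  rw [choose_succ', add_smul, add_comm]

theorem finsum_cf_zero (f : ℕ → M) : ∑ᶠ i, cf 0 i • f i = f 0 := by
  rw [finsum_eq_range (I := 1)]
  · simp [cf_zero]
  · intro i hi
    obtain ⟨j, rfl⟩ := Nat.exists_eq_add_of_le' hi
    rw [cf_zero_left, zero_smul]

theorem finsum_choose_zero (f : ℕ → M) : ∑ᶠ i, Ring.choose (0 : ℤ) i • f i = f 0 := by
  rw [finsum_eq_range (I := 1)]
  · simp
  · intro i hi
    obtain ⟨j, rfl⟩ := Nat.exists_eq_add_of_le' hi
    rw [choose_zero_left, zero_smul]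

end EvZero

/-! ### Expansions of `(y - z)^n` applied to pairs of two-variable sequences -/

section Bor

variable {W W' : Type*} [AddCommGroup W] [Module ℂ W] [AddCommGroup W'] [Module ℂ W']

/-- The coefficients of `(y - z)^n φ₁(y, z) - (y - z)^n φ₂(y, z)`, where `(y - z)^n` is expanded in
the domain `|y| > |z|` in the first term and in the domain `|z| > |y|` in the second. -/
def bor2 (φ₁ φ₂ : ℤ → ℤ → W) (n p q : ℤ) : W :=
  ∑ᶠ i : ℕ, cf n i • (φ₁ (p + n - i) (q + i) - (n.negOnePow : ℤ) • φ₂ (p + i) (q + n - i))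

/-- The condition on `φ₁`, `φ₂` under which the sums in `bor2` are finite. -/
def Trunc2 (φ₁ φ₂ : ℤ → ℤ → W) : Prop :=
  ∀ p q : ℤ, ∃ I : ℕ, ∀ i : ℕ, I ≤ i → φ₁ (p - i) (q + i) = 0 ∧ φ₂ (p + i) (q - i) = 0

theorem Trunc2.evZero {φ₁ φ₂ : ℤ → ℤ → W} (h : Trunc2 φ₁ φ₂) (a p q r s : ℤ) :
    EvZero fun i : ℕ => φ₁ (p - i) (q + i) - a • φ₂ (r + i) (s - i) := by
  obtain ⟨I, hI⟩ := h p q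
  obtain ⟨J, hJ⟩ := h r s
  refine ⟨max I J, fun i hi => ?_⟩
  beta_reduce
  rw [(hI i (le_of_max_le_left hi)).1, (hJ i (le_of_max_le_right hi)).2, smul_zero, sub_zero]

theorem Trunc2.sub {φ₁ φ₂ ψ₁ ψ₂ : ℤ → ℤ → W} (h : Trunc2 φ₁ φ₂) (h' : Trunc2 ψ₁ ψ₂) :
    Trunc2 (fun p q => φ₁ p q - ψ₁ p q) (fun p q => φ₂ p q - ψ₂ p q) := by
  intro p q
  obtain ⟨I, hI⟩ := h p q
  obtain ⟨J, hJ⟩ := h' p q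
  refine ⟨max I J, fun i hi => ?_⟩
  have h1 := hI i (le_of_max_le_left hi)
  have h2 := hJ i (le_of_max_le_right hi)
  simp [h1, h2]

theorem Trunc2.shift {φ₁ φ₂ : ℤ → ℤ → W} (h : Trunc2 φ₁ φ₂) (a b : ℤ) :
    Trunc2 (fun p q => φ₁ (p + a) (q + b)) (fun p q => φ₂ (p + a) (q + b)) := by
  intro p q
  obtain ⟨I, hI⟩ := h (p + a) (q + b)
  refine ⟨I, fun i hi => ?_⟩
  have := hI i hi
  beta_reduce
  rwa [show p - (i : ℤ) + a = p + a - i by ring, show q + (i : ℤ) + b = q + b + i by ring,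
    show p + (i : ℤ) + a = p + a + i by ring, show q - (i : ℤ) + b = q + b - i by ring]

theorem bor2_sub {φ₁ φ₂ ψ₁ ψ₂ : ℤ → ℤ → W} (h : Trunc2 φ₁ φ₂) (h' : Trunc2 ψ₁ ψ₂) (n p q : ℤ) :
    bor2 (fun p q => φ₁ p q - ψ₁ p q) (fun p q => φ₂ p q - ψ₂ p q) n p q =
      bor2 φ₁ φ₂ n p q - bor2 ψ₁ ψ₂ n p q := by
  rw [bor2, bor2, bor2, ← finsum_sub' ((h.evZero _ _ _ _ _).smul _) ((h'.evZero _ _ _ _ _).smul _)]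
  refine finsum_congr fun i => ?_
  rw [← smul_sub]
  congr 1
  module

theorem bor2_shift (φ₁ φ₂ : ℤ → ℤ → W) (n p q a b : ℤ) :
    bor2 (fun p q => φ₁ (p + a) (q + b)) (fun p q => φ₂ (p + a) (q + b)) n p q =
      bor2 φ₁ φ₂ n (p + a) (q + b) := by
  refine finsum_congr fun i => ?_
  beta_reduce
  rw [show p + n - (i : ℤ) + a = p + a + n - i by ring,
    show q + (i : ℤ) + b = q + b + i by ring,
    show p + (i : ℤ) + a = p + a + i by ring, show q + n - (i : ℤ) + b = q + b + n - i by ring]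

theorem bor2_zero (φ₁ φ₂ : ℤ → ℤ → W) (p q : ℤ) : bor2 φ₁ φ₂ 0 p q = φ₁ p q - φ₂ p q := by
  rw [bor2, finsum_cf_zero]; simp

theorem bor2_map {F : Type*} [FunLike F W W'] [AddMonoidHomClass F W W'] (T : F)
    {φ₁ φ₂ : ℤ → ℤ → W} (h : Trunc2 φ₁ φ₂) (n p q : ℤ) :
    T (bor2 φ₁ φ₂ n p q) = bor2 (fun p q => T (φ₁ p q)) (fun p q => T (φ₂ p q)) n p q := by
  rw [bor2, map_finsum' _ ((h.evZero _ _ _ _ _).smul _)]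
  refine finsum_congr fun i => ?_
  rw [map_zsmul, map_sub, map_zsmul]

/-- Multiplication by `y - z`. -/
theorem bor2_succ {φ₁ φ₂ : ℤ → ℤ → W} (h : Trunc2 φ₁ φ₂) (n p q : ℤ) :
    bor2 φ₁ φ₂ (n + 1) p q = bor2 φ₁ φ₂ n (p + 1) q - bor2 φ₁ φ₂ n p (q + 1) := by
  rw [bor2, finsum_cf_succ (h.evZero _ _ _ _ _), bor2, bor2,
    ← finsum_sub' ((h.evZero _ _ _ _ _).smul _) ((h.evZero _ _ _ _ _).smul _)]
  refine finsum_congr fun i => ?_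
  rw [← smul_sub, negOnePow_succ']
  congr 1
  push_cast
  rw [show p + 1 + n - (i : ℤ) = p + (n + 1) - i by ring,
    show p + (n + 1) - ((i : ℤ) + 1) = p + n - i by ring,
    show q + (n + 1) - ((i : ℤ) + 1) = q + n - i by ring,
    show q + 1 + (i : ℤ) = q + (i + 1) by ring, show q + 1 + n - (i : ℤ) = q + (n + 1) - i by ring,
    show p + 1 + (i : ℤ) = p + (i + 1) by ring]
  module

/-! ### Fields on a vector space -/

theorem ncoeff_trunc (F : VertexOperator ℂ W) (w : W) :
    ∃ N : ℤ, ∀ n, N ≤ n → ncoeff F n w = 0 := by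
  refine ⟨-HahnSeries.order ((HahnModule.of ℂ).symm (F w)), fun n hn => ?_⟩
  exact VertexOperator.ncoeff_eq_zero_of_lt_order F n w (by omega)

theorem field_ext {F G : VertexOperator ℂ W} (h : ∀ n w, ncoeff F n w = ncoeff G n w) : F = G := by
  refine HVertexOperator.coeff_inj (funext fun n => LinearMap.ext fun w => ?_)
  rw [VertexOperator.coeff_eq_ncoeff, VertexOperator.coeff_eq_ncoeff]
  exact h _ _

/-- The field with given modes. -/
def mkField (f : ℤ → Module.End ℂ W) (hf : ∀ w, ∃ N : ℤ, ∀ n, N ≤ n → f n w = 0) :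
    VertexOperator ℂ W :=
  VertexOperator.of_coeff (fun n => f (-n - 1)) fun w => by
    obtain ⟨N, hN⟩ := hf w
    refine ⟨-N, fun n hn => ?_⟩
    by_contra h
    exact hn (hN _ (by omega))

@[simp]
theorem ncoeff_mkField (f : ℤ → Module.End ℂ W) (hf) (n : ℤ) : ncoeff (mkField f hf) n = f n := by
  rw [mkField, VertexOperator.ncoeff_of_coeff]
  congr 1
  ring

theorem trunc_nat (F : VertexOperator ℂ W) (w : W) (a : ℤ) :
    ∃ I : ℕ, ∀ i : ℕ, I ≤ i → ncoeff F (a + i) w = 0 := by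
  obtain ⟨N, hN⟩ := ncoeff_trunc F w
  exact ⟨(N - a).toNat, fun i hi => hN _ (by omega)⟩

theorem trunc2_field (F G : VertexOperator ℂ W) (w : W) :
    Trunc2 (fun p q => ncoeff F p (ncoeff G q w)) (fun p q => ncoeff G q (ncoeff F p w)) := by
  intro p q
  obtain ⟨I, hI⟩ := trunc_nat G w q
  obtain ⟨J, hJ⟩ := trunc_nat F w p
  refine ⟨max I J, fun i hi => ?_⟩
  simp [hI i (le_of_max_le_left hi), hJ i (le_of_max_le_right hi)]

/-- The right hand side of the Borcherds identity. -/
def bor (F G : VertexOperator ℂ W) (p q r : ℤ) (w : W) : W :=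
  bor2 (fun p q => ncoeff F p (ncoeff G q w)) (fun p q => ncoeff G q (ncoeff F p w)) r p q

theorem bor_succ (F G : VertexOperator ℂ W) (p q r : ℤ) (w : W) :
    bor F G p q (r + 1) w = bor F G (p + 1) q r w - bor F G p (q + 1) r w :=
  bor2_succ (trunc2_field F G w) r p q

theorem bor_zero (F G : VertexOperator ℂ W) (p q : ℤ) (w : W) :
    bor F G p q 0 w = ncoeff F p (ncoeff G q w) - ncoeff G q (ncoeff F p w) :=
  bor2_zero _ _ _ _

theorem bor_evZero (F G : VertexOperator ℂ W) (p q r : ℤ) (w : W) :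
    EvZero fun i : ℕ => ncoeff F (p + r - i) (ncoeff G (q + i) w) -
      (r.negOnePow : ℤ) • ncoeff G (q + r - i) (ncoeff F (p + i) w) :=
  (trunc2_field F G w).evZero _ _ _ _ _

theorem bor_add_left (F F' G : VertexOperator ℂ W) (p q r : ℤ) (w : W) :
    bor (F + F') G p q r w = bor F G p q r w + bor F' G p q r w := by
  rw [bor, bor, bor, bor2, bor2, bor2, ← finsum_add' ((bor_evZero F G _ _ _ _).smul _)
    ((bor_evZero F' G _ _ _ _).smul _)]
  refine finsum_congr fun i => ?_
  simp only [map_add, Pi.add_apply, LinearMap.add_apply]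
  module

theorem bor_add_right (F G G' : VertexOperator ℂ W) (p q r : ℤ) (w : W) :
    bor F (G + G') p q r w = bor F G p q r w + bor F G' p q r w := by
  rw [bor, bor, bor, bor2, bor2, bor2, ← finsum_add' ((bor_evZero F G _ _ _ _).smul _)
    ((bor_evZero F G' _ _ _ _).smul _)]
  refine finsum_congr fun i => ?_
  simp only [map_add, Pi.add_apply, LinearMap.add_apply]
  module

theorem bor_add_vec (F G : VertexOperator ℂ W) (p q r : ℤ) (w w' : W) :
    bor F G p q r (w + w') = bor F G p q r w + bor F G p q r w' := by
  rw [bor, bor, bor, bor2, bor2, bor2, ← finsum_add' ((bor_evZero F G _ _ _ _).smul _)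
    ((bor_evZero F G _ _ _ _).smul _)]
  refine finsum_congr fun i => ?_
  simp only [map_add]
  module

theorem bor_smul_left (c : ℂ) (F G : VertexOperator ℂ W) (p q r : ℤ) (w : W) :
    bor (c • F) G p q r w = c • bor F G p q r w := by
  rw [bor, bor, bor2, bor2, smul_finsum' c ((bor_evZero F G _ _ _ _).smul _).finite]
  refine finsum_congr fun i => ?_
  simp only [map_smul, Pi.smul_apply, LinearMap.smul_apply]
  module

theorem bor_smul_right (c : ℂ) (F G : VertexOperator ℂ W) (p q r : ℤ) (w : W) :
    bor F (c • G) p q r w = c • bor F G p q r w := by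
  rw [bor, bor, bor2, bor2, smul_finsum' c ((bor_evZero F G _ _ _ _).smul _).finite]
  refine finsum_congr fun i => ?_
  simp only [map_smul, Pi.smul_apply, LinearMap.smul_apply]
  module

theorem bor_smul_vec (c : ℂ) (F G : VertexOperator ℂ W) (p q r : ℤ) (w : W) :
    bor F G p q r (c • w) = c • bor F G p q r w := by
  rw [bor, bor, bor2, bor2, smul_finsum' c ((bor_evZero F G _ _ _ _).smul _).finite]
  refine finsum_congr fun i => ?_
  simp only [map_smul]
  module

/-- The `n`-th product `F_n G` of two fields. -/
def nprod (F G : VertexOperator ℂ W) (n : ℤ) : VertexOperator ℂ W :=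
  mkField (fun k => { toFun := bor F G 0 k n
                      map_add' := bor_add_vec F G 0 k n
                      map_smul' := fun c w => bor_smul_vec c F G 0 k n w }) <| by
    intro w
    obtain ⟨N, hN⟩ := ncoeff_trunc G w
    obtain ⟨I, hI⟩ := trunc_nat F w 0
    have : ∃ M : ℤ, ∀ i < I, ∀ m, M ≤ m → ncoeff G m (ncoeff F (0 + i) w) = 0 := by
      clear hI
      induction I with
      | zero => exact ⟨0, by simp⟩
      | succ I ih =>
        obtain ⟨M, hM⟩ := ih
        obtain ⟨M', hM'⟩ := ncoeff_trunc G (ncoeff F (0 + I) w)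
        refine ⟨max M M', fun i hi m hm => ?_⟩
        rcases Nat.lt_succ_iff_lt_or_eq.1 hi with h | rfl
        · exact hM i h m (le_of_max_le_left hm)
        · exact hM' m (le_of_max_le_right hm)
    obtain ⟨M, hM⟩ := this
    refine ⟨max N (M - n + I), fun k hk => ?_⟩
    have h1 := le_of_max_le_left hk
    have h2 := le_of_max_le_right hk
    change bor F G 0 k n w = 0
    refine (finsum_congr fun i => ?_).trans finsum_zero
    beta_reduce
    rw [hN (k + i) (by omega), map_zero, zero_sub]
    rcases lt_or_ge i I with h | h
    · rw [hM i h _ (by omega)]; simp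
    · rw [hI i h]; simp

theorem ncoeff_nprod (F G : VertexOperator ℂ W) (n k : ℤ) (w : W) :
    ncoeff (nprod F G n) k w = bor F G 0 k n w := by
  rw [nprod, ncoeff_mkField]; rfl

/-- The `n`-th product as a bilinear map. -/
def nprodL (n : ℤ) : VertexOperator ℂ W →ₗ[ℂ] VertexOperator ℂ W →ₗ[ℂ] VertexOperator ℂ W :=
  LinearMap.mk₂ ℂ (fun F G => nprod F G n)
    (fun F F' G => field_ext fun k w => by
      simp only [map_add, Pi.add_apply, LinearMap.add_apply, ncoeff_nprod, bor_add_left])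
    (fun c F G => field_ext fun k w => by
      simp only [map_smul, Pi.smul_apply, LinearMap.smul_apply, ncoeff_nprod, bor_smul_left])
    (fun F G G' => field_ext fun k w => by
      simp only [map_add, Pi.add_apply, LinearMap.add_apply, ncoeff_nprod, bor_add_right])
    (fun c F G => field_ext fun k w => by
      simp only [map_smul, Pi.smul_apply, LinearMap.smul_apply, ncoeff_nprod, bor_smul_right])

theorem nprodL_apply (n : ℤ) (F G : VertexOperator ℂ W) : nprodL n F G = nprod F G n := rfl

/-! ### Locality and the Borcherds identity for a local pair -/

/-- `(y - z)^N [F(y), G(z)] = 0`. -/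
def LocalAt (N : ℕ) (F G : VertexOperator ℂ W) : Prop :=
  ∀ (p q : ℤ) (w : W), bor F G p q N w = 0

/-- Two fields are mutually local if `(y - z)^N [F(y), G(z)] = 0` for some `N`. -/
def IsLocal (F G : VertexOperator ℂ W) : Prop := ∃ N, LocalAt N F G

theorem LocalAt.mono {N : ℕ} {F G : VertexOperator ℂ W} (h : LocalAt N F G) {M : ℕ} (hM : N ≤ M) :
    LocalAt M F G := by
  induction M, hM using Nat.le_induction with
  | base => exact h
  | succ M _ ih =>
    intro p q w
    rw [Nat.cast_succ, bor_succ, ih, ih, sub_zero]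

theorem LocalAt.nprod_eq_zero {N : ℕ} {F G : VertexOperator ℂ W} (h : LocalAt N F G) {n : ℤ}
    (hn : N ≤ n) : nprod F G n = 0 := by
  refine field_ext fun k w => ?_
  obtain ⟨m, rfl⟩ := Int.eq_ofNat_of_zero_le (show 0 ≤ n by omega)
  rw [ncoeff_nprod, h.mono (by omega)]
  simp

/-- The Borcherds identity for a pair of mutually local fields, with `n`-th products in place of the
vertex operators of products. Both sides satisfy the same recursion between consecutive values of
`p`, `q`, `r`, and vanish for large `r` by locality. -/
theorem borcherds_of_local {F G : VertexOperator ℂ W} (h : IsLocal F G) (p q r : ℤ) (w : W) :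
    ∑ᶠ i : ℕ, Ring.choose p i • ncoeff (nprod F G (r + i)) (p + q - i) w = bor F G p q r w := by
  obtain ⟨N, h⟩ := h
  set L : ℤ → ℤ → ℤ → W := fun p q r =>
    ∑ᶠ i : ℕ, Ring.choose p i • ncoeff (nprod F G (r + i)) (p + q - i) w with hL
  have ev : ∀ p r : ℤ, EvZero fun i : ℕ => ncoeff (nprod F G (r + i)) (p - i) w := by
    intro p r
    refine ⟨(N - r).toNat, fun i hi => ?_⟩
    beta_reduce
    rw [h.nprod_eq_zero (show (N : ℤ) ≤ r + i by omega)]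
    simp
  have Lsucc : ∀ p q r, L (p + 1) q r = L p (q + 1) r + L p q (r + 1) := by
    intro p q r
    simp only [hL]
    rw [finsum_choose_succ (ev _ _), ← finsum_add' ((ev _ _).smul _) ((ev _ _).smul _)]
    refine finsum_congr fun i => ?_
    rw [smul_add]
    push_cast
    rw [show p + 1 + q - (i : ℤ) = p + (q + 1) - i by ring,
      show p + 1 + q - ((i : ℤ) + 1) = p + q - i by ring,
      show r + ((i : ℤ) + 1) = r + 1 + i by ring]
  have L0 : ∀ q r, L 0 q r = bor F G 0 q r w := by
    intro q r
    simp only [hL]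
    rw [finsum_choose_zero, ncoeff_nprod]
    simp
  have top : ∀ p q r, (N : ℤ) ≤ r → L p q r = bor F G p q r w := by
    intro p q r hr
    obtain ⟨m, rfl⟩ := Int.eq_ofNat_of_zero_le (show 0 ≤ r by omega)
    rw [h.mono (show N ≤ m by omega)]
    refine (finsum_congr fun i => ?_).trans finsum_zero
    rw [h.nprod_eq_zero (by omega)]
    simp
  change L p q r = bor F G p q r w
  induction p using Int.induction_on generalizing q r with
  | zero => exact L0 q r
  | succ p ih => rw [Lsucc, ih, ih, bor_succ]; abel
  | pred p ih =>
    -- descending induction on `r`, starting where both sides vanish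
    have : ∀ k : ℕ, ∀ r q, (N : ℤ) ≤ r + k → L (-p - 1) q r = bor F G (-p - 1) q r w := by
      intro k
      induction k with
      | zero => intro r q hr; exact top _ _ _ (by simpa using hr)
      | succ k ihk =>
        intro r q hr
        have h1 := Lsucc (-p - 1) (q - 1) r
        have h2 := bor_succ F G (-p - 1) (q - 1) r w
        rw [sub_add_cancel, sub_add_cancel] at h1 h2
        rw [ih] at h1
        have h3 := ihk (r + 1) (q - 1) (by push_cast at hr; omega)
        rw [h3, h2] at h1
        have h4 : L (-p - 1) q r = bor F G (-p) (q - 1) r w -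
            (bor F G (-p) (q - 1) r w - bor F G (-p - 1) q r w) := eq_sub_of_add_eq h1.symm
        rw [h4, sub_sub_cancel]
    exact this (N - r).toNat r q (by omega)

end Bor

/-! ### Multiplication by differences of variables -/

section Nabla

variable {W W' : Type*} [AddCommGroup W] [Module ℂ W] [AddCommGroup W'] [Module ℂ W']

/-- Multiplication by `y - z` of two-variable sequences. -/
def nab : Module.End ℂ (ℤ → ℤ → W) where
  toFun φ p q := φ (p + 1) q - φ p (q + 1)
  map_add' φ ψ := by ext p q; simp only [Pi.add_apply]; abel
  map_smul' c φ := by ext p q; simp only [Pi.smul_apply, RingHom.id_apply, smul_sub]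

/-- Multiplication by `x - y` of sequences in the variables `x`, `y`, `z`. -/
def nab12 : Module.End ℂ (ℤ → ℤ → ℤ → W) where
  toFun φ a p q := φ (a + 1) p q - φ a (p + 1) q
  map_add' φ ψ := by ext a p q; simp only [Pi.add_apply]; abel
  map_smul' c φ := by ext a p q; simp only [Pi.smul_apply, RingHom.id_apply, smul_sub]

/-- Multiplication by `x - z` of sequences in the variables `x`, `y`, `z`. -/
def nab13 : Module.End ℂ (ℤ → ℤ → ℤ → W) where
  toFun φ a p q := φ (a + 1) p q - φ a p (q + 1)
  map_add' φ ψ := by ext a p q; simp only [Pi.add_apply]; abel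
  map_smul' c φ := by ext a p q; simp only [Pi.smul_apply, RingHom.id_apply, smul_sub]

/-- Multiplication by `y - z` of sequences in the variables `x`, `y`, `z`. -/
def nab23 : Module.End ℂ (ℤ → ℤ → ℤ → W) where
  toFun φ a p q := φ a (p + 1) q - φ a p (q + 1)
  map_add' φ ψ := by ext a p q; simp only [Pi.add_apply]; abel
  map_smul' c φ := by ext a p q; simp only [Pi.smul_apply, RingHom.id_apply, smul_sub]

theorem nab13_eq : (nab13 : Module.End ℂ (ℤ → ℤ → ℤ → W)) = nab12 + nab23 := by
  ext φ a p q
  simp [nab12, nab13, nab23]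

theorem commute_nab12_nab23 : Commute (nab12 : Module.End ℂ (ℤ → ℤ → ℤ → W)) nab23 := by
  ext φ a p q
  simp [nab12, nab23]
  abel

theorem commute_nab12_nab13 : Commute (nab12 : Module.End ℂ (ℤ → ℤ → ℤ → W)) nab13 := by
  rw [nab13_eq]
  exact (Commute.refl _).add_right commute_nab12_nab23

theorem add_pow_apply_eq_zero {X : Type*} [AddCommGroup X] [Module ℂ X] {A B : Module.End ℂ X}
    (hAB : Commute A B) {x : X} {N M K : ℕ} (h1 : (A ^ N) (((A + B) ^ M) x) = 0)
    (h2 : (B ^ K) x = 0) : ((A + B) ^ (N + K + M)) x = 0 := by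
  have hA : Commute A (A + B) := (Commute.refl _).add_right hAB
  have hB : Commute B (A + B) := hAB.symm.add_right (Commute.refl _)
  rw [pow_add, hAB.add_pow, Module.End.mul_apply, LinearMap.sum_apply]
  refine Finset.sum_eq_zero fun i hi => ?_
  rw [← (Nat.cast_commute _ _).eq, Module.End.mul_apply]
  suffices h : (A ^ i * B ^ (N + K - i)) (((A + B) ^ M) x) = 0 by
    rw [h, map_zero]
  rcases le_or_gt N i with h | h
  · obtain ⟨j, rfl⟩ := Nat.exists_eq_add_of_le' h
    rw [pow_add, mul_assoc, (hAB.pow_pow N _).eq, Module.End.mul_apply, Module.End.mul_apply, h1,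
      map_zero, map_zero]
  · obtain ⟨j, hj⟩ := Nat.exists_eq_add_of_le' (show K ≤ N + K - i by omega)
    rw [hj, pow_add, Module.End.mul_apply, Module.End.mul_apply]
    have : (B ^ K) (((A + B) ^ M) x) = 0 := by
      rw [← Module.End.mul_apply, (hB.pow_pow K M).eq, Module.End.mul_apply, h2, map_zero]
    rw [this, map_zero, map_zero]

/-- Since `x - z = (x - y) + (y - z)`, a series killed by powers of `(x - y) (x - z)` and of `y - z`
is killed by a power of `x - z`. -/
theorem nab13_pow_eq_zero {φ : ℤ → ℤ → ℤ → W} {N M K : ℕ}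
    (h1 : (nab12 ^ N) ((nab13 ^ M) φ) = 0) (h2 : (nab23 ^ K) φ = 0) :
    (nab13 ^ (N + K + M)) φ = 0 := by
  rw [nab13_eq] at h1 ⊢
  exact add_pow_apply_eq_zero commute_nab12_nab23 h1 h2

theorem nab_pow_map (T : W →ₗ[ℂ] W') (φ : ℤ → ℤ → W) (N : ℕ) :
    (nab ^ N) (fun p q => T (φ p q)) = fun p q => T ((nab ^ N) φ p q) := by
  induction N generalizing φ with
  | zero => rfl
  | succ N ih =>
    rw [pow_succ, Module.End.mul_apply, pow_succ, Module.End.mul_apply, ← ih]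
    congr 1
    ext p q
    simp [nab]

theorem nab12_pow_param (ψ : ℤ → ℤ → ℤ → W) (N : ℕ) :
    (nab12 ^ N) (fun a p q => ψ q a p) = fun a p q => (nab ^ N) (ψ q) a p := by
  induction N generalizing ψ with
  | zero => rfl
  | succ N ih =>
    simp only [pow_succ, Module.End.mul_apply]
    exact ih fun q => nab (ψ q)

theorem nab13_pow_param (ψ : ℤ → ℤ → ℤ → W) (N : ℕ) :
    (nab13 ^ N) (fun a p q => ψ p a q) = fun a p q => (nab ^ N) (ψ p) a q := by
  induction N generalizing ψ with
  | zero => rfl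
  | succ N ih =>
    simp only [pow_succ, Module.End.mul_apply]
    exact ih fun p => nab (ψ p)

theorem nab23_pow_param (ψ : ℤ → ℤ → ℤ → W) (N : ℕ) :
    (nab23 ^ N) ψ = fun a p q => (nab ^ N) (ψ a) p q := by
  induction N generalizing ψ with
  | zero => rfl
  | succ N ih =>
    simp only [pow_succ, Module.End.mul_apply]
    exact ih fun a => nab (ψ a)

theorem nab_pow_bor (F G : VertexOperator ℂ W) (n : ℤ) (w : W) (k : ℕ) :
    (nab ^ k) (fun p q => bor F G p q n w) = fun p q => bor F G p q (n + k) w := by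
  induction k generalizing n with
  | zero => simp
  | succ k ih =>
    rw [pow_succ, Module.End.mul_apply]
    have : nab (fun p q => bor F G p q n w) = fun p q => bor F G p q (n + 1) w := by
      ext p q
      exact (bor_succ F G p q n w).symm
    rw [this, ih]
    ext p q
    push_cast
    rw [show n + 1 + (k : ℤ) = n + (k + 1) by ring]

/-- The commutator `[F_p, G_q] w`. -/
def comm (F G : VertexOperator ℂ W) (w : W) (p q : ℤ) : W :=
  ncoeff F p (ncoeff G q w) - ncoeff G q (ncoeff F p w)

theorem nab_pow_comm (F G : VertexOperator ℂ W) (w : W) (k : ℕ) :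
    (nab ^ k) (comm F G w) = fun p q => bor F G p q k w := by
  have := nab_pow_bor F G 0 w k
  simp only [bor_zero, zero_add] at this
  exact this

/-- Locality as vanishing of `(y - z)^N [F(y), G(z)]`. -/
theorem localAt_iff {N : ℕ} {F G : VertexOperator ℂ W} :
    LocalAt N F G ↔ ∀ w, (nab ^ N) (comm F G w) = 0 := by
  simp only [nab_pow_comm]
  exact ⟨fun h w => by ext p q; exact h p q w, fun h p q w => congrFun (congrFun (h w) p) q⟩

theorem LocalAt.symm {N : ℕ} {F G : VertexOperator ℂ W} (h : LocalAt N F G) : LocalAt N G F := by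
  have key : ∀ (k : ℕ) (p q : ℤ) (w : W),
      bor G F q p k w = ((-1) ^ (k + 1) : ℤ) • bor F G p q k w := by
    intro k
    induction k with
    | zero => intro p q w; rw [Nat.cast_zero, bor_zero, bor_zero]; simp
    | succ k ih =>
      intro p q w
      rw [Nat.cast_succ, bor_succ, bor_succ, ih, ih, pow_succ _ (k + 1)]
      module
  intro p q w
  rw [key, h, smul_zero]

theorem IsLocal.symm {F G : VertexOperator ℂ W} (h : IsLocal F G) : IsLocal G F :=
  h.imp fun _ h => h.symm

/-! ### Dong's lemma -/

theorem nab12_bor2 {φ₁ φ₂ : ℤ → ℤ → ℤ → W} (h : ∀ a, Trunc2 (φ₁ a) (φ₂ a)) (n : ℤ) (N : ℕ) :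
    (nab12 ^ N) (fun a p q => bor2 (φ₁ a) (φ₂ a) n p q) =
        (fun a p q => bor2 ((nab12 ^ N) φ₁ a) ((nab12 ^ N) φ₂ a) n p q) ∧
      ∀ a, Trunc2 ((nab12 ^ N) φ₁ a) ((nab12 ^ N) φ₂ a) := by
  induction N generalizing φ₁ φ₂ with
  | zero => exact ⟨rfl, h⟩
  | succ N ih =>
    simp only [pow_succ, Module.End.mul_apply]
    have h' : ∀ a, Trunc2 (nab12 (W := W) φ₁ a) (nab12 (W := W) φ₂ a) := by
      intro a
      have := (h a).shift 1 0
      simp only [add_zero] at this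
      exact Trunc2.sub (h (a + 1)) this
    obtain ⟨b1, b2⟩ := ih (φ₁ := nab12 φ₁) (φ₂ := nab12 φ₂) h'
    rw [← b1]
    refine ⟨congrArg _ ?_, b2⟩
    ext a p q
    have := bor2_shift (φ₁ a) (φ₂ a) n p q 1 0
    have h2 := (h a).shift 1 0
    simp only [add_zero] at this h2
    change bor2 (φ₁ (a + 1)) (φ₂ (a + 1)) n p q - bor2 (φ₁ a) (φ₂ a) n (p + 1) q = _
    rw [← this, ← bor2_sub (h (a + 1)) h2]
    rfl

theorem nab13_bor2 {φ₁ φ₂ : ℤ → ℤ → ℤ → W} (h : ∀ a, Trunc2 (φ₁ a) (φ₂ a)) (n : ℤ) (N : ℕ) :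
    (nab13 ^ N) (fun a p q => bor2 (φ₁ a) (φ₂ a) n p q) =
        (fun a p q => bor2 ((nab13 ^ N) φ₁ a) ((nab13 ^ N) φ₂ a) n p q) ∧
      ∀ a, Trunc2 ((nab13 ^ N) φ₁ a) ((nab13 ^ N) φ₂ a) := by
  induction N generalizing φ₁ φ₂ with
  | zero => exact ⟨rfl, h⟩
  | succ N ih =>
    simp only [pow_succ, Module.End.mul_apply]
    have h' : ∀ a, Trunc2 (nab13 (W := W) φ₁ a) (nab13 (W := W) φ₂ a) := by
      intro a
      have := (h a).shift 0 1
      simp only [add_zero] at this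
      exact Trunc2.sub (h (a + 1)) this
    obtain ⟨b1, b2⟩ := ih (φ₁ := nab13 φ₁) (φ₂ := nab13 φ₂) h'
    rw [← b1]
    refine ⟨congrArg _ ?_, b2⟩
    ext a p q
    have := bor2_shift (φ₁ a) (φ₂ a) n p q 0 1
    have h2 := (h a).shift 0 1
    simp only [add_zero] at this h2
    change bor2 (φ₁ (a + 1)) (φ₂ (a + 1)) n p q - bor2 (φ₁ a) (φ₂ a) n p (q + 1) = _
    rw [← this, ← bor2_sub (h (a + 1)) h2]
    rfl

/-- Dong's lemma.  With `x`, `y`, `z` the variables of `H`, `F`, `G`, the commutator of `H(x)` with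
the series `(y - z)^n F(y) G(z) - (y - z)^n G(z) F(y)` is annihilated by a power of `y - z` and by
a power of `(x - y) (x - z)`, hence by a power of `x - z`. -/
theorem IsLocal.nprod {F G H : VertexOperator ℂ W} (hFG : IsLocal F G) (hFH : IsLocal F H)
    (hGH : IsLocal G H) (n : ℤ) : IsLocal (nprod F G n) H := by
  obtain ⟨K, hK⟩ := hFG
  obtain ⟨N, hN⟩ := hFH
  obtain ⟨M, hM⟩ := hGH
  refine IsLocal.symm ⟨N + (K - n).toNat + M, localAt_iff.2 fun w => ?_⟩
  set E : ℤ → ℤ → ℤ → W := fun a p q =>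
    ncoeff H a (bor F G p q n w) - bor F G p q n (ncoeff H a w) with hE
  have h2 : (nab23 ^ (K - n).toNat) E = 0 := by
    have e : E = (fun a p q => ncoeff H a (bor F G p q n w)) -
        (fun a p q => bor F G p q n (ncoeff H a w)) := rfl
    obtain ⟨m, hm⟩ := Int.eq_ofNat_of_zero_le (show 0 ≤ n + (K - n).toNat by omega)
    rw [e, map_sub, nab23_pow_param, nab23_pow_param]
    ext a p q
    simp only [Pi.sub_apply, nab_pow_map, nab_pow_bor]
    rw [hm, hK.mono (show K ≤ m by omega), hK.mono (show K ≤ m by omega)]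
    simp
  set φ₁ : ℤ → ℤ → ℤ → W := fun a p q =>
    ncoeff H a (ncoeff F p (ncoeff G q w)) - ncoeff F p (ncoeff G q (ncoeff H a w)) with hφ₁
  set φ₂ : ℤ → ℤ → ℤ → W := fun a p q =>
    ncoeff H a (ncoeff G q (ncoeff F p w)) - ncoeff G q (ncoeff F p (ncoeff H a w)) with hφ₂
  have t1 : ∀ a, Trunc2 (fun p q => ncoeff H a (ncoeff F p (ncoeff G q w)))
      (fun p q => ncoeff H a (ncoeff G q (ncoeff F p w))) := by
    intro a p q
    obtain ⟨I, hI⟩ := trunc2_field F G w p q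
    exact ⟨I, fun i hi => by simp [hI i hi]⟩
  have t : ∀ a, Trunc2 (φ₁ a) (φ₂ a) := fun a => (t1 a).sub (trunc2_field F G (ncoeff H a w))
  have hE' : E = fun a p q => bor2 (φ₁ a) (φ₂ a) n p q := by
    ext a p q
    rw [hE, hφ₁, hφ₂]
    beta_reduce
    rw [bor2_sub (t1 a) (trunc2_field F G _), ← bor2_map (ncoeff H a) (trunc2_field F G w)]
    rfl
  have hNF := localAt_iff.1 hN.symm
  have hMG := localAt_iff.1 hM.symm
  have c := (commute_nab12_nab13 (W := W)).pow_pow N M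
  have z1 : (nab12 ^ N) ((nab13 ^ M) φ₁) = 0 := by
    have e : φ₁ = (fun a p q => comm H F (ncoeff G q w) a p) +
        (fun a p q => ncoeff F p (comm H G w a q)) := by
      ext a p q
      simp [hφ₁, comm]
    have e1 : (nab12 ^ N) (fun a p q => comm H F (ncoeff G q w) a p) = 0 := by
      rw [nab12_pow_param fun q a p => comm H F (ncoeff G q w) a p]
      ext a p q
      rw [hNF]; rfl
    have e2 : (nab13 ^ M) (fun a p q => ncoeff F p (comm H G w a q)) = 0 := by
      rw [nab13_pow_param fun p a q => ncoeff F p (comm H G w a q)]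
      ext a p q
      rw [nab_pow_map, hMG]; simp
    rw [e, map_add, e2, add_zero, ← Module.End.mul_apply, c.eq, Module.End.mul_apply, e1, map_zero]
  have z2 : (nab12 ^ N) ((nab13 ^ M) φ₂) = 0 := by
    have e : φ₂ = (fun a p q => ncoeff G q (comm H F w a p)) +
        (fun a p q => comm H G (ncoeff F p w) a q) := by
      ext a p q
      simp [hφ₂, comm]
    have e1 : (nab12 ^ N) (fun a p q => ncoeff G q (comm H F w a p)) = 0 := by
      rw [nab12_pow_param fun q a p => ncoeff G q (comm H F w a p)]
      ext a p q
      rw [nab_pow_map, hNF]; simp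
    have e2 : (nab13 ^ M) (fun a p q => comm H G (ncoeff F p w) a q) = 0 := by
      rw [nab13_pow_param fun p a q => comm H G (ncoeff F p w) a q]
      ext a p q
      rw [hMG]; rfl
    rw [e, map_add, e2, add_zero, ← Module.End.mul_apply, c.eq, Module.End.mul_apply, e1, map_zero]
  have h1 : (nab12 ^ N) ((nab13 ^ M) E) = 0 := by
    obtain ⟨b1, b2⟩ := nab13_bor2 t n M
    obtain ⟨b3, -⟩ := nab12_bor2 b2 n N
    rw [hE', b1, b3, z1, z2]
    ext a p q
    simp [bor2]
  have h3 := nab13_pow_eq_zero h1 h2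
  have e : E = fun a p q => (fun p a q => E a p q) p a q := rfl
  rw [e, nab13_pow_param] at h3
  have h4 : comm H (Toroidal.nprod F G n) w = fun a q => E a 0 q := by
    ext a q
    simp only [comm, ncoeff_nprod, hE]
  rw [h4]
  ext a q
  exact congrFun (congrFun (congrFun h3 a) 0) q

end Nabla

/-! ### Locality of the operators `H ↦ F_n H` on fields -/

section Double

variable {W W' : Type*} [AddCommGroup W] [Module ℂ W] [AddCommGroup W'] [Module ℂ W']

theorem EvZero.map {F : Type*} [FunLike F W W'] [AddMonoidHomClass F W W'] {f : ℕ → W}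
    (hf : EvZero f) (T : F) : EvZero fun i => T (f i) :=
  hf.imp fun _ hI i hi => (congrArg T (hI i hi)).trans (map_zero T)

/-- Vanishing of a double sequence outside a finite square. -/
def EvZero2 (f : ℕ → ℕ → W) : Prop := ∃ M, ∀ j k, M ≤ j ∨ M ≤ k → f j k = 0

/-- The double sum `∑ⱼ ∑ₖ (-1)^{j+k} (p choose j) (q choose k) f j k`. -/
def dsum (p q : ℤ) (f : ℕ → ℕ → W) : W := ∑ᶠ j, cf p j • ∑ᶠ k, cf q k • f j k

theorem EvZero2.row {f : ℕ → ℕ → W} (h : EvZero2 f) (j : ℕ) : EvZero fun k => f j k :=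
  h.imp fun _ hM k hk => hM j k (Or.inr hk)

theorem EvZero2.row_sum {f : ℕ → ℕ → W} (h : EvZero2 f) (q : ℤ) :
    EvZero fun j => ∑ᶠ k, cf q k • f j k := by
  obtain ⟨M, hM⟩ := h
  refine ⟨M, fun j hj => (finsum_congr fun k => ?_).trans finsum_zero⟩
  rw [hM j k (Or.inl hj), smul_zero]

theorem EvZero2.add {f g : ℕ → ℕ → W} (hf : EvZero2 f) (hg : EvZero2 g) :
    EvZero2 fun j k => f j k + g j k := by
  obtain ⟨M, hM⟩ := hf
  obtain ⟨N, hN⟩ := hg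
  refine ⟨max M N, fun j k h => ?_⟩
  beta_reduce
  rw [hM j k (by omega), hN j k (by omega), add_zero]

theorem EvZero2.smul {f : ℕ → ℕ → W} (hf : EvZero2 f) (c : ℤ) : EvZero2 fun j k => c • f j k := by
  obtain ⟨M, hM⟩ := hf
  refine ⟨M, fun j k h => ?_⟩
  beta_reduce
  rw [hM j k h, smul_zero]

theorem EvZero2.sub {f g : ℕ → ℕ → W} (hf : EvZero2 f) (hg : EvZero2 g) :
    EvZero2 fun j k => f j k - g j k := by
  obtain ⟨M, hM⟩ := hf
  obtain ⟨N, hN⟩ := hg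
  refine ⟨max M N, fun j k h => ?_⟩
  beta_reduce
  rw [hM j k (by omega), hN j k (by omega), sub_zero]

theorem EvZero2.swap {f : ℕ → ℕ → W} (hf : EvZero2 f) : EvZero2 fun j k => f k j :=
  hf.imp fun _ hM j k h => hM k j h.symm

theorem EvZero2.succ_left {f : ℕ → ℕ → W} (hf : EvZero2 f) : EvZero2 fun j k => f (j + 1) k :=
  hf.imp fun _ hM j k h => hM (j + 1) k (by omega)

theorem EvZero2.succ_right {f : ℕ → ℕ → W} (hf : EvZero2 f) : EvZero2 fun j k => f j (k + 1) :=
  hf.imp fun _ hM j k h => hM j (k + 1) (by omega)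

theorem dsum_eq_range (p q : ℤ) {f : ℕ → ℕ → W} {M : ℕ} (h : ∀ j k, M ≤ j ∨ M ≤ k → f j k = 0) :
    dsum p q f = ∑ j ∈ Finset.range M, ∑ k ∈ Finset.range M, (cf p j * cf q k) • f j k := by
  have e : ∀ j, ∑ᶠ k, cf q k • f j k = ∑ k ∈ Finset.range M, cf q k • f j k := fun j =>
    finsum_eq_range fun k hk => by rw [h j k (Or.inr hk), smul_zero]
  rw [dsum, finsum_eq_range (I := M)]
  · refine Finset.sum_congr rfl fun j _ => ?_
    rw [e, Finset.smul_sum]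
    exact Finset.sum_congr rfl fun k _ => by rw [mul_smul]
  · intro j hj
    rw [e, Finset.sum_eq_zero fun k _ => by rw [h j k (Or.inl hj), smul_zero], smul_zero]

theorem dsum_swap (p q : ℤ) {f : ℕ → ℕ → W} (h : EvZero2 f) :
    dsum p q f = dsum q p fun k j => f j k := by
  obtain ⟨M, hM⟩ := h
  rw [dsum_eq_range p q hM, dsum_eq_range q p (M := M) fun k j h => hM j k h.symm,
    Finset.sum_comm]
  exact Finset.sum_congr rfl fun j _ => Finset.sum_congr rfl fun k _ => by rw [mul_comm]

theorem dsum_sub (p q : ℤ) {f g : ℕ → ℕ → W} (hf : EvZero2 f) (hg : EvZero2 g) :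
    dsum p q (fun j k => f j k - g j k) = dsum p q f - dsum p q g := by
  rw [dsum, dsum, dsum, ← finsum_sub' ((hf.row_sum q).smul _) ((hg.row_sum q).smul _)]
  refine finsum_congr fun j => ?_
  rw [← smul_sub, ← finsum_sub' ((hf.row j).smul _) ((hg.row j).smul _)]
  congr 1
  exact finsum_congr fun k => smul_sub _ _ _

theorem dsum_succ_left (p q : ℤ) {f : ℕ → ℕ → W} (hf : EvZero2 f) :
    dsum (p + 1) q f = dsum p q fun j k => f j k - f (j + 1) k := by
  rw [dsum_sub p q hf hf.succ_left, dsum, finsum_cf_succ (hf.row_sum q)]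
  rw [dsum, dsum, ← finsum_sub' ((hf.row_sum q).smul _) ((hf.succ_left.row_sum q).smul _)]
  exact finsum_congr fun j => smul_sub _ _ _

theorem dsum_succ_right (p q : ℤ) {f : ℕ → ℕ → W} (hf : EvZero2 f) :
    dsum p (q + 1) f = dsum p q fun j k => f j k - f j (k + 1) := by
  rw [dsum_swap _ _ hf, dsum_succ_left _ _ hf.swap, dsum_swap p q (hf.sub hf.succ_right)]

/-- The summand of the coefficients of
`(x - z)^p (y - z)^q ψ₁(x, y, z) + (x - z)^p (y - z)^q ψ₂(x, y, z)`, where in the first term the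
binomials are expanded in positive powers of `z`, in the second in positive powers of `x`, `y`. -/
def dterm (ψ₁ ψ₂ : ℤ → ℤ → ℤ → W) (p q : ℤ) (j k : ℕ) : W :=
  ψ₁ (p - j) (q - k) (j + k) + ((p + q).negOnePow : ℤ) • ψ₂ j k (p + q - j - k)

/-- The condition under which the double sums with terms `dterm` are finite. -/
def DTrunc (ψ₁ ψ₂ : ℤ → ℤ → ℤ → W) : Prop :=
  (∃ M : ℤ, ∀ a b m, M ≤ m → ψ₁ a b m = 0) ∧
    ∃ M : ℤ, ∀ a b m, 0 ≤ a → 0 ≤ b → M ≤ a ∨ M ≤ b → ψ₂ a b m = 0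

theorem DTrunc.evZero2 {ψ₁ ψ₂ : ℤ → ℤ → ℤ → W} (h : DTrunc ψ₁ ψ₂) (p q : ℤ) :
    EvZero2 (dterm ψ₁ ψ₂ p q) := by
  obtain ⟨⟨M, hM⟩, N, hN⟩ := h
  refine ⟨max M.toNat N.toNat, fun j k h => ?_⟩
  rw [dterm, hM _ _ _ (by omega), hN _ _ _ (by omega) (by omega) (by omega), smul_zero, add_zero]

theorem DTrunc.nab12 {ψ₁ ψ₂ : ℤ → ℤ → ℤ → W} (h : DTrunc ψ₁ ψ₂) :
    DTrunc (nab12 ψ₁) (nab12 ψ₂) := by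
  obtain ⟨⟨M, hM⟩, N, hN⟩ := h
  refine ⟨⟨M, fun a b m hm => ?_⟩, N, fun a b m ha hb h => ?_⟩
  · change ψ₁ _ _ _ - ψ₁ _ _ _ = 0
    rw [hM _ _ _ hm, hM _ _ _ hm, sub_zero]
  · change ψ₂ _ _ _ - ψ₂ _ _ _ = 0
    rw [hN _ _ _ (by omega) (by omega) (by omega), hN _ _ _ (by omega) (by omega) (by omega),
      sub_zero]

/-- Multiplication by `x - y = (x - z) - (y - z)` can be carried out under the double sum. -/
theorem nab_dsum {ψ₁ ψ₂ : ℤ → ℤ → ℤ → W} (h : DTrunc ψ₁ ψ₂) (N : ℕ) :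
    (nab ^ N) (fun p q => dsum p q (dterm ψ₁ ψ₂ p q)) =
      fun p q => dsum p q (dterm ((nab12 ^ N) ψ₁) ((nab12 ^ N) ψ₂) p q) := by
  induction N generalizing ψ₁ ψ₂ with
  | zero => rfl
  | succ N ih =>
    simp only [pow_succ, Module.End.mul_apply]
    rw [← ih h.nab12]
    congr 1
    ext p q
    change dsum (p + 1) q (dterm ψ₁ ψ₂ (p + 1) q) - dsum p (q + 1) (dterm ψ₁ ψ₂ p (q + 1)) = _
    have e1 := h.evZero2 (p + 1) q
    have e2 := h.evZero2 p (q + 1)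
    rw [dsum_succ_left _ _ e1, dsum_succ_right _ _ e2,
      ← dsum_sub _ _ (e1.sub e1.succ_left) (e2.sub e2.succ_right)]
    congr 1
    ext j k
    simp only [dterm, Toroidal.nab12, LinearMap.coe_mk, AddHom.coe_mk]
    push_cast
    rw [show p + 1 + q = p + q + 1 by ring, show p + (q + 1) = p + q + 1 by ring, negOnePow_succ',
      show p + 1 - ((j : ℤ) + 1) = p - j by ring, show q + 1 - ((k : ℤ) + 1) = q - k by ring,
      show p + 1 - (j : ℤ) = p - j + 1 by ring, show q + 1 - (k : ℤ) = q - k + 1 by ring,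
      show (j : ℤ) + 1 + k = j + (k + 1) by ring,
      show p + q + 1 - ((j : ℤ) + 1) - k = p + q - j - k by ring,
      show p + q + 1 - (j : ℤ) - (k + 1) = p + q - j - k by ring]
    module

theorem nab_dsum_eq_zero {ψ₁ ψ₂ : ℤ → ℤ → ℤ → W} (h : DTrunc ψ₁ ψ₂) {N : ℕ}
    (h1 : (nab12 ^ N) ψ₁ = 0) (h2 : (nab12 ^ N) ψ₂ = 0) :
    (nab ^ N) (fun p q => dsum p q (dterm ψ₁ ψ₂ p q)) = 0 := by
  rw [nab_dsum h, h1, h2]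
  ext p q
  simp [dsum, dterm]

/-! ### Iterated products as double sums -/

/-- Finitely many vectors have a common truncation bound. -/
theorem exists_bound (F : VertexOperator ℂ W) (v : ℕ → W) (a : ℕ → ℤ) (K : ℕ) :
    ∃ M : ℕ, ∀ k < K, ∀ i : ℕ, M ≤ i → ncoeff F (a k + i) (v k) = 0 := by
  induction K with
  | zero => exact ⟨0, by simp⟩
  | succ K ih =>
    obtain ⟨M, hM⟩ := ih
    obtain ⟨M', hM'⟩ := trunc_nat F (v K) (a K)
    refine ⟨max M M', fun k hk i hi => ?_⟩
    rcases Nat.lt_succ_iff_lt_or_eq.1 hk with h | rfl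
    · exact hM k h i (le_of_max_le_left hi)
    · exact hM' i (le_of_max_le_right hi)

/-- The summand of `F_p (G_q H)`. -/
def nestTerm (F G H : VertexOperator ℂ W) (p q c : ℤ) (w : W) (j k : ℕ) : W :=
  ncoeff F (p - j) (ncoeff G (q - k) (ncoeff H (c + j + k) w)) -
    (q.negOnePow : ℤ) • ncoeff F (p - j) (ncoeff H (q + c + j - k) (ncoeff G k w)) -
    (p.negOnePow : ℤ) • ncoeff G (q - k) (ncoeff H (p + c - j + k) (ncoeff F j w)) +
    ((p.negOnePow : ℤ) * q.negOnePow) •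
      ncoeff H (p + q + c - j - k) (ncoeff G k (ncoeff F j w))

/-- Each of the four parts of `nestTerm` has only finitely many nonzero terms. -/
theorem nestTerm_parts (F G H : VertexOperator ℂ W) (p q c : ℤ) (w : W) :
    (EvZero2 fun j k : ℕ => ncoeff F (p - j) (ncoeff G (q - k) (ncoeff H (c + j + k) w))) ∧
    (EvZero2 fun j k : ℕ => ncoeff F (p - j) (ncoeff H (q + c + j - k) (ncoeff G k w))) ∧
    (EvZero2 fun j k : ℕ => ncoeff G (q - k) (ncoeff H (p + c - j + k) (ncoeff F j w))) ∧
    (EvZero2 fun j k : ℕ => ncoeff H (p + q + c - j - k) (ncoeff G k (ncoeff F j w))) := by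
  obtain ⟨I, hI⟩ := trunc_nat H w c
  obtain ⟨J, hJ⟩ := trunc_nat F w 0
  obtain ⟨K, hK⟩ := trunc_nat G w 0
  simp only [zero_add] at hJ hK
  refine ⟨⟨I, fun j k h => ?_⟩, ?_, ?_, ?_⟩
  · have := hI (j + k) (by omega)
    push_cast at this
    beta_reduce
    rw [add_assoc, this]; simp
  · obtain ⟨M, hM⟩ := exists_bound H (fun k => ncoeff G k w) (fun k => q + c - k) K
    refine ⟨max M K, fun j k h => ?_⟩
    beta_reduce
    rcases lt_or_ge k K with hk | hk
    · have := hM k hk j (by omega)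
      rw [show q + c + (j : ℤ) - k = q + c - k + j by ring, this, map_zero]
    · rw [hK k hk]; simp
  · obtain ⟨M, hM⟩ := exists_bound H (fun j => ncoeff F j w) (fun j => p + c - j) J
    refine ⟨max M J, fun j k h => ?_⟩
    beta_reduce
    rcases lt_or_ge j J with hj | hj
    · rw [hM j hj k (by omega), map_zero]
    · rw [hJ j hj]; simp
  · obtain ⟨M, hM⟩ := exists_bound G (fun j => ncoeff F j w) (fun j => 0) J
    simp only [zero_add] at hM
    refine ⟨max M J, fun j k h => ?_⟩
    beta_reduce
    rcases lt_or_ge j J with hj | hj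
    · rw [hM j hj k (by omega), map_zero]
    · rw [hJ j hj]; simp

theorem nestTerm_evZero2 (F G H : VertexOperator ℂ W) (p q c : ℤ) (w : W) :
    EvZero2 (nestTerm F G H p q c w) := by
  obtain ⟨h1, h2, h3, h4⟩ := nestTerm_parts F G H p q c w
  exact ((h1.sub (h2.smul _)).sub (h3.smul _)).add (h4.smul _)

theorem ncoeff_nest (F G H : VertexOperator ℂ W) (p q c : ℤ) (w : W) :
    ncoeff (nprod F (nprod G H q) p) c w = dsum p q (nestTerm F G H p q c w) := by
  rw [ncoeff_nprod]
  refine finsum_congr fun j => ?_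
  congr 1
  beta_reduce
  rw [ncoeff_nprod, ncoeff_nprod]
  have e1 := (bor_evZero G H 0 (c + j) q w).smul (cf q)
  have e2 := (bor_evZero G H 0 (c + p - j) q (ncoeff F (0 + j) w)).smul (cf q)
  have m1 := e1.map (ncoeff F (0 + p - j))
  have m2 := e2.smul fun _ => (p.negOnePow : ℤ)
  rw [bor, bor, bor2, bor2]
  rw [map_finsum' _ e1, smul_finsum' (p.negOnePow : ℤ) e2.finite, ← finsum_sub' m1 m2]
  refine finsum_congr fun k => ?_
  rw [map_zsmul, map_sub, map_zsmul, nestTerm]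
  simp only [zero_add]
  rw [show c + p - (j : ℤ) + k = p + c - j + k by ring,
    show c + (j : ℤ) + q - k = q + c + j - k by ring,
    show c + p - (j : ℤ) + q - k = p + q + c - j - k by ring]
  module

/-- If two fields are mutually local, so are the operator-valued series `∑ₙ F_n z^{-n-1}` and
`∑ₙ G_n z^{-n-1}` acting on fields. -/
theorem nab_pow_nprod_comm {N : ℕ} {F G : VertexOperator ℂ W} (h : LocalAt N F G)
    (H : VertexOperator ℂ W) :
    (nab ^ N) (fun p q => nprod F (nprod G H q) p - nprod G (nprod F H p) q) = 0 := by
  ext p q : 2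
  refine field_ext fun c w => ?_
  let T : VertexOperator ℂ W →ₗ[ℂ] W :=
    { toFun := fun F => ncoeff F c w
      map_add' := fun F F' => by simp
      map_smul' := fun a F => by simp }
  have hT : ∀ F, T F = ncoeff F c w := fun _ => rfl
  simp only [Pi.zero_apply, map_zero, LinearMap.zero_apply]
  rw [← hT]
  have e := congrFun (congrFun (nab_pow_map T
    (fun p q => nprod F (nprod G H q) p - nprod G (nprod F H p) q) N) p) q
  rw [← e]
  set ψ₁ : ℤ → ℤ → ℤ → W := fun a b m => comm F G (ncoeff H (c + m) w) a b with hψ₁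
  set ψ₂ : ℤ → ℤ → ℤ → W := fun a b m => ncoeff H (c + m) (-comm F G w a b) with hψ₂
  have tr : DTrunc ψ₁ ψ₂ := by
    constructor
    · obtain ⟨M, hM⟩ := ncoeff_trunc H w
      refine ⟨M - c, fun a b m hm => ?_⟩
      simp only [hψ₁, comm]
      rw [hM _ (by omega)]; simp
    · obtain ⟨J, hJ⟩ := trunc_nat F w 0
      obtain ⟨K, hK⟩ := trunc_nat G w 0
      obtain ⟨M, hM⟩ := exists_bound G (fun j => ncoeff F j w) (fun j => 0) J
      obtain ⟨M', hM'⟩ := exists_bound F (fun j => ncoeff G j w) (fun j => 0) K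
      simp only [zero_add] at hM hM' hJ hK
      refine ⟨max (max J K) (max M M') , fun a b m ha hb h => ?_⟩
      obtain ⟨j, rfl⟩ := Int.eq_ofNat_of_zero_le ha
      obtain ⟨k, rfl⟩ := Int.eq_ofNat_of_zero_le hb
      simp only [hψ₂, comm]
      have z1 : ncoeff G k (ncoeff F j w) = 0 := by
        rcases lt_or_ge j J with hj | hj
        · rw [hM j hj k (by omega)]
        · rw [hJ j hj]; simp
      have z2 : ncoeff F j (ncoeff G k w) = 0 := by
        rcases lt_or_ge k K with hj | hj
        · rw [hM' k hj j (by omega)]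
        · rw [hK k hj]; simp
      rw [z1, z2]; simp
  have n1 : (nab12 ^ N) ψ₁ = 0 := by
    rw [hψ₁, nab12_pow_param fun q a p => comm F G (ncoeff H (c + q) w) a p]
    ext a b m
    rw [localAt_iff.1 h]; rfl
  have n2 : (nab12 ^ N) ψ₂ = 0 := by
    rw [hψ₂, nab12_pow_param fun q a p => ncoeff H (c + q) (-comm F G w a p)]
    ext a b m
    rw [nab_pow_map]
    have : (fun p q => -comm F G w p q) = -comm F G w := rfl
    rw [this, map_neg, localAt_iff.1 h]; simp
  refine (congrFun (congrFun (congrArg (nab ^ N) ?_) p) q).trans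
    (congrFun (congrFun (nab_dsum_eq_zero tr n1 n2) p) q)
  ext p q
  rw [map_sub, hT, hT, ncoeff_nest, ncoeff_nest, dsum_swap q p (nestTerm_evZero2 G F H q p c w),
    ← dsum_sub _ _ (nestTerm_evZero2 F G H p q c w) (nestTerm_evZero2 G F H q p c w).swap]
  congr 1
  ext j k
  simp only [nestTerm, dterm, hψ₁, hψ₂, comm, Int.negOnePow_add, Units.val_mul]
  rw [show c + (k : ℤ) + j = c + (j + k) by ring, show c + (j : ℤ) + k = c + (j + k) by ring,
    show p + c + (k : ℤ) - j = p + c - j + k by ring,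
    show q + c - (k : ℤ) + j = q + c + j - k by ring,
    show q + p + c - (k : ℤ) - j = c + (p + q - j - k) by ring,
    show p + q + c - (j : ℤ) - k = c + (p + q - j - k) by ring]
  simp only [neg_sub, map_sub]
  module

end Double

/-! ### The identity field and the derivative of a field -/

section Derivative

variable {W : Type*} [AddCommGroup W] [Module ℂ W]

/-- The identity field. -/
def idField (W : Type*) [AddCommGroup W] [Module ℂ W] : VertexOperator ℂ W :=
  mkField (fun n => if n = -1 then 1 else 0) fun w => ⟨0, fun n hn => by
    rw [if_neg (by omega)]; rfl⟩

theorem ncoeff_idField (n : ℤ) : ncoeff (idField W) n = if n = -1 then 1 else 0 := by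
  rw [idField, ncoeff_mkField]

theorem localAt_idField (F : VertexOperator ℂ W) : LocalAt 0 F (idField W) := by
  intro p q w
  rw [Nat.cast_zero, bor_zero, ncoeff_idField]
  split_ifs <;> simp

theorem isLocal_idField (F : VertexOperator ℂ W) : IsLocal F (idField W) := ⟨0, localAt_idField F⟩

theorem nprod_idField_of_nonneg (F : VertexOperator ℂ W) {n : ℤ} (hn : 0 ≤ n) :
    nprod F (idField W) n = 0 :=
  (localAt_idField F).nprod_eq_zero (by simpa using hn)

theorem nprod_idField (F : VertexOperator ℂ W) : nprod F (idField W) (-1) = F := by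
  refine field_ext fun k w => ?_
  rw [ncoeff_nprod, bor, bor2]
  simp only [ncoeff_idField, cf_neg_one, one_smul, Int.negOnePow_neg, Int.negOnePow_one]
  rcases le_or_gt 0 k with h | h
  · rw [finsum_eq_single _ k.toNat]
    · rw [if_neg (by omega), if_pos (by omega)]
      simp [h]
    · intro i hi
      rw [if_neg (by omega), if_neg (by omega)]
      simp
  · rw [finsum_eq_single _ (-1 - k).toNat]
    · rw [if_pos (by omega), if_neg (by omega)]
      have : (0 + -1 - ((-1 - k).toNat : ℤ)) = k := by omega
      rw [this]
      simp
    · intro i hi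
      rw [if_neg (by omega), if_neg (by omega)]
      simp

theorem idField_nprod (G : VertexOperator ℂ W) (n : ℤ) :
    nprod (idField W) G n = if n = -1 then G else 0 := by
  refine field_ext fun k w => ?_
  rw [ncoeff_nprod, bor, bor2]
  simp only [ncoeff_idField]
  rcases lt_trichotomy n (-1) with h | rfl | h
  · rw [if_neg (by omega)]
    refine (finsum_congr fun i => ?_).trans (finsum_zero.trans (by simp))
    rw [if_neg (by omega), if_neg (by omega)]
    simp
  · rw [if_pos rfl, finsum_eq_single _ 0]
    · rw [if_pos (by omega), if_neg (by omega), cf_zero]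
      simp
    · intro i hi
      rw [if_neg (by omega), if_neg (by omega)]
      simp
  · rw [if_neg (by omega)]
    obtain ⟨m, rfl⟩ := Int.eq_ofNat_of_zero_le (show 0 ≤ n by omega)
    refine (finsum_congr fun i => ?_).trans (finsum_zero.trans (by simp))
    rw [if_neg (show ¬ (0 + (i : ℤ) = -1) by omega)]
    split_ifs with h'
    · rw [cf_nat_eq_zero m i (by omega), zero_smul]
    · simp

/-- The formal derivative of a field. -/
def dField (F : VertexOperator ℂ W) : VertexOperator ℂ W :=
  mkField (fun n => (-n) • ncoeff F (n - 1)) fun w => by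
    obtain ⟨N, hN⟩ := ncoeff_trunc F w
    refine ⟨N + 1, fun n hn => ?_⟩
    rw [LinearMap.smul_apply, hN _ (by omega), smul_zero]

theorem ncoeff_dField (F : VertexOperator ℂ W) (n : ℤ) (w : W) :
    ncoeff (dField F) n w = (-n) • ncoeff F (n - 1) w := by
  rw [dField, ncoeff_mkField, LinearMap.smul_apply]

/-- The derivative as a linear map. -/
def dFieldL (W : Type*) [AddCommGroup W] [Module ℂ W] :
    VertexOperator ℂ W →ₗ[ℂ] VertexOperator ℂ W where
  toFun := dField
  map_add' F G := field_ext fun n w => by simp [ncoeff_dField]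
  map_smul' c F := field_ext fun n w => by
    simp only [RingHom.id_apply, map_smul, Pi.smul_apply, LinearMap.smul_apply, ncoeff_dField]
    rw [smul_comm]

theorem dField_idField : dField (idField W) = 0 := by
  refine field_ext fun n w => ?_
  rw [ncoeff_dField, ncoeff_idField]
  split_ifs with h
  · rw [show n = 0 by omega]; simp
  · simp

/-- Summation by parts for the coefficients `cf`. -/
theorem finsum_cf_parts {M : Type*} [AddCommGroup M] {f : ℕ → M} (hf : EvZero f) (n : ℤ) :
    ∑ᶠ i : ℕ, cf n i • ((i : ℤ) • f i) = -n • ∑ᶠ i : ℕ, cf (n - 1) i • f (i + 1) := by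
  rw [finsum_succ ((hf.smul _).smul _), smul_finsum' (-n) (hf.succ.smul _).finite]
  simp only [Nat.cast_zero, zero_smul, smul_zero, zero_add]
  refine finsum_congr fun i => ?_
  rw [smul_smul, smul_smul, ← cf_mul_succ]
  push_cast
  rw [mul_comm]

theorem finsum_cf_parts' {M : Type*} [AddCommGroup M] {f : ℕ → M} (hf : EvZero f) (n : ℤ) :
    ∑ᶠ i : ℕ, cf n i • ((n - i : ℤ) • f i) = n • ∑ᶠ i : ℕ, cf (n - 1) i • f i := by
  rw [smul_finsum' n (hf.smul _).finite]
  refine finsum_congr fun i => ?_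
  rw [smul_smul, smul_smul, ← cf_sub_mul, mul_comm]

theorem ev_left (F G : VertexOperator ℂ W) (p q : ℤ) (w : W) :
    EvZero fun i : ℕ => ncoeff F (p - i) (ncoeff G (q + i) w) := by
  obtain ⟨I, hI⟩ := trunc2_field F G w p q
  exact ⟨I, fun i hi => (hI i hi).1⟩

theorem ev_right (F G : VertexOperator ℂ W) (p q : ℤ) (w : W) :
    EvZero fun i : ℕ => ncoeff G (q - i) (ncoeff F (p + i) w) := by
  obtain ⟨I, hI⟩ := trunc2_field F G w p q
  exact ⟨I, fun i hi => (hI i hi).2⟩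

/-- The two halves of the `n`-th product as separate sums. -/
theorem ncoeff_nprod_split (F G : VertexOperator ℂ W) (n k : ℤ) (w : W) :
    ncoeff (nprod F G n) k w = ∑ᶠ i : ℕ, cf n i • ncoeff F (n - i) (ncoeff G (k + i) w) -
      (n.negOnePow : ℤ) • ∑ᶠ i : ℕ, cf n i • ncoeff G (k + n - i) (ncoeff F i w) := by
  have h := (ev_right F G 0 (k + n) w).smul (cf n)
  simp only [zero_add] at h
  rw [ncoeff_nprod, bor, bor2, smul_finsum' _ h.finite,
    ← finsum_sub' ((ev_left F G n k w).smul (cf n)) (h.smul fun _ => (n.negOnePow : ℤ))]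
  refine finsum_congr fun i => ?_
  simp only [zero_add]
  module

/-- `(∂F)_n G = -n F_{n-1} G`. -/
theorem nprod_dField_left (F G : VertexOperator ℂ W) (n : ℤ) :
    nprod (dField F) G n = -n • nprod F G (n - 1) := by
  refine field_ext fun k w => ?_
  have e1 := finsum_cf_parts' (ev_left F G (n - 1) k w) n
  have h2 : EvZero fun i : ℕ => ncoeff G (k + n - i) (ncoeff F (i - 1) w) := by
    have := ev_right F G (-1) (k + n) w
    simpa only [neg_add_eq_sub] using this
  have e2 := finsum_cf_parts h2 n
  have s := negOnePow_succ' (n - 1)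
  rw [sub_add_cancel] at s
  rw [map_zsmul, Pi.smul_apply, LinearMap.smul_apply, ncoeff_nprod_split, ncoeff_nprod_split, s]
  have f1 : ∑ᶠ i : ℕ, cf n i • ncoeff (dField F) (n - i) (ncoeff G (k + i) w) =
      -(n • ∑ᶠ i : ℕ, cf (n - 1) i • ncoeff F (n - 1 - i) (ncoeff G (k + i) w)) := by
    rw [← e1, ← finsum_neg_distrib]
    refine finsum_congr fun i => ?_
    rw [ncoeff_dField, show n - (i : ℤ) - 1 = n - 1 - i by ring]
    module
  have f2 : ∑ᶠ i : ℕ, cf n i • ncoeff G (k + n - i) (ncoeff (dField F) i w) =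
      n • ∑ᶠ i : ℕ, cf (n - 1) i • ncoeff G (k + (n - 1) - i) (ncoeff F i w) := by
    have : ∀ i : ℕ, ncoeff G (k + (n - 1) - i) (ncoeff F i w) =
        ncoeff G (k + n - ((i + 1 : ℕ) : ℤ)) (ncoeff F (((i + 1 : ℕ) : ℤ) - 1) w) := by
      intro i
      push_cast
      rw [show k + (n - 1) - (i : ℤ) = k + n - (i + 1) by ring, add_sub_cancel_right]
    simp only [this]
    rw [← neg_neg (n • _), ← neg_smul, ← e2, ← finsum_neg_distrib]
    refine finsum_congr fun i => ?_
    rw [ncoeff_dField, map_zsmul]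
    module
  rw [f1, f2]
  module

/-- The derivative is a derivation of all `n`-th products. -/
theorem dField_nprod (F G : VertexOperator ℂ W) (n : ℤ) :
    dField (nprod F G n) = -n • nprod F G (n - 1) + nprod F (dField G) n := by
  refine field_ext fun k w => ?_
  have h1 : EvZero fun i : ℕ => ncoeff F (n - i) (ncoeff G (k + i - 1) w) := by
    have := ev_left F G n (k - 1) w
    simpa only [show ∀ i : ℕ, k + (i : ℤ) - 1 = k - 1 + i by intro i; ring] using this
  have e1 := finsum_cf_parts h1 n
  have h2 : EvZero fun i : ℕ => ncoeff G (k + (n - 1) - i) (ncoeff F i w) := by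
    have := ev_right F G 0 (k + (n - 1)) w
    simpa only [zero_add] using this
  have e2 := finsum_cf_parts' h2 n
  have s := negOnePow_succ' (n - 1)
  rw [sub_add_cancel] at s
  have f1 : ∑ᶠ i : ℕ, cf n i • ncoeff F (n - i) (ncoeff (dField G) (k + i) w) =
      -k • ∑ᶠ i : ℕ, cf n i • ncoeff F (n - i) (ncoeff G (k - 1 + i) w) +
      n • ∑ᶠ i : ℕ, cf (n - 1) i • ncoeff F (n - 1 - i) (ncoeff G (k + i) w) := by
    have : ∀ i : ℕ, ncoeff F (n - 1 - i) (ncoeff G (k + i) w) =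
        ncoeff F (n - ((i + 1 : ℕ) : ℤ)) (ncoeff G (k + ((i + 1 : ℕ) : ℤ) - 1) w) := by
      intro i
      push_cast
      rw [show n - 1 - (i : ℤ) = n - (i + 1) by ring, ← add_assoc, add_sub_cancel_right]
    simp only [this]
    have h1' := ev_left F G n (k - 1) w
    rw [← neg_neg (n • _), ← neg_smul, ← e1, ← sub_eq_add_neg,
      smul_finsum' (-k) (h1'.smul _).finite,
      ← finsum_sub' ((h1'.smul _).smul fun _ => -k) ((h1.smul (fun i => (i : ℤ))).smul (cf n))]
    refine finsum_congr fun i => ?_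
    rw [ncoeff_dField, map_zsmul, show k - 1 + (i : ℤ) = k + i - 1 by ring]
    module
  have f2 : ∑ᶠ i : ℕ, cf n i • ncoeff (dField G) (k + n - i) (ncoeff F i w) =
      -k • ∑ᶠ i : ℕ, cf n i • ncoeff G (k - 1 + n - i) (ncoeff F i w) -
      n • ∑ᶠ i : ℕ, cf (n - 1) i • ncoeff G (k + (n - 1) - i) (ncoeff F i w) := by
    have h3 : EvZero fun i : ℕ => ncoeff G (k - 1 + n - i) (ncoeff F i w) := by
      have := ev_right F G 0 (k - 1 + n) w
      simpa only [zero_add] using this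
    rw [← e2, smul_finsum' (-k) (h3.smul _).finite,
      ← finsum_sub' ((h3.smul _).smul fun _ => -k) ((h2.smul fun i => n - i).smul _)]
    refine finsum_congr fun i => ?_
    rw [ncoeff_dField, show k - 1 + n - (i : ℤ) = k + n - i - 1 by ring,
      show k + (n - 1) - (i : ℤ) = k + n - i - 1 by ring]
    module
  rw [ncoeff_dField, map_add, Pi.add_apply, LinearMap.add_apply, map_zsmul, Pi.smul_apply,
    LinearMap.smul_apply, ncoeff_nprod_split, ncoeff_nprod_split, ncoeff_nprod_split, f1, f2, s]
  module

end Derivative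

/-! ### Vertex algebras from mutually local covariant vertex operators -/

/-- A state-field correspondence on `X` whose vertex operators are pairwise local, create their
states from the vacuum and are covariant under an operator `D` killing the vacuum.  By
`StateField.vertexAlgebra` these data form a vertex algebra. -/
structure StateField (X : Type*) [AddCommGroup X] [Module ℂ X] where
  /-- the vacuum vector -/
  vac : X
  /-- the vertex operator map -/
  Y : X →ₗ[ℂ] VertexOperator ℂ X
  /-- the translation operator -/
  D : X →ₗ[ℂ] X
  vac_mode : ∀ n : ℤ, ncoeff (Y vac) n = if n = -1 then 1 else 0
  creation : ∀ (F : X) (n : ℤ), 0 ≤ n → ncoeff (Y F) n vac = 0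
  creation_neg_one : ∀ F : X, ncoeff (Y F) (-1) vac = F
  D_vac : D vac = 0
  covariant : ∀ (F : X) (n : ℤ) (H : X),
    D (ncoeff (Y F) n H) = (-n) • ncoeff (Y F) (n - 1) H + ncoeff (Y F) n (D H)
  isLocal : ∀ F G : X, IsLocal (Y F) (Y G)

theorem IsLocal.sub_left {W : Type*} [AddCommGroup W] [Module ℂ W] {A B C : VertexOperator ℂ W}
    (hA : IsLocal A C) (hB : IsLocal B C) : IsLocal (A - B) C := by
  obtain ⟨N, hN⟩ := hA
  obtain ⟨M, hM⟩ := hB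
  refine ⟨max N M, fun p q w => ?_⟩
  have h1 := bor_add_left (A - B) B C p q (max N M : ℕ) w
  rw [sub_add_cancel, hN.mono (le_max_left N M), hM.mono (le_max_right N M), add_zero] at h1
  exact h1.symm

namespace StateField

variable {X : Type*} [AddCommGroup X] [Module ℂ X] (S : StateField X)

/-- Goddard's uniqueness: a field that is local with all `Y(H, z)` and kills the vacuum is `0`. -/
theorem eq_zero_of_vac {A : VertexOperator ℂ X} (h : ∀ H, IsLocal A (S.Y H))
    (h0 : ∀ n, ncoeff A n S.vac = 0) : A = 0 := by
  refine field_ext fun n H => ?_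
  obtain ⟨N, hN⟩ := h H
  have h1 : bor A (S.Y H) (n - N) (-1) N S.vac = ncoeff A n H := by
    refine (finsum_eq_single _ 0 fun i hi => ?_).trans ?_
    · beta_reduce
      rw [h0, S.creation H _ (by omega), map_zero, map_zero, smul_zero, sub_zero, smul_zero]
    · beta_reduce
      rw [h0, map_zero, smul_zero, sub_zero, cf_zero, one_smul, Nat.cast_zero, sub_zero, add_zero,
        S.creation_neg_one, sub_add_cancel]
  rw [← h1, hN, map_zero, Pi.zero_apply, LinearMap.zero_apply]

/-- Fields that are covariant under the translation operator. -/
def Covariant (A : VertexOperator ℂ X) : Prop :=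
  ∀ n H, S.D (ncoeff A n H) = ncoeff (dField A) n H + ncoeff A n (S.D H)

theorem covariant_Y (F : X) : S.Covariant (S.Y F) := by
  intro n H
  rw [ncoeff_dField]
  exact S.covariant F n H

theorem Covariant.nprod {S : StateField X} {A B : VertexOperator ℂ X} (hA : S.Covariant A)
    (hB : S.Covariant B) (r : ℤ) : S.Covariant (nprod A B r) := by
  intro n H
  have e1 := nprod_dField_left A B r
  have e2 := dField_nprod A B r
  rw [← e1] at e2
  rw [e2, map_add, Pi.add_apply, LinearMap.add_apply]
  simp only [ncoeff_nprod, bor]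
  rw [bor2_map _ (trunc2_field A B H)]
  rw [bor2, bor2, bor2, bor2, ← finsum_add' ((bor_evZero _ _ _ _ _ _).smul _)
    ((bor_evZero _ _ _ _ _ _).smul _), ← finsum_add'
    (((bor_evZero _ _ _ _ _ _).smul _).add ((bor_evZero _ _ _ _ _ _).smul _))
    ((bor_evZero _ _ _ _ _ _).smul _)]
  refine finsum_congr fun i => ?_
  rw [hA, hB, hB, hA, map_add, map_add]
  module

/-- Fields that are local with all vertex operators are determined by their values on the vacuum. -/
theorem eq_of_vac {A B : VertexOperator ℂ X} (hA : ∀ H, IsLocal A (S.Y H))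
    (hB : ∀ H, IsLocal B (S.Y H)) (h0 : ∀ n, ncoeff A n S.vac = ncoeff B n S.vac) : A = B := by
  rw [← sub_eq_zero]
  refine S.eq_zero_of_vac (fun H => (hA H).sub_left (hB H)) fun n => ?_
  rw [map_sub, Pi.sub_apply, LinearMap.sub_apply, h0, sub_self]

/-- `Y(F_r G, z) = Y(F, z)_r Y(G, z)`: both sides are covariant, local with all vertex operators
and create the same vector from the vacuum. -/
theorem Y_nprod (F G : X) (r : ℤ) :
    S.Y (ncoeff (S.Y F) r G) = nprod (S.Y F) (S.Y G) r := by
  refine S.eq_of_vac (fun H => S.isLocal _ H)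
    (fun H => (S.isLocal F G).nprod (S.isLocal F H) (S.isLocal G H) r) fun n => ?_
  rcases le_or_gt 0 n with hn | hn
  · rw [S.creation _ _ hn, ncoeff_nprod]
    refine ((finsum_congr fun i => ?_).trans finsum_zero).symm
    beta_reduce
    rw [S.creation G _ (by omega), S.creation F _ (by omega), map_zero, map_zero, smul_zero,
      sub_zero, smul_zero]
  · -- descending induction from `n = -1` by covariance
    obtain ⟨k, rfl⟩ : ∃ k : ℕ, n = -1 - k := ⟨(-1 - n).toNat, by omega⟩
    clear hn
    induction k with
    | zero =>
      rw [Nat.cast_zero, sub_zero, creation_neg_one, ncoeff_nprod, bor, bor2,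
        finsum_eq_single _ 0]
      · rw [S.creation F _ (show (0 : ℤ) ≤ 0 + (0 : ℕ) by simp), Nat.cast_zero, add_zero,
          creation_neg_one, cf_zero, map_zero, smul_zero, sub_zero, one_smul, sub_zero, zero_add]
      · intro i hi
        rw [S.creation F _ (by omega), S.creation G _ (by omega), map_zero, map_zero, smul_zero,
          sub_zero, smul_zero]
    | succ k ih =>
      have h1 := S.covariant_Y (ncoeff (S.Y F) r G) (-1 - k) S.vac
      have h2 := ((S.covariant_Y F).nprod (S.covariant_Y G) r) (-1 - k) S.vac
      rw [S.D_vac, map_zero, add_zero, ncoeff_dField] at h1 h2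
      rw [ih, h2] at h1
      have h3 : (-(-1 - (k : ℤ)) : ℤ) ≠ 0 := by omega
      have h4 : ((-(-1 - (k : ℤ)) : ℤ) : ℂ) ≠ 0 := Int.cast_ne_zero.2 h3
      rw [← Int.cast_smul_eq_zsmul ℂ, ← Int.cast_smul_eq_zsmul ℂ] at h1
      have h5 := smul_right_injective _ h4 h1
      push_cast
      rw [show (-1 - ((k : ℤ) + 1)) = -1 - k - 1 by ring]
      exact h5.symm

/-- The vertex algebra of a state-field correspondence. -/
def vertexAlgebra : VertexAlgebra X where
  vac := S.vac
  Y := S.Y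
  vac_mode := S.vac_mode
  creation := S.creation
  creation_neg_one := S.creation_neg_one
  borcherds F G H p q r := by
    have := borcherds_of_local (S.isLocal F G) p q r H
    simp only [← Y_nprod] at this
    exact this

end StateField

/-! ### Vertex algebras of mutually local fields -/

/-- The vertex operator map of a subspace closed under a family of bilinear products. -/
def subspaceY {X : Type*} [AddCommGroup X] [Module ℂ X] (U : Submodule ℂ X)
    (P : ℤ → X →ₗ[ℂ] X →ₗ[ℂ] X) (hP : ∀ F ∈ U, ∀ G ∈ U, ∀ n, P n F G ∈ U)
    (hT : ∀ F ∈ U, ∀ G ∈ U, ∃ N : ℤ, ∀ n, N ≤ n → P n F G = 0) : U →ₗ[ℂ] VertexOperator ℂ U where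
  toFun F := mkField
    (fun n =>
      { toFun := fun G => ⟨P n F.1 G.1, hP F.1 F.2 G.1 G.2 n⟩
        map_add' := fun G G' => Subtype.ext (map_add (P n F.1) G.1 G'.1)
        map_smul' := fun c G => Subtype.ext (map_smul (P n F.1) c G.1) }) fun G => by
      obtain ⟨N, hN⟩ := hT F.1 F.2 G.1 G.2
      exact ⟨N, fun n hn => Subtype.ext (hN n hn)⟩
  map_add' F F' := by
    refine field_ext fun n G => Subtype.ext ?_
    rw [map_add, Pi.add_apply, ncoeff_mkField, ncoeff_mkField, ncoeff_mkField]
    exact LinearMap.map_add₂ (P n) F.1 F'.1 G.1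
  map_smul' c F := by
    refine field_ext fun n G => Subtype.ext ?_
    rw [map_smul, Pi.smul_apply, ncoeff_mkField, ncoeff_mkField]
    exact LinearMap.map_smul₂ (P n) c F.1 G.1

theorem coe_ncoeff_subspaceY {X : Type*} [AddCommGroup X] [Module ℂ X] (U : Submodule ℂ X)
    (P : ℤ → X →ₗ[ℂ] X →ₗ[ℂ] X) (hP hT) (F G : U) (n : ℤ) :
    (ncoeff (subspaceY U P hP hT F) n G : X) = P n F.1 G.1 := by
  have h : ncoeff (subspaceY U P hP hT F) n = _ := ncoeff_mkField _ _ n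
  rw [h]
  rfl

/-- Locality on a subspace can be tested in the ambient space. -/
theorem isLocal_subspaceY {X : Type*} [AddCommGroup X] [Module ℂ X] (U : Submodule ℂ X)
    (P : ℤ → X →ₗ[ℂ] X →ₗ[ℂ] X) (hP hT) (F G : U) {N : ℕ}
    (h : ∀ H : X, (nab ^ N) (fun p q => P p F.1 (P q G.1 H) - P q G.1 (P p F.1 H)) = 0) :
    IsLocal (subspaceY U P hP hT F) (subspaceY U P hP hT G) := by
  refine ⟨N, localAt_iff.2 fun H => ?_⟩
  ext p q
  have h := congrFun (congrFun (h H.1) p) q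
  have e := congrFun (congrFun (nab_pow_map U.subtype
    (comm (subspaceY U P hP hT F) (subspaceY U P hP hT G) H) N) p) q
  rw [Submodule.subtype_apply] at e
  rw [← e]
  simp only [comm, map_sub, Submodule.subtype_apply, coe_ncoeff_subspaceY]
  exact h

/-- A state-field correspondence on a subspace closed under a family of bilinear products. -/
def StateField.ofSubspace {X : Type*} [AddCommGroup X] [Module ℂ X] (U : Submodule ℂ X)
    (P : ℤ → X →ₗ[ℂ] X →ₗ[ℂ] X) (hP : ∀ F ∈ U, ∀ G ∈ U, ∀ n, P n F G ∈ U)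
    (hT : ∀ F ∈ U, ∀ G ∈ U, ∃ N : ℤ, ∀ n, N ≤ n → P n F G = 0)
    (vac : X) (hvac : vac ∈ U) (D : X →ₗ[ℂ] X) (hD : ∀ F ∈ U, D F ∈ U)
    (h1 : ∀ n F, P n vac F = if n = -1 then F else 0) (h2 : ∀ F n, 0 ≤ n → P n F vac = 0)
    (h3 : ∀ F, P (-1) F vac = F) (h4 : D vac = 0)
    (h5 : ∀ F n H, D (P n F H) = (-n) • P (n - 1) F H + P n F (D H))
    (h6 : ∀ F ∈ U, ∀ G ∈ U, ∃ N : ℕ, ∀ H : X,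
      (nab ^ N) (fun p q => P p F (P q G H) - P q G (P p F H)) = 0) : StateField U where
  vac := ⟨vac, hvac⟩
  Y := subspaceY U P hP hT
  D := D.restrict hD
  vac_mode n := by
    refine LinearMap.ext fun F => Subtype.ext ?_
    rw [coe_ncoeff_subspaceY, h1]
    split_ifs <;> rfl
  creation F n hn := Subtype.ext <| by
    rw [coe_ncoeff_subspaceY, h2 _ _ hn]; rfl
  creation_neg_one F := Subtype.ext <| by
    rw [coe_ncoeff_subspaceY, h3]
  D_vac := Subtype.ext h4
  covariant F n H := Subtype.ext <| by
    rw [Submodule.coe_add, Submodule.coe_smul_of_tower, coe_ncoeff_subspaceY, coe_ncoeff_subspaceY,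
      LinearMap.coe_restrict_apply, coe_ncoeff_subspaceY]
    exact h5 _ _ _
  isLocal F G := by
    obtain ⟨N, hN⟩ := h6 F.1 F.2 G.1 G.2
    exact isLocal_subspaceY _ _ _ _ _ _ hN

/-- A space of pairwise local fields containing the identity and closed under all `n`-th
products. -/
structure IsFieldAlgebra {W : Type*} [AddCommGroup W] [Module ℂ W]
    (U : Submodule ℂ (VertexOperator ℂ W)) : Prop where
  id_mem : idField W ∈ U
  nprod_mem : ∀ F ∈ U, ∀ G ∈ U, ∀ n, nprod F G n ∈ U
  isLocal : ∀ F ∈ U, ∀ G ∈ U, IsLocal F G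

namespace IsFieldAlgebra

variable {W : Type*} [AddCommGroup W] [Module ℂ W]

variable {U : Submodule ℂ (VertexOperator ℂ W)} (hU : IsFieldAlgebra U)

theorem dField_mem (hU : IsFieldAlgebra U) {F : VertexOperator ℂ W} (hF : F ∈ U) :
    dField F ∈ U := by
  have h := dField_nprod F (idField W) (-1)
  have h0 : nprodL (-1) F (0 : VertexOperator ℂ W) = 0 := map_zero _
  rw [nprodL_apply] at h0
  rw [nprod_idField, dField_idField, h0, neg_neg, one_smul, add_zero] at h
  rw [h]
  exact hU.nprod_mem _ hF _ hU.id_mem _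

theorem trunc (hU : IsFieldAlgebra U) : ∀ F ∈ U, ∀ G ∈ U, ∃ N : ℤ, ∀ n, N ≤ n →
    nprodL n F G = 0 := fun F hF G hG => by
  obtain ⟨N, hN⟩ := hU.isLocal F hF G hG
  exact ⟨N, fun n hn => hN.nprod_eq_zero hn⟩

/-- The state-field correspondence `F ↦ ∑ₙ F_n z^{-n-1}` on a space of mutually local fields. -/
def stateField : StateField U :=
  .ofSubspace U nprodL (fun F hF G hG n => hU.nprod_mem F hF G hG n) hU.trunc (idField W) hU.id_mem
    (dFieldL W) (fun _ => hU.dField_mem) (fun n F => idField_nprod F n)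
    (fun F _ => nprod_idField_of_nonneg F) nprod_idField dField_idField
    (fun F n H => dField_nprod F H n) fun F hF G hG => by
      obtain ⟨N, hN⟩ := hU.isLocal F hF G hG
      exact ⟨N, nab_pow_nprod_comm hN⟩

/-- The vertex algebra structure on a space of mutually local fields. -/
def vertexAlgebra : VertexAlgebra U := hU.stateField.vertexAlgebra

theorem coe_ncoeff_Y (F G : U) (n : ℤ) :
    (ncoeff (hU.vertexAlgebra.Y F) n G : VertexOperator ℂ W) = nprod F.1 G.1 n :=
  coe_ncoeff_subspaceY U nprodL (fun F hF G hG n => hU.nprod_mem F hF G hG n) hU.trunc F G n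

end IsFieldAlgebra

/-! ### Module structures from local fields -/

section ModuleOfFields

variable {V W : Type*} [AddCommGroup V] [Module ℂ V] [AddCommGroup W] [Module ℂ W]

/-- A module structure from a linear map into pairwise local fields that is compatible with the
`n`-th products. -/
def VAModule.ofFields (A : VertexAlgebra V) (Y : V →ₗ[ℂ] VertexOperator ℂ W)
    (hv : Y A.vac = idField W) (hl : ∀ u v, IsLocal (Y u) (Y v))
    (hn : ∀ u v n, Y (ncoeff (A.Y u) n v) = nprod (Y u) (Y v) n) : VAModule A W where
  Y := Y
  vac_mode n := by rw [hv, ncoeff_idField]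
  borcherds u v w p q r := by
    have := borcherds_of_local (hl u v) p q r w
    simp only [← hn] at this
    exact this

/-- In a module, `Y(u_n v, z)` is the `n`-th product of the fields `Y(u, z)` and `Y(v, z)`. -/
theorem VAModule.Y_nprod {A : VertexAlgebra V} (M : VAModule A W) (u v : V) (n : ℤ) :
    M.Y (ncoeff (A.Y u) n v) = nprod (M.Y u) (M.Y v) n := by
  refine field_ext fun k w => ?_
  have := M.borcherds u v w 0 k n
  rw [finsum_choose_zero] at this
  rw [ncoeff_nprod]
  simp only [Nat.cast_zero, add_zero, sub_zero, zero_add] at this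
  rw [this, bor, bor2]
  simp only [zero_add]
  rfl

end ModuleOfFields

/-! ### The modes of the generators as a basis of the Lie algebra -/

section Modes

variable {g : Type*} [LieRing g] [LieAlgebra ℂ g] (κ : InvForm g) (μ : ℂ)

/-- `t₁^p ⊗ u` as an element of `𝒜_g`. -/
def genL (p : ℤ) (u : g) : GenSpace g := (Finsupp.single p u, 0, 0, 0)

/-- `k₁` as an element of `𝒜_g`. -/
def genK1 : GenSpace g := (0, 1, 0, 0)

/-- `d₁` as an element of `𝒜_g`. -/
def genD1 : GenSpace g := (0, 0, 1, 0)

/-- `K_p` as an element of `𝒜_g`. -/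
def genK (p : {n : ℤ // n ≠ 0}) : GenSpace g := (0, 0, 0, Finsupp.single p (1, 0))

/-- `D_p` as an element of `𝒜_g`. -/
def genD (p : {n : ℤ // n ≠ 0}) : GenSpace g := (0, 0, 0, Finsupp.single p (0, 1))

theorem genSpace_induction {p : GenSpace g → Prop} (hadd : ∀ a b, p a → p b → p (a + b))
    (hsmul : ∀ (c : ℂ) a, p a → p (c • a)) (hL : ∀ n u, p (genL n u)) (hK1 : p genK1)
    (hD1 : p genD1) (hK : ∀ n, p (genK n)) (hD : ∀ n, p (genD n)) (a : GenSpace g) : p a := by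
  have h0 : p 0 := by simpa using hsmul 0 _ hK1
  obtain ⟨x, c, d, y⟩ := a
  have e : ((x, c, d, y) : GenSpace g) =
      (x, 0, 0, 0) + (c • genK1 + (d • genD1 + (0, 0, 0, y))) := by
    ext <;> simp [genK1, genD1]
  rw [e]
  clear e
  refine hadd _ _ ?_ (hadd _ _ (hsmul _ _ hK1) (hadd _ _ (hsmul _ _ hD1) ?_))
  · induction x using Finsupp.induction_linear with
    | zero => exact h0
    | add x x' h h' =>
      have := hadd _ _ h h'
      rwa [show ((x, 0, 0, 0) : GenSpace g) + (x', 0, 0, 0) = (x + x', 0, 0, 0) by simp] at this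
    | single n u => exact hL n u
  · induction y using Finsupp.induction_linear with
    | zero => exact h0
    | add x x' h h' =>
      have := hadd _ _ h h'
      rwa [show ((0, 0, 0, x) : GenSpace g) + (0, 0, 0, x') = (0, 0, 0, x + x') by simp] at this
    | single n u =>
      have := hadd _ _ (hsmul u.1 _ (hK n)) (hsmul u.2 _ (hD n))
      convert this using 1
      simp [genK, genD, ← Finsupp.single_add]

theorem genSpace_hom_ext {X : Type*} [AddCommGroup X] [Module ℂ X] {f f' : GenSpace g →ₗ[ℂ] X}
    (hL : ∀ n u, f (genL n u) = f' (genL n u)) (hK1 : f genK1 = f' genK1)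
    (hD1 : f genD1 = f' genD1) (hK : ∀ n, f (genK n) = f' (genK n))
    (hD : ∀ n, f (genD n) = f' (genD n)) : f = f' :=
  LinearMap.ext <| genSpace_induction (fun a b h h' => by rw [map_add, map_add, h, h'])
    (fun c a h => by rw [map_smul, map_smul, h]) hL hK1 hD1 hK hD

theorem mode_genL (n p : ℤ) (u : g) : mode κ μ n (genL p u) = hLoop κ μ n p u := by
  simp [mode, genL]

theorem mode_genK1 (n : ℤ) : mode κ μ n genK1 = hK1 κ μ n := by simp [mode, genK1]

theorem mode_genD1 (n : ℤ) : mode κ μ n genD1 = hD1 κ μ n := by simp [mode, genD1]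

theorem mode_genK (n : ℤ) (p : {n : ℤ // n ≠ 0}) : mode κ μ n (genK p) = hKK κ μ (n + 1) p := by
  simp [mode, genK]

theorem mode_genD (n : ℤ) (p : {n : ℤ // n ≠ 0}) : mode κ μ n (genD p) = hDD κ μ (n - 1) p := by
  simp [mode, genD]

theorem coe_mode_genL (n p : ℤ) (u : g) :
    (mode κ μ n (genL p u) : Full κ μ) = hom κ μ (n, p) (u, 0, 0) := by
  rw [mode_genL]; rfl

theorem coe_mode_genK1 (n : ℤ) :
    (mode κ μ n genK1 : Full κ μ) = hom κ μ (n, 0) (0, (0, 1), 0) := by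
  rw [mode_genK1]; rfl

theorem coe_mode_genD1 (n : ℤ) :
    (mode κ μ n genD1 : Full κ μ) = hom κ μ (n, 0) (0, 0, (0, 1)) := by
  rw [mode_genD1]; rfl

theorem coe_mode_genK (n : ℤ) (p : {n : ℤ // n ≠ 0}) :
    (mode κ μ n (genK p) : Full κ μ) = hom κ μ (n + 1, p) (0, (1 / (p : ℤ), 0), 0) := by
  rw [mode_genK]
  change kk κ μ _ _ = _
  rw [kk, if_pos p.2]
  rfl

theorem coe_mode_genD (n : ℤ) (p : {n : ℤ // n ≠ 0}) :
    (mode κ μ n (genD p) : Full κ μ) =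
      hom κ μ (n - 1, p) (0, (μ * (p : ℤ) * (n - 1 / 2), 0), (-(p : ℤ), n)) := by
  rw [mode_genD]
  change dd κ μ _ _ = _
  rw [dd, dbar, der, kform, ← hom_add]
  congr 1
  ext <;> simp
  left
  ring

section Lift

variable {X : Type*} [AddCommGroup X] [Module ℂ X] (F : ℤ → GenSpace g →ₗ[ℂ] X) (c : X)

/-- The map `Comp g → X` in degree `(m, n)` that expresses a homogeneous element through the modes
`F` of the generators and the value `c` of `k₀`. -/
def liftComp (m n : ℤ) : Comp g →ₗ[ℂ] X :=
  (F m ∘ₗ LinearMap.inl ℂ _ _ ∘ₗ Finsupp.lsingle n).coprod <|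
    if h : n = 0 then
      ((LinearMap.toSpanSingleton ℂ X (if m = 0 then c else 0)).coprod
        (LinearMap.toSpanSingleton ℂ X (F m genK1))).coprod
      ((0 : ℂ →ₗ[ℂ] X).coprod (LinearMap.toSpanSingleton ℂ X (F m genD1)))
    else
      ((LinearMap.toSpanSingleton ℂ X ((n : ℂ) • F (m - 1) (genK ⟨n, h⟩))).coprod
        (LinearMap.toSpanSingleton ℂ X (-(m : ℂ) • F (m - 1) (genK ⟨n, h⟩)))).coprod
      ((LinearMap.toSpanSingleton ℂ X ((-1 / n : ℂ) • (F (m + 1) (genD ⟨n, h⟩) -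
        (μ * n ^ 2 * (m + 1 / 2)) • F (m - 1) (genK ⟨n, h⟩)))).coprod (0 : ℂ →ₗ[ℂ] X))

/-- The linear map out of the full toroidal Lie algebra with prescribed values on the modes of the
generators and on `k₀`. -/
def liftFull : Full κ μ →ₗ[ℂ] X :=
  (exactForms g).liftQ (Finsupp.lsum ℂ fun m : ℤ × ℤ => liftComp μ F c m.1 m.2) <| by
    refine Submodule.span_le.2 ?_
    rintro _ ⟨⟨m, n⟩, rfl⟩
    refine LinearMap.mem_ker.2 ?_
    rw [Finsupp.lsum_single]
    by_cases h : n = 0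
    · subst h
      by_cases h' : m = 0 <;> simp [liftComp, vec, h'] <;> exact map_zero _
    · simp only [liftComp, vec, h, dite_false, LinearMap.coprod_apply, map_zero, add_zero,
        LinearMap.toSpanSingleton_apply, zero_add]
      module

theorem liftFull_hom (m n : ℤ) (x : Comp g) :
    liftFull κ μ F c (hom κ μ (m, n) x) = liftComp μ F c m n x := by
  rw [liftFull, hom, toFull]
  refine (Submodule.liftQ_apply _ _ _).trans ?_
  rw [Finsupp.lsum_single]

/-- The linear map out of `t̂(g, μ)ᵒ` with prescribed values on the modes of the generators and on
`k₀`. -/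
def liftHat : HatO κ μ →ₗ[ℂ] X := liftFull κ μ F c ∘ₗ (HatO κ μ).toSubmodule.subtype

theorem liftHat_mode (n : ℤ) (a : GenSpace g) : liftHat κ μ F c (mode κ μ n a) = F n a := by
  have : liftHat κ μ F c ∘ₗ mode κ μ n = F n := by
    refine genSpace_hom_ext (fun p u => ?_) ?_ ?_ (fun p => ?_) fun p => ?_
    · refine (congrArg (liftFull κ μ F c) (coe_mode_genL κ μ n p u)).trans ?_
      rw [liftFull_hom, liftComp]
      split_ifs <;> simp <;> rfl
    · refine (congrArg (liftFull κ μ F c) (coe_mode_genK1 κ μ n)).trans ?_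
      rw [liftFull_hom, liftComp]
      simp
      exact map_zero _
    · refine (congrArg (liftFull κ μ F c) (coe_mode_genD1 κ μ n)).trans ?_
      rw [liftFull_hom, liftComp]
      simp
      exact map_zero _
    · refine (congrArg (liftFull κ μ F c) (coe_mode_genK κ μ n p)).trans ?_
      have hp : ((p : ℤ) : ℂ) ≠ 0 := Int.cast_ne_zero.2 p.2
      rw [liftFull_hom, liftComp, dif_neg p.2]
      simp only [LinearMap.coprod_apply, map_zero, add_zero, LinearMap.toSpanSingleton_apply,
        zero_add, smul_smul, add_sub_cancel_right, one_div, inv_mul_cancel₀ hp, one_smul]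
    · refine (congrArg (liftFull κ μ F c) (coe_mode_genD κ μ n p)).trans ?_
      have hp : ((p : ℤ) : ℂ) ≠ 0 := Int.cast_ne_zero.2 p.2
      rw [liftFull_hom, liftComp, dif_neg p.2]
      simp only [LinearMap.coprod_apply, map_zero, add_zero, LinearMap.toSpanSingleton_apply,
        zero_add, smul_smul, sub_add_cancel, smul_sub, LinearMap.zero_apply]
      rw [show -((p : ℤ) : ℂ) * (-1 / (p : ℤ)) = 1 by field_simp]
      rw [add_comm, sub_add, ← sub_smul, one_smul, sub_eq_self]
      convert zero_smul ℂ _ using 2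
      push_cast
      field_simp
      ring
  exact LinearMap.congr_fun this a

theorem liftHat_hK0 : liftHat κ μ F c (hK0 κ μ) = c := by
  refine (liftFull_hom κ μ F c 0 0 (0, (1, 0), 0)).trans ?_
  rw [liftComp, dif_pos rfl]
  simp
  exact map_zero _

end Lift

/-- The form `t₀^m k₀` with `m ≠ 0` is exact. -/
theorem kform_zero_mem (m : ℤ) (hm : m ≠ 0) : kform κ μ m 0 1 0 = 0 := by
  refine (hom_eq κ μ (m, 0) (0, (1, 0), 0) 0 (1 / m) rfl rfl ?_).trans (hom_zero κ μ _)
  have hm' : (m : ℂ) ≠ 0 := Int.cast_ne_zero.2 hm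
  ext <;> simp [vec, hm']

/-- `t̂(g, μ)ᵒ` is spanned by the modes of the generators and `k₀`. -/
theorem hat_induction {p : HatO κ μ → Prop} (hadd : ∀ x y, p x → p y → p (x + y))
    (hsmul : ∀ (c : ℂ) x, p x → p (c • x)) (hm : ∀ n a, p (mode κ μ n a)) (h0 : p (hK0 κ μ))
    (x : HatO κ μ) : p x := by
  -- the image of the span of the modes contains all spanning vectors
  let S : Submodule ℂ (HatO κ μ) :=
    Submodule.span ℂ ({x | ∃ n a, x = mode κ μ n a} ∪ {hK0 κ μ})
  have hmode : ∀ n a, (mode κ μ n a : Full κ μ) ∈ S.map (HatO κ μ).toSubmodule.subtype :=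
    fun n a => ⟨_, Submodule.subset_span (Or.inl ⟨n, a, rfl⟩), rfl⟩
  have hform : ∀ m n, ∀ a : ℂ × ℂ, hom κ μ (m, n) (0, a, 0) ∈
      S.map (HatO κ μ).toSubmodule.subtype := by
    intro m n a
    by_cases hn : n = 0
    · subst hn
      have e : hom κ μ (m, 0) (0, a, 0) = a.1 • kform κ μ m 0 1 0 + a.2 • (mode κ μ m genK1).1 := by
        rw [coe_mode_genK1, kform, ← hom_smul, ← hom_smul, ← hom_add]
        congr 1
        ext <;> simp
      rw [e]
      refine add_mem (Submodule.smul_mem _ _ ?_) (Submodule.smul_mem _ _ (hmode _ _))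
      by_cases hm : m = 0
      · subst hm
        exact ⟨_, Submodule.subset_span (Or.inr rfl), rfl⟩
      · rw [kform_zero_mem κ μ m hm]; exact zero_mem _
    · have hn' : (n : ℂ) ≠ 0 := Int.cast_ne_zero.2 hn
      have e : hom κ μ (m, n) (0, a, 0) =
          (a.1 * n - a.2 * m) • (mode κ μ (m - 1) (genK ⟨n, hn⟩)).1 := by
        rw [coe_mode_genK, ← hom_smul, sub_add_cancel]
        refine hom_eq κ μ (m, n) _ _ (a.2 / n) (by simp) (by simp) ?_
        ext
        · simp [vec]; field_simp; ring
        · simp [vec]; field_simp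
      rw [e]
      exact Submodule.smul_mem _ _ (hmode _ _)
  have key : ∀ y ∈ Submodule.span ℂ (hatGens κ μ), y ∈ S.map (HatO κ μ).toSubmodule.subtype := by
    intro y hy
    refine (Submodule.span_le.2 ?_ : Submodule.span ℂ (hatGens κ μ) ≤ _) hy
    rintro _ (((⟨m, n, u, rfl⟩ | ⟨m, n, a, b, rfl⟩) | rfl) | ⟨n, m, rfl⟩)
    · have := hmode m (genL n u)
      rw [coe_mode_genL] at this
      exact this
    · exact hform m n (a, b)
    · have := hmode (-1) (genD1 (g := g))
      rw [coe_mode_genD1] at this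
      exact this
    · by_cases hm : m = 0
      · subst hm
        have e : dbar κ μ n 0 = (n + 1 : ℂ) • (mode κ μ n genD1).1 := by
          rw [coe_mode_genD1, dbar, der, ← hom_smul]
          congr 1
          ext <;> simp
        rw [e]
        exact Submodule.smul_mem _ _ (hmode _ _)
      · have e : dbar κ μ n m = (mode κ μ (n + 1) (genD ⟨m, hm⟩)).1 -
            hom κ μ (n, m) (0, (μ * m * (n + 1 / 2), 0), 0) := by
          rw [eq_sub_iff_add_eq, coe_mode_genD, dbar, der, ← hom_add, add_sub_cancel_right]
          congr 1
          ext <;> simp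
          left
          ring
        rw [e]
        exact sub_mem (hmode _ _) (hform _ _ _)
  obtain ⟨x', hx', e⟩ := key x.1 x.2
  have e : x' = x := Subtype.ext e
  subst e
  refine Submodule.span_induction (p := fun x _ => p x) ?_ ?_ (fun x y _ _ => hadd x y)
    (fun c x _ => hsmul c x) hx'
  · rintro _ (⟨n, a, rfl⟩ | rfl)
    · exact hm n a
    · exact h0
  · simpa using hsmul 0 _ h0

variable {κ μ} in
/-- Linear maps out of `t̂(g, μ)ᵒ` are determined by the modes of the generators and `k₀`. -/
theorem hat_hom_ext {X : Type*} [AddCommGroup X] [Module ℂ X] {f f' : HatO κ μ →ₗ[ℂ] X}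
    (hm : ∀ n a, f (mode κ μ n a) = f' (mode κ μ n a)) (h0 : f (hK0 κ μ) = f' (hK0 κ μ)) :
    f = f' :=
  LinearMap.ext <| hat_induction κ μ (fun x y h h' => by rw [map_add, map_add, h, h'])
    (fun c x h => by rw [map_smul, map_smul, h]) hm h0

/-- `k₀` is central. -/
theorem lie_hK0 (x : HatO κ μ) : ⁅x, hK0 κ μ⁆ = 0 := by
  have h : ∀ y : Full κ μ, ⁅y, kform κ μ 0 0 1 0⁆ = 0 := fun y => by
    induction y using full_induction with
    | h0 => rw [zero_lie]
    | ha x y hx hy => rw [add_lie, hx, hy, add_zero]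
    | hs m x =>
      rw [kform, hom_bracket]
      refine (hom_eq κ μ _ _ 0 x.2.2.1 ?_ ?_ ?_).trans (hom_zero κ μ _) <;>
        simp [compBracket, dot, pair, vec]
  exact Subtype.ext (h x.1)

theorem hK0_lie (x : HatO κ μ) : ⁅hK0 κ μ, x⁆ = 0 := by
  rw [← lie_skew, lie_hK0, neg_zero]

end Modes

/-! ### Formal derivatives of generators -/

section Formal

variable {g : Type*} [LieRing g] [LieAlgebra ℂ g]

/-- The free space generated by `𝒜_g` under a derivation, together with the element `k₀`: the
`j`-th derivative of `a` is `(Finsupp.single j a, 0)`, and `k₀` is `(0, 1)`. -/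
abbrev Formal (g : Type*) [LieRing g] : Type _ := (ℕ →₀ GenSpace g) × ℂ

/-- The derivation of the formal space. -/
def formalD : Formal g →ₗ[ℂ] Formal g :=
  (Finsupp.lmapDomain (GenSpace g) ℂ Nat.succ).prodMap 0

/-- The inclusion of the generators. -/
def formalGen : GenSpace g →ₗ[ℂ] Formal g := LinearMap.inl ℂ _ _ ∘ₗ Finsupp.lsingle 0

/-- The formal element `k₀`. -/
def formalK0 : Formal g := (0, 1)

theorem formal_induction {p : Formal g → Prop} (hadd : ∀ x y, p x → p y → p (x + y))
    (hgen : ∀ a, p (formalGen a)) (hk : ∀ c : ℂ, p (c • formalK0)) (hD : ∀ x, p x → p (formalD x))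
    (x : Formal g) : p x := by
  obtain ⟨x, c⟩ := x
  have e : ((x, c) : Formal g) = (x, 0) + c • formalK0 := by
    ext <;> simp [formalK0]
  rw [e]
  clear e
  refine hadd _ _ ?_ (hk c)
  induction x using Finsupp.induction_linear with
  | zero =>
    have := hk 0
    rw [zero_smul] at this
    exact this
  | add x y hx hy => simpa using hadd _ _ hx hy
  | single j a =>
    induction j with
    | zero => exact hgen a
    | succ j ih => simpa [formalD] using hD _ ih

section Lift

variable {X : Type*} [AddCommGroup X] [Module ℂ X] (D : X →ₗ[ℂ] X) (f : GenSpace g →ₗ[ℂ] X) (c : X)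

/-- The extension of a map on generators to the formal space, compatible with the derivation
`D`. -/
def formalLift : Formal g →ₗ[ℂ] X :=
  (Finsupp.lsum ℂ fun j => (D ^ j) ∘ₗ f).coprod (LinearMap.toSpanSingleton ℂ X c)

theorem formalLift_gen (a : GenSpace g) : formalLift D f c (formalGen a) = f a := by
  simp [formalLift, formalGen]

theorem formalLift_k0 : formalLift D f c formalK0 = c := by
  simp [formalLift, formalK0]

theorem formalLift_D (hc : D c = 0) (x : Formal g) :
    formalLift D f c (formalD x) = D (formalLift D f c x) := by
  have : formalLift D f c ∘ₗ formalD = D ∘ₗ formalLift D f c := by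
    refine LinearMap.prod_ext (Finsupp.lhom_ext fun j a => ?_) (LinearMap.ext_ring ?_)
    · simp [formalLift, formalD, pow_succ']
    · simp [formalLift, formalD, hc]
  exact LinearMap.congr_fun this x

end Lift

/-- Linear maps out of the formal space agree if they intertwine derivations and agree on the
generators and `k₀`. -/
theorem formal_hom_ext {X : Type*} [AddCommGroup X] [Module ℂ X] {D : X →ₗ[ℂ] X}
    {T T' : Formal g →ₗ[ℂ] X} (hT : ∀ x, T (formalD x) = D (T x))
    (hT' : ∀ x, T' (formalD x) = D (T' x)) (hg : ∀ a, T (formalGen a) = T' (formalGen a))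
    (hk : T formalK0 = T' formalK0) : T = T' :=
  LinearMap.ext <| formal_induction (fun x y h h' => by rw [map_add, map_add, h, h']) hg
    (fun c => by rw [map_smul, map_smul, hk]) fun x h => by rw [hT, hT', h]

/-- The derivation of mode sequences, `(∂e)(n) = -n e(n-1)`. -/
def seqD (X : Type*) [AddCommGroup X] [Module ℂ X] : (ℤ → X) →ₗ[ℂ] (ℤ → X) where
  toFun e n := (-n) • e (n - 1)
  map_add' e e' := funext fun n => smul_add _ _ _
  map_smul' c e := funext fun n => by
    simp only [Pi.smul_apply, RingHom.id_apply]
    rw [smul_comm]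

/-- The mode sequence of the constant field with value `x`. -/
def seqConst {X : Type*} [AddCommGroup X] (x : X) (n : ℤ) : X := if n = -1 then x else 0

theorem seqD_const {X : Type*} [AddCommGroup X] [Module ℂ X] (x : X) : seqD X (seqConst x) = 0 := by
  funext n
  change (-n) • seqConst x (n - 1) = 0
  rw [seqConst]
  split_ifs with h
  · rw [show n = 0 by omega, neg_zero, zero_smul]
  · rw [smul_zero]

variable (κ : InvForm g) (μ : ℂ)

/-- The modes in `t̂(g, μ)ᵒ` of a formal element. -/
def modeP : Formal g →ₗ[ℂ] (ℤ → HatO κ μ) :=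
  formalLift (seqD _) (LinearMap.pi fun n => mode κ μ n) (seqConst (hK0 κ μ))

theorem modeP_gen (a : GenSpace g) (n : ℤ) : modeP κ μ (formalGen a) n = mode κ μ n a := by
  rw [modeP, formalLift_gen]; rfl

theorem modeP_k0 (n : ℤ) : modeP κ μ formalK0 n = if n = -1 then hK0 κ μ else 0 := by
  rw [modeP, formalLift_k0]; rfl

theorem modeP_D (x : Formal g) (n : ℤ) :
    modeP κ μ (formalD x) n = (-n) • modeP κ μ x (n - 1) := by
  rw [modeP, formalLift_D _ _ _ (seqD_const _)]; rfl

end Formal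

/-! ### Operator products of the generators -/

section OPE

variable {g : Type*} [LieRing g] [LieAlgebra ℂ g] (κ : InvForm g) (μ : ℂ)

/-- The formal elements `σ t` are the coefficients of the operator product of `a` and `b`:
`[a(m), b(n)] = ∑ₜ (m choose t) σₜ(m + n - t)`. -/
structure IsOPE (a b : GenSpace g) (σ : ℕ → Formal g) : Prop where
  eq_zero : ∀ t, 4 ≤ t → σ t = 0
  lie_eq : ∀ m n : ℤ, ⁅mode κ μ m a, mode κ μ n b⁆ =
    ∑ t ∈ Finset.range 4, Ring.choose m t • modeP κ μ (σ t) (m + n - t)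

/-- The modes of a formal element in the full toroidal Lie algebra. -/
def modeF (n : ℤ) : Formal g →ₗ[ℂ] Full κ μ :=
  (HatO κ μ).toSubmodule.subtype ∘ₗ LinearMap.proj n ∘ₗ modeP κ μ

theorem modeF_gen (a : GenSpace g) (n : ℤ) : modeF κ μ n (formalGen a) = (mode κ μ n a).1 :=
  congrArg Subtype.val (modeP_gen κ μ a n)

theorem modeF_D (x : Formal g) (n : ℤ) :
    modeF κ μ n (formalD x) = (-n : ℂ) • modeF κ μ (n - 1) x := by
  refine (congrArg Subtype.val (modeP_D κ μ x n)).trans ?_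
  rw [← Int.cast_neg, Int.cast_smul_eq_zsmul]
  rfl

theorem cast_choose_two (m : ℤ) : ((Ring.choose m 2 : ℤ) : ℂ) = m * (m - 1) / 2 := by
  have h := choose_mul_succ m 1
  rw [Ring.choose_one_right] at h
  have h' : ((((1 : ℕ) + 1 : ℤ) * Ring.choose m 2 : ℤ) : ℂ) = ((m * (m - 1) : ℤ) : ℂ) :=
    congrArg _ h
  push_cast at h'
  linear_combination h' / 2

theorem cast_choose_three (m : ℤ) :
    ((Ring.choose m 3 : ℤ) : ℂ) = m * (m - 1) * (m - 2) / 6 := by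
  have h := choose_mul_succ m 2
  have h2 := cast_choose_two (m - 1)
  have h' : ((((2 : ℕ) + 1 : ℤ) * Ring.choose m 3 : ℤ) : ℂ) =
    ((m * Ring.choose (m - 1) 2 : ℤ) : ℂ) := congrArg _ h
  push_cast at h' h2
  rw [h2] at h'
  linear_combination h' / 3

variable {κ μ} in
/-- A criterion for operator products in terms of the full toroidal Lie algebra. -/
theorem IsOPE.of {a b : GenSpace g} (s0 s1 s2 s3 : Formal g)
    (h : ∀ m n : ℤ, ⁅(mode κ μ m a : Full κ μ), (mode κ μ n b : Full κ μ)⁆ =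
      modeF κ μ (m + n) s0 + (m : ℂ) • modeF κ μ (m + n - 1) s1 +
      (m * (m - 1) / 2 : ℂ) • modeF κ μ (m + n - 2) s2 +
      (m * (m - 1) * (m - 2) / 6 : ℂ) • modeF κ μ (m + n - 3) s3) :
    ∃ σ, IsOPE κ μ a b σ := by
  refine ⟨fun t => match t with | 0 => s0 | 1 => s1 | 2 => s2 | 3 => s3 | _ => 0, ?_, ?_⟩
  · intro t ht
    match t, ht with
    | t + 4, _ => rfl
  · intro m n
    refine Subtype.ext ((h m n).trans ?_)
    rw [← cast_choose_two, ← cast_choose_three, Int.cast_smul_eq_zsmul, Int.cast_smul_eq_zsmul,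
      Int.cast_smul_eq_zsmul]
    simp only [Finset.sum_range_succ, Finset.sum_range_zero, Ring.choose_zero_right,
      Ring.choose_one_right, one_smul, zero_add, Nat.cast_zero, sub_zero, Nat.cast_one,
      Nat.cast_ofNat]
    rfl

/-- `p K_p` as a generator; it has the modes `t₀^{n+1} t₁^p k₀`. -/
def genA (p : {n : ℤ // n ≠ 0}) : GenSpace g := ((p : ℤ) : ℂ) • genK p

theorem genK_eq (p : {n : ℤ // n ≠ 0}) : (genK p : GenSpace g) = (((p : ℤ) : ℂ))⁻¹ • genA p := by
  rw [genA, smul_smul, inv_mul_cancel₀ (Int.cast_ne_zero.2 p.2), one_smul]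

theorem coe_mode_genA (n : ℤ) (p : {n : ℤ // n ≠ 0}) :
    (mode κ μ n (genA p) : Full κ μ) = hom κ μ (n + 1, p) (0, (1, 0), 0) := by
  have h : mode κ μ n (genA p) = ((p : ℤ) : ℂ) • mode κ μ n (genK p) := map_smul _ _ _
  rw [h]
  change ((p : ℤ) : ℂ) • (mode κ μ n (genK p) : Full κ μ) = _
  have hp : ((p : ℤ) : ℂ) ≠ 0 := Int.cast_ne_zero.2 p.2
  rw [coe_mode_genK, ← hom_smul]
  congr 1
  ext <;> simp [hp]

/-- The formal element with modes `t₀^{n+1} t₁^q k₀`. -/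
def formA (q : ℤ) : Formal g := if h : q = 0 then formalK0 else formalGen (genA ⟨q, h⟩)

/-- The formal element with modes `t₀^n t₁^q k₁`. -/
def formB (q : ℤ) : Formal g :=
  if h : q = 0 then formalGen genK1 else formalD (formalGen (genK ⟨q, h⟩))

/-- The formal element with modes `d_{n-1,q}`. -/
def formE (q : ℤ) : Formal g :=
  if h : q = 0 then (-1 : ℂ) • formalD (formalGen genD1) else formalGen (genD ⟨q, h⟩)

theorem modeF_formA (q n : ℤ) :
    modeF κ μ n (formA q) = hom κ μ (n + 1, q) (0, (1, 0), 0) := by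
  rw [formA]
  split_ifs with h
  · subst h
    change (modeP κ μ formalK0 n).1 = _
    rw [modeP_k0]
    split_ifs with h
    · subst h; rfl
    · exact (kform_zero_mem κ μ (n + 1) (by omega)).symm
  · rw [modeF_gen, coe_mode_genA]

theorem modeF_formB (q n : ℤ) : modeF κ μ n (formB q) = hom κ μ (n, q) (0, (0, 1), 0) := by
  rw [formB]
  split_ifs with h
  · subst h
    rw [modeF_gen, coe_mode_genK1]
  · have hp : (q : ℂ) ≠ 0 := Int.cast_ne_zero.2 h
    rw [modeF_D, modeF_gen, coe_mode_genK, ← hom_smul, sub_add_cancel]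
    refine hom_eq κ μ (n, q) _ _ (-1 / q) (by simp) (by simp) ?_
    ext
    · simp [vec]; field_simp
    · simp [vec]; field_simp; ring

theorem modeF_formE (q n : ℤ) :
    modeF κ μ n (formE q) = hom κ μ (n - 1, q) (0, (μ * q * (n - 1 / 2), 0), (-q, n)) := by
  rw [formE]
  split_ifs with h
  · subst h
    rw [map_smul, modeF_D, modeF_gen, coe_mode_genD1, ← hom_smul, ← hom_smul]
    congr 1
    ext <;> simp
  · rw [modeF_gen, coe_mode_genD]

theorem modeF_genL (q n : ℤ) (u : g) :
    modeF κ μ n (formalGen (genL q u)) = hom κ μ (n, q) (u, 0, 0) := by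
  rw [modeF_gen, coe_mode_genL]

theorem ope_loop_loop (p q : ℤ) (u v : g) : ∃ σ, IsOPE κ μ (genL p u) (genL q v) σ := by
  refine IsOPE.of (formalGen (genL (p + q) ⁅u, v⁆) + (κ.form u v * p) • formB (p + q))
    (κ.form u v • formA (p + q)) 0 0 fun m n => ?_
  rw [coe_mode_genL, coe_mode_genL, hom_bracket, map_zero, map_zero, smul_zero, smul_zero, add_zero,
    add_zero, map_add, map_smul, map_smul, modeF_genL, modeF_formA, modeF_formB, sub_add_cancel]
  simp only [← hom_smul, ← hom_add]
  congr 1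
  ext <;> simp [compBracket, dot, pair, vec]
  ring

theorem ope_zero {a b : GenSpace g}
    (h : ∀ m n : ℤ, ⁅(mode κ μ m a : Full κ μ), (mode κ μ n b : Full κ μ)⁆ = 0) :
    ∃ σ, IsOPE κ μ a b σ :=
  IsOPE.of 0 0 0 0 fun m n => by simp [h]

theorem ope_D1_loop (q : ℤ) (v : g) : ∃ σ, IsOPE κ μ genD1 (genL q v) σ := by
  refine IsOPE.of ((q : ℂ) • formalGen (genL q v)) 0 0 0 fun m n => ?_
  rw [coe_mode_genD1, coe_mode_genL, hom_bracket]
  simp only [map_zero, smul_zero, add_zero, map_smul, modeF_genL, ← hom_smul, Prod.mk_add_mk,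
    zero_add]
  congr 1
  ext <;> simp [compBracket, dot, pair, vec]

theorem ope_D1_A (q : {n : ℤ // n ≠ 0}) : ∃ σ, IsOPE κ μ genD1 (genA q) σ := by
  refine IsOPE.of (((q : ℤ) : ℂ) • formA q) 0 0 0 fun m n => ?_
  rw [coe_mode_genD1, coe_mode_genA, hom_bracket]
  simp only [map_zero, smul_zero, add_zero, map_smul, modeF_formA, ← hom_smul, Prod.mk_add_mk,
    zero_add, ← add_assoc]
  congr 1
  ext <;> simp [compBracket, dot, pair, vec]

theorem ope_D1_K1 : ∃ σ, IsOPE κ μ genD1 genK1 σ := by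
  refine IsOPE.of 0 (formA 0) 0 0 fun m n => ?_
  rw [coe_mode_genD1, coe_mode_genK1, hom_bracket]
  simp only [map_zero, smul_zero, add_zero, modeF_formA, ← hom_smul, Prod.mk_add_mk,
    zero_add, sub_add_cancel]
  congr 1
  ext <;> simp [compBracket, dot, pair, vec]

theorem ope_D_loop (p : {n : ℤ // n ≠ 0}) (q : ℤ) (v : g) :
    ∃ σ, IsOPE κ μ (genD p) (genL q v) σ := by
  refine IsOPE.of (((p : ℤ) : ℂ) • formalD (formalGen (genL (p + q) v)))
    ((p + q : ℂ) • formalGen (genL (p + q) v)) 0 0 fun m n => ?_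
  rw [coe_mode_genD, coe_mode_genL, hom_bracket]
  simp only [map_zero, smul_zero, add_zero, map_smul, modeF_D, modeF_genL, ← hom_smul,
    Prod.mk_add_mk, ← hom_add, show m - 1 + n = m + n - 1 by ring]
  congr 1
  ext <;> simp [compBracket, dot, pair, vec]
  module

theorem ope_D_A (p q : {n : ℤ // n ≠ 0}) : ∃ σ, IsOPE κ μ (genD p) (genA q) σ := by
  refine IsOPE.of ((p * q : ℂ) • formB (p + q)) (((q : ℤ) : ℂ) • formA (p + q)) 0 0 fun m n => ?_
  rw [coe_mode_genD, coe_mode_genA, hom_bracket]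
  simp only [map_zero, smul_zero, add_zero, map_smul, modeF_formA, modeF_formB, ← hom_smul,
    Prod.mk_add_mk, ← hom_add, show m - 1 + (n + 1) = m + n by ring, sub_add_cancel]
  refine hom_eq κ μ _ _ _ (-((p : ℤ) : ℂ)) ?_ ?_ ?_
  · simp [compBracket]
  · simp [compBracket, dot]
  · ext <;> simp [compBracket, dot, pair, vec] <;> ring

theorem ope_D_K1 (p : {n : ℤ // n ≠ 0}) : ∃ σ, IsOPE κ μ (genD p) genK1 σ := by
  refine IsOPE.of (((p : ℤ) : ℂ) • formalD (formB p)) ((2 * p : ℂ) • formB p) ((2 : ℂ) • formA p) 0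
    fun m n => ?_
  rw [coe_mode_genD, coe_mode_genK1, hom_bracket]
  simp only [map_zero, smul_zero, add_zero, map_smul, modeF_D, modeF_formA, modeF_formB, ← hom_smul,
    Prod.mk_add_mk, ← hom_add, show m - 1 + n = m + n - 1 by ring,
    show m + n - 2 + 1 = m + n - 1 by ring]
  congr 1
  ext <;> simp [compBracket, dot, pair, vec] <;> ring

theorem ope_D_D1 (p : {n : ℤ // n ≠ 0}) : ∃ σ, IsOPE κ μ (genD p) genD1 σ := by
  refine IsOPE.of ((-p : ℂ) • formE p + (-(μ * p ^ 2)) • formalD (formalD (formA p)))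
    ((-(2 * μ * p ^ 2)) • formalD (formA p)) ((-(2 * μ * p ^ 2)) • formA p) 0 fun m n => ?_
  rw [coe_mode_genD, coe_mode_genD1, hom_bracket]
  simp only [map_zero, smul_zero, add_zero, map_smul, map_add, modeF_D, modeF_formA, modeF_formE,
    Prod.mk_add_mk, show m - 1 + n = m + n - 1 by ring, show m + n - 1 - 1 + 1 = m + n - 1 by ring,
    show m + n - 2 + 1 = m + n - 1 by ring]
  simp only [← hom_smul, ← hom_add]
  refine hom_eq κ μ _ _ _ (μ * p ^ 2 * n) ?_ ?_ ?_
  · simp [compBracket]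
  · ext
    · simp [compBracket, dot]
    · simp [compBracket, dot]; ring
  · ext
    · simp [compBracket, dot, pair, vec]; ring
    · simp [compBracket, dot, pair, vec]; left; ring

/-- The operator product of two generators `D_p` and `D_q`; the central terms come from the
cocycle with coefficient `μ`. -/
theorem ope_D_D (p q : {n : ℤ // n ≠ 0}) : ∃ σ, IsOPE κ μ (genD p) (genD q) σ := by
  refine IsOPE.of
    (((p : ℤ) : ℂ) • formalD (formE (p + q)) +
      (μ * p ^ 3) • formalD (formalD (formB (p + q))))
    ((p + q : ℂ) • formE (p + q) + (3 * μ * p ^ 2) • formalD (formalD (formA (p + q))))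
    ((6 * μ * p * (p + q)) • formalD (formA (p + q)))
    ((6 * μ * (p + q) ^ 2) • formA (p + q)) fun m n => ?_
  rw [coe_mode_genD, coe_mode_genD, hom_bracket]
  simp only [map_smul, map_add, modeF_D, modeF_formA, modeF_formB, modeF_formE,
    Prod.mk_add_mk, show m - 1 + (n - 1) = m + n - 2 by ring,
    show m + n - 1 - 1 = m + n - 2 by ring, show m + n - 2 - 1 + 1 = m + n - 2 by ring,
    show m + n - 3 + 1 = m + n - 2 by ring]
  simp only [← hom_smul, ← hom_add]
  -- the two sides differ by an exact form; the last argument is its coefficient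
  refine hom_eq κ μ _ _ _
    (μ * (-(p * q / 2) - 2 * p ^ 2 * m * (m + n) + p ^ 2 * m + p * (p + q) * m ^ 2)) ?_ ?_ ?_
  · simp [compBracket]
  · ext <;> simp [compBracket, dot] <;> ring
  · ext <;> simp [compBracket, dot, pair, vec] <;> ring

variable {κ μ} in
/-- A property of pairs of generators that is bilinear and symmetric holds as soon as it holds for
all pairs admitting an operator product. -/
theorem ope_induction {P : GenSpace g → GenSpace g → Prop}
    (hadd : ∀ a a' b, P a b → P a' b → P (a + a') b)
    (hsmul : ∀ (c : ℂ) a b, P a b → P (c • a) b) (hsymm : ∀ a b, P a b → P b a)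
    (hope : ∀ a b σ, IsOPE κ μ a b σ → P a b) (a b : GenSpace g) : P a b := by
  have hope' : ∀ a b, (∃ σ, IsOPE κ μ a b σ) → P a b := fun a b ⟨σ, h⟩ => hope a b σ h
  have hK : ∀ a p, P a (genA p) → P a (genK p) := fun a p h => by
    rw [genK_eq]
    exact hsymm _ _ (hsmul _ _ _ (hsymm _ _ h))
  have hLK : ∀ n u p, P (genL n u) (genK p) := fun n u p => hK _ _ <| hope' _ _ <| ope_zero κ μ
    fun m n' => by
      rw [coe_mode_genL, coe_mode_genA, hom_bracket]
      convert hom_zero κ μ _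
      ext <;> simp [compBracket, dot, pair]
  have hLK1 : ∀ n u, P (genL n u) genK1 := fun n u => hope' _ _ <| ope_zero κ μ fun m n' => by
      rw [coe_mode_genL, coe_mode_genK1, hom_bracket]
      convert hom_zero κ μ _
      ext <;> simp [compBracket, dot, pair]
  have hKK : ∀ p q, P (genK p) (genK q) := fun p q => hK _ _ <| hsymm _ _ <| hK _ _ <| hope' _ _ <|
    ope_zero κ μ fun m n' => by
      rw [coe_mode_genA, coe_mode_genA, hom_bracket]
      convert hom_zero κ μ _
      ext <;> simp [compBracket, dot, pair]
  have hK1K : ∀ p, P genK1 (genK p) := fun p => hK _ _ <| hope' _ _ <| ope_zero κ μ fun m n' => by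
      rw [coe_mode_genK1, coe_mode_genA, hom_bracket]
      convert hom_zero κ μ _
      ext <;> simp [compBracket, dot, pair]
  have hK1K1 : P genK1 genK1 := hope' _ _ <| ope_zero κ μ fun m n' => by
      rw [coe_mode_genK1, coe_mode_genK1, hom_bracket]
      convert hom_zero κ μ _
      ext <;> simp [compBracket, dot, pair]
  have hD1D1 : P genD1 genD1 := hope' _ _ <| ope_zero κ μ fun m n' => by
      rw [coe_mode_genD1, coe_mode_genD1, hom_bracket]
      convert hom_zero κ μ _
      ext <;> simp [compBracket, dot, pair]
  have hD1K : ∀ p, P genD1 (genK p) := fun p => hK _ _ (hope' _ _ (ope_D1_A κ μ p))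
  have hDK : ∀ p q, P (genD p) (genK q) := fun p q => hK _ _ (hope' _ _ (ope_D_A κ μ p q))
  have hD1L : ∀ q v, P genD1 (genL q v) := fun q v => hope' _ _ (ope_D1_loop κ μ q v)
  have hDL : ∀ p q v, P (genD p) (genL q v) := fun p q v => hope' _ _ (ope_D_loop κ μ p q v)
  have hD1K1 : P genD1 genK1 := hope' _ _ (ope_D1_K1 κ μ)
  have hDK1 : ∀ p, P (genD p) genK1 := fun p => hope' _ _ (ope_D_K1 κ μ p)
  have hDD1 : ∀ p, P (genD p) genD1 := fun p => hope' _ _ (ope_D_D1 κ μ p)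
  refine genSpace_induction (p := fun a => P a b) (fun a a' => hadd a a' b)
    (fun c a => hsmul c a b) ?_ ?_ ?_ ?_ ?_ a
  all_goals
    intros
    refine genSpace_induction (p := fun b => P _ b)
      (fun a a' h h' => hsymm _ _ (hadd _ _ _ (hsymm _ _ h) (hsymm _ _ h')))
      (fun c a h => hsymm _ _ (hsmul c _ _ (hsymm _ _ h))) ?_ ?_ ?_ ?_ ?_ b
  · exact fun q v => hope' _ _ (ope_loop_loop κ μ _ q _ v)
  · exact hLK1 _ _
  · exact hsymm _ _ (hD1L _ _)
  · exact fun p => hLK _ _ p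
  · exact fun p => hsymm _ _ (hDL p _ _)
  · exact fun q v => hsymm _ _ (hLK1 q v)
  · exact hK1K1
  · exact hsymm _ _ hD1K1
  · exact hK1K
  · exact fun p => hsymm _ _ (hDK1 p)
  · exact hD1L
  · exact hD1K1
  · exact hD1D1
  · exact hD1K
  · exact fun p => hsymm _ _ (hDD1 p)
  · exact fun q v => hsymm _ _ (hLK q v _)
  · exact hsymm _ _ (hK1K _)
  · exact hsymm _ _ (hD1K _)
  · exact fun p => hKK _ p
  · exact fun p => hsymm _ _ (hDK p _)
  · exact hDL _
  · exact hDK1 _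
  · exact hDD1 _
  · exact fun p => hDK _ p
  · exact fun p => hope' _ _ (ope_D_D κ μ _ p)

end OPE

/-! ### Fields of a restricted module -/

section Locality

variable {W : Type*} [AddCommGroup W] [Module ℂ W]

theorem IsLocal.add_left {A B C : VertexOperator ℂ W} (hA : IsLocal A C) (hB : IsLocal B C) :
    IsLocal (A + B) C := by
  obtain ⟨N, hN⟩ := hA
  obtain ⟨M, hM⟩ := hB
  refine ⟨max N M, fun p q w => ?_⟩
  rw [bor_add_left, hN.mono (le_max_left N M), hM.mono (le_max_right N M), add_zero]

theorem IsLocal.smul_left {A C : VertexOperator ℂ W} (hA : IsLocal A C) (c : ℂ) :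
    IsLocal (c • A) C := by
  obtain ⟨N, hN⟩ := hA
  exact ⟨N, fun p q w => by rw [bor_smul_left, hN, smul_zero]⟩

theorem isLocal_zero_left (C : VertexOperator ℂ W) : IsLocal 0 C := by
  have := (isLocal_idField C).symm.smul_left 0
  rwa [zero_smul] at this

/-- Multiplication by powers of `y - z` on the commutator coefficients of an operator product. -/
theorem nab_pow_ope (f : ℕ → ℤ → W) (i N : ℕ) :
    (nab ^ i) (fun p q => ∑ t ∈ Finset.range N, Ring.choose p t • f t (p + q - t)) =
      fun p q => ∑ t ∈ Finset.range (N - i), Ring.choose p t • f (t + i) (p + q - t) := by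
  induction i generalizing N f with
  | zero => simp
  | succ i ih =>
    rw [pow_succ, Module.End.mul_apply]
    cases N with
    | zero =>
      have : nab (fun p q => ∑ t ∈ Finset.range 0, Ring.choose p t • f t (p + q - t)) = 0 := by
        ext p q; simp [nab]
      rw [this, map_zero]
      ext p q; simp
    | succ N =>
      have : nab (fun p q => ∑ t ∈ Finset.range (N + 1), Ring.choose p t • f t (p + q - t)) =
          fun p q => ∑ t ∈ Finset.range N, Ring.choose p t • f (t + 1) (p + q - t) := by
        ext p q
        simp only [nab, LinearMap.coe_mk, AddHom.coe_mk]
        rw [Finset.sum_range_succ', Finset.sum_range_succ', Ring.choose_zero_right,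
          Ring.choose_zero_right, show p + 1 + q = p + (q + 1) by ring, add_sub_add_right_eq_sub,
          ← Finset.sum_sub_distrib]
        refine Finset.sum_congr rfl fun t _ => ?_
        rw [choose_succ', ← sub_smul, add_sub_cancel_right]
        push_cast
        rw [show p + (q + 1) - ((t : ℤ) + 1) = p + q - t by ring]
      rw [this, ih (fun t => f (t + 1)), Nat.add_sub_add_right]
      simp only [add_assoc, add_comm i 1]

end Locality

section Fields

variable {g : Type*} [LieRing g] [LieAlgebra ℂ g] {κ : InvForm g} {μ : ℂ}
  {W : Type*} [AddCommGroup W] [Module ℂ W] {ρ : HatRep κ μ W} {ℓ : ℂ}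

theorem IsRestricted.trunc (hr : IsRestricted ρ) (a : GenSpace g) (w : W) :
    ∃ N : ℤ, ∀ n, N ≤ n → ρ (mode κ μ n a) w = 0 := by
  obtain ⟨F, hF⟩ := hr a
  obtain ⟨N, hN⟩ := ncoeff_trunc F w
  exact ⟨N, fun n hn => by rw [← hF]; exact hN n hn⟩

theorem isRestricted_of_trunc
    (h : ∀ (a : GenSpace g) (w : W), ∃ N : ℤ, ∀ n, N ≤ n → ρ (mode κ μ n a) w = 0) :
    IsRestricted ρ :=
  fun a => ⟨mkField (fun n => ρ (mode κ μ n a)) (h a), fun n => ncoeff_mkField _ _ n⟩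

/-- The fields `a(z)` on a restricted module. -/
def fld (hr : IsRestricted ρ) : GenSpace g →ₗ[ℂ] VertexOperator ℂ W where
  toFun a := mkField (fun n => ρ (mode κ μ n a)) (hr.trunc a)
  map_add' a b := field_ext fun n w => by
    rw [map_add, Pi.add_apply, ncoeff_mkField, ncoeff_mkField, ncoeff_mkField, map_add]
    exact LinearMap.congr_fun (map_add ρ _ _) w
  map_smul' c a := field_ext fun n w => by
    rw [map_smul, Pi.smul_apply, ncoeff_mkField, ncoeff_mkField, map_smul]
    exact LinearMap.congr_fun (map_smul ρ c _) w

theorem ncoeff_fld (hr : IsRestricted ρ) (a : GenSpace g) (n : ℤ) :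
    ncoeff (fld hr a) n = ρ (mode κ μ n a) := ncoeff_mkField _ _ n

/-- The fields of formal elements on a restricted module of level `ℓ`. -/
def fldP (hr : IsRestricted ρ) (ℓ : ℂ) : Formal g →ₗ[ℂ] VertexOperator ℂ W :=
  formalLift (dFieldL W) (fld hr) (ℓ • idField W)

theorem dFieldL_smul_idField (W : Type*) [AddCommGroup W] [Module ℂ W] (ℓ : ℂ) :
    dFieldL W (ℓ • idField W) = 0 := by
  rw [map_smul]
  exact (congrArg (ℓ • ·) dField_idField).trans (smul_zero ℓ)

theorem ncoeff_fldP (hr : IsRestricted ρ) (hl : HasLevel ρ ℓ) (x : Formal g) (n : ℤ) (w : W) :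
    ncoeff (fldP hr ℓ x) n w = ρ (modeP κ μ x n) w := by
  induction x using formal_induction generalizing n w with
  | hadd x y hx hy =>
    rw [map_add, map_add, map_add, Pi.add_apply, Pi.add_apply, LinearMap.add_apply, hx, hy]
    exact (LinearMap.congr_fun (map_add ρ _ _) w).symm
  | hgen a => rw [fldP, formalLift_gen, modeP_gen, ncoeff_fld]
  | hk c =>
    rw [map_smul, map_smul, map_smul, fldP, formalLift_k0, Pi.smul_apply, Pi.smul_apply,
      LinearMap.smul_apply, modeP_k0, map_smul, Pi.smul_apply, ncoeff_idField]
    refine Eq.trans ?_ (LinearMap.congr_fun (map_smul ρ c _) w).symm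
    rw [LinearMap.smul_apply]
    split_ifs
    · rw [LinearMap.smul_apply, hl]; rfl
    · have : ρ 0 = 0 := map_zero ρ
      rw [this, smul_zero, LinearMap.zero_apply, smul_zero, smul_zero]
  | hD x hx =>
    have : fldP hr ℓ (formalD x) = dField (fldP hr ℓ x) :=
      formalLift_D _ _ _ (dFieldL_smul_idField W ℓ) x
    rw [this, ncoeff_dField, hx, modeP_D]
    exact (LinearMap.congr_fun (map_zsmul ρ (-n) _) w).symm

/-- The commutator of two fields with an operator product, multiplied by a power of `y - z`; it
vanishes from the fourth power on. -/
theorem nab_pow_comm_fld (hr : IsRestricted ρ) {a b : GenSpace g} {σ : ℕ → Formal g}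
    (h : IsOPE κ μ a b σ) (w : W) (i : ℕ) :
    (nab ^ i) (comm (fld hr a) (fld hr b) w) = fun p q => ∑ t ∈ Finset.range (4 - i),
      Ring.choose p t • ρ (modeP κ μ (σ (t + i)) (p + q - t)) w := by
  rw [← nab_pow_ope fun t n => ρ (modeP κ μ (σ t) n) w]
  congr 1
  ext p q
  have e := LinearMap.congr_fun (congrArg ρ (h.lie_eq p q)) w
  rw [LieHom.map_lie, map_sum, LinearMap.sum_apply] at e
  rw [comm, ncoeff_fld, ncoeff_fld]
  refine Eq.trans ?_ (e.trans (Finset.sum_congr rfl fun t _ => ?_))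
  · rfl
  · exact LinearMap.congr_fun (map_zsmul ρ _ _) w

theorem localAt_fld (hr : IsRestricted ρ) {a b : GenSpace g} {σ : ℕ → Formal g}
    (h : IsOPE κ μ a b σ) : LocalAt 4 (fld hr a) (fld hr b) :=
  localAt_iff.2 fun w => by
    rw [nab_pow_comm_fld hr h]
    ext p q
    simp

/-- The fields of a restricted module are mutually local. -/
theorem isLocal_fld (hr : IsRestricted ρ) (a b : GenSpace g) :
    IsLocal (fld hr a) (fld hr b) := by
  refine ope_induction (κ := κ) (μ := μ) (P := fun a b => IsLocal (fld hr a) (fld hr b))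
    (fun a a' b h h' => ?_) (fun c a b h => ?_) (fun a b h => h.symm)
    (fun a b σ h => ⟨4, localAt_fld hr h⟩) a b
  · rw [map_add]; exact h.add_left h'
  · rw [map_smul]; exact h.smul_left c

/-- The nonnegative products of the fields `a(z)` are the coefficients of the operator product. -/
theorem nprod_fld (hr : IsRestricted ρ) (hl : HasLevel ρ ℓ) {a b : GenSpace g} {σ : ℕ → Formal g}
    (h : IsOPE κ μ a b σ) (i : ℕ) : nprod (fld hr a) (fld hr b) i = fldP hr ℓ (σ i) := by
  refine field_ext fun n w => ?_
  have e := congrFun (congrFun (nab_pow_comm_fld hr h w i) 0) n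
  rw [nab_pow_comm] at e
  beta_reduce at e
  rw [ncoeff_nprod, e, ncoeff_fldP hr hl]
  rcases lt_or_ge i 4 with hi | hi
  · obtain ⟨j, hj⟩ : ∃ j, 4 - i = j + 1 := ⟨3 - i, by omega⟩
    rw [hj, Finset.sum_range_succ', Finset.sum_eq_zero fun t _ => by
      rw [choose_zero_left, zero_smul], Ring.choose_zero_right, zero_add, one_smul, zero_add,
      Nat.cast_zero, sub_zero, zero_add]
  · rw [h.eq_zero i hi, Nat.sub_eq_zero_of_le hi, map_zero]
    exact (LinearMap.congr_fun (map_zero ρ) w).symm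

end Fields

/-! ### Representations from modules of vertex algebras -/

section FromModule

variable {V W : Type*} [AddCommGroup V] [Module ℂ V] [AddCommGroup W] [Module ℂ W]

/-- The translation operator of a vertex algebra. -/
def VertexAlgebra.D (A : VertexAlgebra V) : V →ₗ[ℂ] V where
  toFun v := ncoeff (A.Y v) (-2) A.vac
  map_add' u v := by rw [map_add, map_add]; rfl
  map_smul' c v := by rw [map_smul, map_smul]; rfl

theorem VAModule.Y_vac {A : VertexAlgebra V} (M : VAModule A W) : M.Y A.vac = idField W :=
  field_ext fun n w => by rw [M.vac_mode, ncoeff_idField]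

theorem nprod_idField_neg_two (F : VertexOperator ℂ W) : nprod F (idField W) (-2) = dField F := by
  have h := dField_nprod F (idField W) (-1)
  have h0 : nprodL (-1) F (0 : VertexOperator ℂ W) = 0 := map_zero _
  rw [nprodL_apply] at h0
  rw [nprod_idField, dField_idField, h0, neg_neg, one_smul, add_zero] at h
  exact h.symm

theorem VAModule.Y_D {A : VertexAlgebra V} (M : VAModule A W) (v : V) :
    M.Y (A.D v) = dField (M.Y v) := by
  have h : M.Y (A.D v) = _ := M.Y_nprod v A.vac (-2)
  rw [h, M.Y_vac, nprod_idField_neg_two]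

/-- A vertex algebra as a module over itself. -/
def VertexAlgebra.adjoint (A : VertexAlgebra V) : VAModule A V where
  Y := A.Y
  vac_mode := A.vac_mode
  borcherds := A.borcherds

theorem VertexAlgebra.D_vac (A : VertexAlgebra V) : A.D A.vac = 0 := by
  change ncoeff (A.Y A.vac) (-2) A.vac = 0
  rw [A.vac_mode]
  simp

theorem VertexAlgebra.Y_injective (A : VertexAlgebra V) : Function.Injective A.Y := by
  intro u v h
  rw [← A.creation_neg_one u, h, A.creation_neg_one]

variable {g : Type*} [LieRing g] [LieAlgebra ℂ g] {κ : InvForm g} {μ : ℂ}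

/-- The vector of a formal element in a vertex algebra, given the vectors of the generators. -/
def vecP (A : VertexAlgebra V) (f : GenSpace g →ₗ[ℂ] V) (ℓ : ℂ) : Formal g →ₗ[ℂ] V :=
  formalLift A.D f (ℓ • A.vac)

theorem vecP_D (A : VertexAlgebra V) (f : GenSpace g →ₗ[ℂ] V) (ℓ : ℂ) (x : Formal g) :
    vecP A f ℓ (formalD x) = A.D (vecP A f ℓ x) :=
  formalLift_D _ _ _ (by rw [map_smul, A.D_vac, smul_zero]) x

variable (κ μ) in
/-- The vectors `f a` in a vertex algebra have the operator products of the generators of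
`t̂(g, μ)ᵒ` at level `ℓ`. -/
def HasGenOPE (A : VertexAlgebra V) (f : GenSpace g →ₗ[ℂ] V) (ℓ : ℂ) : Prop :=
  ∀ a b σ, IsOPE κ μ a b σ → ∀ i : ℕ, ncoeff (A.Y (f a)) i (f b) = vecP A f ℓ (σ i)

variable {A : VertexAlgebra V} {f : GenSpace g →ₗ[ℂ] V} {ℓ : ℂ}

/-- The linear map underlying the representation of `t̂(g, μ)ᵒ` on a module. -/
def repLin (κ : InvForm g) (μ : ℂ) (f : GenSpace g →ₗ[ℂ] V) (ℓ : ℂ) (M : VAModule A W) :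
    HatO κ μ →ₗ[ℂ] Module.End ℂ W :=
  liftHat κ μ (fun n => LinearMap.proj n ∘ₗ ncoeff ∘ₗ M.Y ∘ₗ f) (ℓ • 1)

theorem repLin_mode (M : VAModule A W) (n : ℤ) (a : GenSpace g) :
    repLin κ μ f ℓ M (mode κ μ n a) = ncoeff (M.Y (f a)) n :=
  liftHat_mode _ _ _ _ _ _

theorem repLin_hK0 (M : VAModule A W) : repLin κ μ f ℓ M (hK0 κ μ) = ℓ • 1 :=
  liftHat_hK0 _ _ _ _

theorem repLin_modeP (M : VAModule A W) (x : Formal g) (n : ℤ) :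
    repLin κ μ f ℓ M (modeP κ μ x n) = ncoeff (M.Y (vecP A f ℓ x)) n := by
  induction x using formal_induction generalizing n with
  | hadd x y hx hy =>
    rw [map_add, map_add, Pi.add_apply, map_add, hx, hy, map_add, map_add, Pi.add_apply]
  | hgen a => rw [modeP_gen, repLin_mode, vecP, formalLift_gen]
  | hk c =>
    rw [map_smul, Pi.smul_apply, map_smul, map_smul, map_smul, map_smul, Pi.smul_apply, modeP_k0,
      vecP, formalLift_k0, map_smul, map_smul, Pi.smul_apply, M.vac_mode]
    split_ifs
    · rw [repLin_hK0]
    · rw [map_zero, smul_zero, smul_zero, smul_zero]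
  | hD x hx =>
    rw [modeP_D, map_zsmul, hx, vecP_D, M.Y_D]
    refine LinearMap.ext fun w => ?_
    rw [ncoeff_dField, LinearMap.smul_apply]

/-- The commutator formula in a module. -/
theorem VAModule.commutator (M : VAModule A W) (u v : V) (w : W) (p q : ℤ) :
    ncoeff (M.Y u) p (ncoeff (M.Y v) q w) - ncoeff (M.Y v) q (ncoeff (M.Y u) p w) =
      ∑ᶠ i : ℕ, Ring.choose p i • ncoeff (M.Y (ncoeff (A.Y u) i v)) (p + q - i) w := by
  have h := M.borcherds u v w p q 0
  have e := finsum_cf_zero fun i : ℕ =>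
        (ncoeff (M.Y u) (p + 0 - i) (ncoeff (M.Y v) (q + i) w) -
          ((0 : ℤ).negOnePow : ℤ) • ncoeff (M.Y v) (q + 0 - i) (ncoeff (M.Y u) (p + i) w))
  simp only [cf] at e
  rw [e] at h
  simpa using h.symm

/-- The commutator formula in the module turns the operator products of the vectors `f a` into the
bracket relations of `t̂(g, μ)ᵒ`. -/
theorem repLin_lie (hf : HasGenOPE κ μ A f ℓ) (M : VAModule A W) (x y : HatO κ μ) :
    repLin κ μ f ℓ M ⁅x, y⁆ = ⁅repLin κ μ f ℓ M x, repLin κ μ f ℓ M y⁆ := by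
  have key : ∀ a b : GenSpace g, ∀ m n : ℤ, repLin κ μ f ℓ M ⁅mode κ μ m a, mode κ μ n b⁆ =
      ⁅repLin κ μ f ℓ M (mode κ μ m a), repLin κ μ f ℓ M (mode κ μ n b)⁆ := by
    refine ope_induction (κ := κ) (μ := μ) (fun a a' b h h' m n => ?_) (fun c a b h m n => ?_)
      (fun a b h m n => ?_) fun a b σ h m n => ?_
    · rw [map_add, add_lie, map_add, h, h', map_add, add_lie]
    · rw [map_smul, smul_lie, map_smul, h, map_smul, smul_lie]
    · rw [← lie_skew, map_neg, h, lie_skew]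
    · refine LinearMap.ext fun w => ?_
      rw [h.lie_eq, map_sum, LinearMap.sum_apply, repLin_mode, repLin_mode]
      change _ = ncoeff (M.Y (f a)) m (ncoeff (M.Y (f b)) n w) -
        ncoeff (M.Y (f b)) n (ncoeff (M.Y (f a)) m w)
      rw [M.commutator, finsum_eq_range (I := 4)]
      · refine Finset.sum_congr rfl fun t _ => ?_
        rw [map_zsmul, repLin_modeP, hf a b σ h, LinearMap.smul_apply]
      · intro t ht
        rw [hf a b σ h, h.eq_zero t ht, map_zero, map_zero, map_zero, Pi.zero_apply,
          LinearMap.zero_apply, smul_zero]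
  have hk : ∀ z : Module.End ℂ W, ⁅ℓ • (1 : Module.End ℂ W), z⁆ = 0 := fun z => by
    rw [smul_lie, LieRing.of_associative_ring_bracket, one_mul, mul_one, sub_self, smul_zero]
  induction x using hat_induction with
  | hadd x x' h h' => rw [add_lie, map_add, map_add, add_lie, h, h']
  | hsmul c x h => rw [smul_lie, map_smul, map_smul, smul_lie, h]
  | h0 => rw [hK0_lie, map_zero, repLin_hK0, hk]
  | hm m a =>
    induction y using hat_induction with
    | hadd y y' h h' => rw [lie_add, map_add, map_add, lie_add, h, h']
    | hsmul c y h => rw [lie_smul, map_smul, map_smul, lie_smul, h]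
    | h0 => rw [lie_hK0, map_zero, repLin_hK0, ← lie_skew, hk, neg_zero]
    | hm n b => exact key a b m n

/-- The representation of `t̂(g, μ)ᵒ` on a module of a vertex algebra containing vectors with the
operator products of the generators. -/
def repOfModule (hf : HasGenOPE κ μ A f ℓ) (M : VAModule A W) : HatRep κ μ W where
  __ := repLin κ μ f ℓ M
  map_lie' {x y} := repLin_lie hf M x y

theorem repOfModule_mode (hf : HasGenOPE κ μ A f ℓ) (M : VAModule A W) (n : ℤ) (a : GenSpace g) :
    repOfModule hf M (mode κ μ n a) = ncoeff (M.Y (f a)) n := repLin_mode M n a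

theorem repOfModule_restricted (hf : HasGenOPE κ μ A f ℓ) (M : VAModule A W) :
    IsRestricted (repOfModule hf M) :=
  fun a => ⟨M.Y (f a), fun n => (repOfModule_mode hf M n a).symm⟩

theorem repOfModule_level (hf : HasGenOPE κ μ A f ℓ) (M : VAModule A W) :
    HasLevel (repOfModule hf M) ℓ := fun w => by
  have : repOfModule hf M (hK0 κ μ) = _ := repLin_hK0 M
  rw [this]
  rfl

/-- Representations of the same level agree if they agree on the modes of the generators. -/
theorem hatRep_ext {ρ ρ' : HatRep κ μ W} (hl : HasLevel ρ ℓ) (hl' : HasLevel ρ' ℓ)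
    (h : ∀ n a, ρ (mode κ μ n a) = ρ' (mode κ μ n a)) : ρ = ρ' := by
  have : (ρ : HatO κ μ →ₗ[ℂ] Module.End ℂ W) = ρ' :=
    hat_hom_ext h (LinearMap.ext fun w => (hl w).trans (hl' w).symm)
  exact LieHom.ext fun x => LinearMap.congr_fun this x

end FromModule

/-! ### The space of fields generated by a local family -/

section Generated

variable {W : Type*} [AddCommGroup W] [Module ℂ W]

/-- The fields obtained from a family and the identity by iterated `n`-th products of mutually
local fields.  (If the family is local, the locality condition is automatic.) -/
inductive FieldGen (S : Set (VertexOperator ℂ W)) : VertexOperator ℂ W → Prop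
  | id : FieldGen S (idField W)
  | mem {F : VertexOperator ℂ W} : F ∈ S → FieldGen S F
  | nprod {F G : VertexOperator ℂ W} (n : ℤ) : FieldGen S F → FieldGen S G → IsLocal F G →
      FieldGen S (nprod F G n)

theorem FieldGen.isLocal {S : Set (VertexOperator ℂ W)} (hS : ∀ F ∈ S, ∀ G ∈ S, IsLocal F G)
    {F G : VertexOperator ℂ W} (hF : FieldGen S F) (hG : FieldGen S G) : IsLocal F G := by
  have h1 : ∀ F ∈ S, IsLocal F G := by
    intro F hF
    induction hG with
    | id => exact isLocal_idField F
    | mem hG => exact hS F hF _ hG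
    | nprod n _ _ hl h1 h2 => exact (hl.nprod h1.symm h2.symm n).symm
  induction hF with
  | id => exact (isLocal_idField G).symm
  | mem hF => exact h1 _ hF
  | nprod n _ _ hl h1 h2 => exact hl.nprod h1 h2 n

/-- The span of the fields generated by a family. -/
def genAlg (S : Set (VertexOperator ℂ W)) : Submodule ℂ (VertexOperator ℂ W) :=
  Submodule.span ℂ {F | FieldGen S F}

/-- A local family of fields generates a space of pairwise local fields that is closed under all
products. -/
theorem isFieldAlgebra_genAlg {S : Set (VertexOperator ℂ W)}
    (hS : ∀ F ∈ S, ∀ G ∈ S, IsLocal F G) : IsFieldAlgebra (genAlg S) where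
  id_mem := Submodule.subset_span .id
  nprod_mem F hF G hG n := by
    rw [← nprodL_apply]
    induction hF, hG using Submodule.span_induction₂ with
    | mem_mem F G hF hG => exact Submodule.subset_span (.nprod n hF hG (hF.isLocal hS hG))
    | zero_left G _ => rw [LinearMap.map_zero₂]; exact zero_mem _
    | zero_right F _ => rw [map_zero]; exact zero_mem _
    | add_left F F' G _ _ _ h h' => rw [LinearMap.map_add₂]; exact add_mem h h'
    | add_right F G G' _ _ _ h h' => rw [map_add]; exact add_mem h h'
    | smul_left c F G _ _ h => rw [LinearMap.map_smul₂]; exact Submodule.smul_mem _ _ h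
    | smul_right c F G _ _ h => rw [map_smul]; exact Submodule.smul_mem _ _ h
  isLocal F hF G hG := by
    induction hF, hG using Submodule.span_induction₂ with
    | mem_mem F G hF hG => exact hF.isLocal hS hG
    | zero_left G _ => exact isLocal_zero_left G
    | zero_right F _ => exact (isLocal_zero_left F).symm
    | add_left F F' G _ _ _ h h' => exact h.add_left h'
    | add_right F G G' _ _ _ h h' => exact (h.symm.add_left h'.symm).symm
    | smul_left c F G _ _ h => exact h.smul_left c
    | smul_right c F G _ _ h => exact (h.symm.smul_left c).symm

/-- A vector killed by the nonnegative modes of a family is killed by the nonnegative modes of all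
generated fields. -/
theorem genAlg_creation {S : Set (VertexOperator ℂ W)} {w : W}
    (hS : ∀ F ∈ S, ∀ n : ℤ, 0 ≤ n → ncoeff F n w = 0) {F : VertexOperator ℂ W} (hF : F ∈ genAlg S)
    {n : ℤ} (hn : 0 ≤ n) : ncoeff F n w = 0 := by
  induction hF using Submodule.span_induction with
  | mem F hF =>
    induction hF generalizing n with
    | id => rw [ncoeff_idField, if_neg (by omega)]; rfl
    | mem hF => exact hS _ hF n hn
    | nprod r _ _ _ h1 h2 =>
      rw [ncoeff_nprod]
      refine (finsum_congr fun i => ?_).trans finsum_zero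
      beta_reduce
      rw [h2 (by omega), h1 (by omega), map_zero, map_zero, smul_zero, sub_zero, smul_zero]
  | zero => rw [map_zero]; rfl
  | add F G _ _ h h' => rw [map_add, Pi.add_apply, LinearMap.add_apply, h, h', add_zero]
  | smul c F _ h => rw [map_smul, Pi.smul_apply, LinearMap.smul_apply, h, smul_zero]

end Generated

section Stable

variable {X : Type*} [AddCommGroup X] [Module ℂ X]

theorem finsum_mem_submodule (S : Submodule ℂ X) {f : ℕ → X} (h : ∀ i, f i ∈ S) :
    ∑ᶠ i, f i ∈ S :=
  finsum_induction (· ∈ S) S.zero_mem (fun _ _ => S.add_mem) h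

/-- The subspaces stable under the modes of `u` and of `v` are stable under those of `u_r v`. -/
theorem stable_nprod {F G : VertexOperator ℂ X} {S : Submodule ℂ X}
    (hF : ∀ n, ∀ w ∈ S, ncoeff F n w ∈ S) (hG : ∀ n, ∀ w ∈ S, ncoeff G n w ∈ S) (r n : ℤ) {w : X}
    (hw : w ∈ S) : ncoeff (nprod F G r) n w ∈ S := by
  rw [ncoeff_nprod]
  refine finsum_mem_submodule S fun i => S.smul_of_tower_mem _ (S.sub_mem ?_ ?_)
  · exact hF _ _ (hG _ _ hw)
  · exact S.smul_of_tower_mem _ (hG _ _ (hF _ _ hw))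

theorem VertexAlgebra.Y_nprod (A : VertexAlgebra X) (u v : X) (n : ℤ) :
    A.Y (ncoeff (A.Y u) n v) = nprod (A.Y u) (A.Y v) n := A.adjoint.Y_nprod u v n

theorem VertexAlgebra.Y_vac (A : VertexAlgebra X) : A.Y A.vac = idField X := A.adjoint.Y_vac

/-- The vectors of a vertex algebra whose modes preserve a given subspace. -/
def VertexAlgebra.stabilizer (A : VertexAlgebra X) (T : Submodule ℂ X) : Submodule ℂ X where
  carrier := {F | ∀ n, ∀ w ∈ T, ncoeff (A.Y F) n w ∈ T}
  add_mem' hF hG n w hw := by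
    rw [map_add, map_add]
    exact T.add_mem (hF n w hw) (hG n w hw)
  zero_mem' n w _ := by
    rw [map_zero, map_zero]
    exact T.zero_mem
  smul_mem' c F hF n w hw := by
    rw [map_smul, map_smul]
    exact T.smul_mem c (hF n w hw)

theorem VertexAlgebra.vac_mem_stabilizer (A : VertexAlgebra X) (T : Submodule ℂ X) :
    A.vac ∈ A.stabilizer T := fun n w hw => by
  rw [A.vac_mode]
  split_ifs
  · exact hw
  · exact T.zero_mem

theorem VertexAlgebra.mode_mem_stabilizer (A : VertexAlgebra X) (T : Submodule ℂ X) {F G : X}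
    (hF : F ∈ A.stabilizer T) (hG : G ∈ A.stabilizer T) (r : ℤ) :
    ncoeff (A.Y F) r G ∈ A.stabilizer T := fun n w hw => by
  rw [A.Y_nprod]
  exact stable_nprod hF hG r n hw

theorem VertexAlgebra.stabilizer_le (A : VertexAlgebra X) (T : Submodule ℂ X) (hT : A.vac ∈ T) :
    A.stabilizer T ≤ T := fun F hF => by
  have := hF (-1) _ hT
  rwa [A.creation_neg_one] at this

variable {W : Type*} [AddCommGroup W] [Module ℂ W]

/-- The vertex algebra generated by a local family of fields is spanned by the vectors obtained
from the vacuum by the modes of the family. -/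
theorem genAlg_generation {S : Set (VertexOperator ℂ W)} (hS : ∀ F ∈ S, ∀ G ∈ S, IsLocal F G)
    (T : Submodule ℂ (genAlg S)) (hT : (isFieldAlgebra_genAlg hS).vertexAlgebra.vac ∈ T)
    (hT' : ∀ F : genAlg S, F.1 ∈ S → F ∈ (isFieldAlgebra_genAlg hS).vertexAlgebra.stabilizer T)
    (F : genAlg S) : F ∈ T := by
  have hU := isFieldAlgebra_genAlg hS
  have key : genAlg S ≤ (hU.vertexAlgebra.stabilizer T).map (genAlg S).subtype := by
    refine Submodule.span_le.2 fun F h => ?_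
    induction h with
    | id => exact ⟨_, hU.vertexAlgebra.vac_mem_stabilizer T, rfl⟩
    | mem h => exact ⟨⟨_, Submodule.subset_span (.mem h)⟩, hT' ⟨_, _⟩ h, rfl⟩
    | nprod r _ _ _ ih1 ih2 =>
      obtain ⟨F, hF, rfl⟩ := ih1
      obtain ⟨G, hG, rfl⟩ := ih2
      exact ⟨_, hU.vertexAlgebra.mode_mem_stabilizer T hF hG r, hU.coe_ncoeff_Y F G r⟩
  obtain ⟨F', hF', e⟩ := key F.2
  obtain rfl : F' = F := Subtype.ext e
  exact hU.vertexAlgebra.stabilizer_le T hT hF'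

end Stable

/-! ### The universal property of the induced module -/

section Universal

variable {g : Type*} [LieRing g] [LieAlgebra ℂ g] {κ : InvForm g} {μ : ℂ}

theorem env_adjoin : Algebra.adjoin ℂ (Set.range (emb κ μ)) = ⊤ := by
  let S := Algebra.adjoin ℂ (Set.range (emb κ μ))
  let f : HatO κ μ →ₗ⁅ℂ⁆ S :=
    { toFun := fun x => ⟨emb κ μ x, Algebra.subset_adjoin ⟨x, rfl⟩⟩
      map_add' := fun x y => Subtype.ext (map_add (UniversalEnvelopingAlgebra.ι ℂ) x y)
      map_smul' := fun c x => Subtype.ext (map_smul (UniversalEnvelopingAlgebra.ι ℂ) c x)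
      map_lie' := fun {x y} => Subtype.ext (LieHom.map_lie (UniversalEnvelopingAlgebra.ι ℂ) x y) }
  have h : S.val.comp (UniversalEnvelopingAlgebra.lift ℂ f) = AlgHom.id ℂ _ := by
    ext x
    simp only [LieHom.comp_apply, AlgHom.coe_toLieHom, AlgHom.comp_apply,
      UniversalEnvelopingAlgebra.lift_ι_apply, AlgHom.id_apply]
    rfl
  refine eq_top_iff.2 fun x _ => ?_
  have := DFunLike.congr_fun h x
  rw [AlgHom.id_apply] at this
  rw [← this]
  exact (UniversalEnvelopingAlgebra.lift ℂ f x).2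

theorem emb_add (x y : HatO κ μ) : emb κ μ (x + y) = emb κ μ x + emb κ μ y :=
  map_add (UniversalEnvelopingAlgebra.ι ℂ) x y

theorem emb_smul (c : ℂ) (x : HatO κ μ) : emb κ μ (c • x) = c • emb κ μ x :=
  map_smul (UniversalEnvelopingAlgebra.ι ℂ) c x

theorem emb_lie (x y : HatO κ μ) :
    emb κ μ ⁅x, y⁆ = emb κ μ x * emb κ μ y - emb κ μ y * emb κ μ x :=
  LieHom.map_lie (UniversalEnvelopingAlgebra.ι ℂ) x y

/-- A left multiplication stable property holds on an `Env`-module generated by one vector. -/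
theorem env_smul_induction {M : Type*} [AddCommGroup M] [Module ℂ M] [Module (Env κ μ) M]
    [IsScalarTower ℂ (Env κ μ) M] {p : M → Prop} (hadd : ∀ x y, p x → p y → p (x + y))
    (hsmul : ∀ (c : ℂ) x, p x → p (c • x)) (hm : ∀ y x, p x → p (emb κ μ y • x)) (x : Env κ μ)
    {v : M} (hv : p v) : p (x • v) := by
  have hx : x ∈ Algebra.adjoin ℂ (Set.range (emb κ μ)) := by
    rw [env_adjoin]; exact Algebra.mem_top
  induction hx using Algebra.adjoin_induction generalizing v with
  | mem x hx =>
    obtain ⟨y, rfl⟩ := hx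
    exact hm y v hv
  | algebraMap c => rw [algebraMap_smul]; exact hsmul c v hv
  | add x y _ _ hx hy => rw [add_smul]; exact hadd _ _ (hx hv) (hy hv)
  | mul x y _ _ hx hy => rw [mul_smul]; exact hx (hy hv)

/-- An `Env`-module as a representation. -/
def repOfEnv (M : Type*) [AddCommGroup M] [Module ℂ M] [Module (Env κ μ) M]
    [IsScalarTower ℂ (Env κ μ) M] : HatRep κ μ M :=
  (Algebra.lsmul ℂ ℂ M : Env κ μ →ₐ[ℂ] Module.End ℂ M).toLieHom.comp
    (UniversalEnvelopingAlgebra.ι ℂ)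

/-- Vectors are killed by the positive part if they are killed by the nonnegative modes of the
generators. -/
theorem plusGens_iff {X : Type*} [AddCommGroup X] [Module ℂ X] (T : HatO κ μ →ₗ[ℂ] X) :
    (∀ y ∈ plusGens κ μ, T y = 0) ↔ ∀ (n : ℤ) (a : GenSpace g), 0 ≤ n → T (mode κ μ n a) = 0 := by
  constructor
  · intro h n a hn
    obtain ⟨n, rfl⟩ := Int.eq_ofNat_of_zero_le hn
    induction a using genSpace_induction with
    | hadd a b ha hb => rw [map_add, map_add, ha, hb, add_zero]
    | hsmul c a ha => rw [map_smul, map_smul, ha, smul_zero]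
    | hL p u => rw [mode_genL]; exact h _ (Or.inl (Or.inl ⟨n, p, u, rfl⟩))
    | hK1 => rw [mode_genK1]; exact h _ (Or.inl (Or.inr ⟨n, Or.inl rfl⟩))
    | hD1 => rw [mode_genD1]; exact h _ (Or.inl (Or.inr ⟨n, Or.inr rfl⟩))
    | hK p => rw [mode_genK]; exact h _ (Or.inr ⟨n, p, Or.inl rfl⟩)
    | hD p => rw [mode_genD]; exact h _ (Or.inr ⟨n, p, Or.inr rfl⟩)
  · intro h y hy
    rcases hy with (⟨n, m, u, rfl⟩ | ⟨n, rfl | rfl⟩) | ⟨n, m, rfl | rfl⟩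
    · rw [← mode_genL]; exact h _ _ (by simp)
    · rw [← mode_genK1]; exact h _ _ (by simp)
    · rw [← mode_genD1]; exact h _ _ (by simp)
    · by_cases hm : m = 0
      · have e : hKK κ μ (n + 1) m = (-1 / (n + 1) : ℂ) • hK1 κ μ (n + 1) := by
          subst hm
          refine Subtype.ext ?_
          change kk κ μ (n + 1) 0 = (-1 / (n + 1) : ℂ) • kform κ μ (n + 1) 0 0 1
          rw [kk, if_neg (by simp), if_pos (by omega), kform, kform, ← hom_smul]
          congr 1
          ext <;> simp
        rw [e, map_smul, ← mode_genK1, h _ _ (by omega), smul_zero]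
      · have := h n (genK ⟨m, hm⟩) (by simp)
        rwa [mode_genK] at this
    · by_cases hm : m = 0
      · have e : hDD κ μ (n - 1) m = (n : ℂ) • hD1 κ μ (n - 1) := by
          subst hm
          refine Subtype.ext ?_
          change dd κ μ _ _ = (n : ℂ) • der κ μ _ _ _ _
          rw [dd, dbar, kform, der, der, ← hom_add, ← hom_smul]
          congr 1
          ext <;> simp
        rw [e, map_smul, ← mode_genD1]
        rcases Nat.eq_zero_or_pos n with rfl | hn
        · simp
        · rw [h _ _ (by omega), smul_zero]
      · have := h n (genD ⟨m, hm⟩) (by simp)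
        rwa [mode_genD] at this

variable {ℓ : ℂ}

theorem mode_smul_one {n : ℤ} (hn : 0 ≤ n) (a : GenSpace g) :
    emb κ μ (mode κ μ n a) • one κ μ ℓ = 0 := by
  have h : ∀ y ∈ plusGens κ μ, emb κ μ y • one κ μ ℓ = 0 := fun y hy => by
    rw [one, ← map_smul, smul_eq_mul, mul_one]
    exact (Submodule.Quotient.mk_eq_zero _).2 (Submodule.subset_span (Or.inl ⟨y, hy, rfl⟩))
  exact (plusGens_iff ((LinearMap.toSpanSingleton (Env κ μ) _ (one κ μ ℓ)).restrictScalars ℂ ∘ₗ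
    (UniversalEnvelopingAlgebra.ι ℂ : HatO κ μ →ₗ⁅ℂ⁆ Env κ μ).toLinearMap)).1 h n a hn

theorem mkQ_eq_smul_one (x : Env κ μ) : (inducedIdeal κ μ ℓ).mkQ x = x • one κ μ ℓ := by
  rw [one, ← map_smul, smul_eq_mul, mul_one]

theorem hK0_smul (v : VSpace κ μ ℓ) : emb κ μ (hK0 κ μ) • v = ℓ • v := by
  obtain ⟨x, rfl⟩ := (inducedIdeal κ μ ℓ).mkQ_surjective v
  rw [mkQ_eq_smul_one]
  refine env_smul_induction (p := fun v => emb κ μ (hK0 κ μ) • v = ℓ • v) ?_ ?_ ?_ x ?_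
  · intro x y hx hy
    rw [smul_add, hx, hy, smul_add]
  · intro c x hx
    rw [smul_comm, hx, smul_comm]
  · intro y x hx
    have h := emb_lie (hK0 κ μ) y
    have h0 : emb κ μ (0 : HatO κ μ) = 0 := map_zero (UniversalEnvelopingAlgebra.ι ℂ)
    rw [hK0_lie, h0, eq_comm, sub_eq_zero] at h
    rw [← mul_smul, h, mul_smul, hx, smul_comm]
  · rw [← sub_eq_zero, ← algebraMap_smul (Env κ μ) ℓ (one κ μ ℓ), ← sub_smul, ← mkQ_eq_smul_one]
    exact (Submodule.Quotient.mk_eq_zero _).2 (Submodule.subset_span (Or.inr rfl))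

/-- `V(ℓ)` is spanned by the vectors obtained from `𝟏` by the modes of the generators. -/
theorem vspace_induction {p : VSpace κ μ ℓ → Prop} (h1 : p (one κ μ ℓ))
    (hadd : ∀ x y, p x → p y → p (x + y)) (hsmul : ∀ (c : ℂ) x, p x → p (c • x))
    (hm : ∀ n a x, p x → p (emb κ μ (mode κ μ n a) • x)) (v : VSpace κ μ ℓ) : p v := by
  obtain ⟨x, rfl⟩ := (inducedIdeal κ μ ℓ).mkQ_surjective v
  rw [mkQ_eq_smul_one]
  refine env_smul_induction hadd hsmul (fun y x hx => ?_) x h1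
  induction y using hat_induction with
  | hadd y y' h h' => rw [emb_add, add_smul]; exact hadd _ _ h h'
  | hsmul c y h => rw [emb_smul, smul_assoc]; exact hsmul _ _ h
  | hm n a => exact hm n a x hx
  | h0 => rw [hK0_smul]; exact hsmul _ _ hx

/-- The left multiplication representation on `V(ℓ)`. -/
def vRep (κ : InvForm g) (μ ℓ : ℂ) : HatRep κ μ (VSpace κ μ ℓ) := repOfEnv (VSpace κ μ ℓ)

theorem vRep_apply (x : HatO κ μ) (v : VSpace κ μ ℓ) : vRep κ μ ℓ x v = emb κ μ x • v := rfl

theorem vRep_level : HasLevel (vRep κ μ ℓ) ℓ := fun v => hK0_smul v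

theorem modeP_trunc {X : Type*} [AddCommGroup X] [Module ℂ X] {T : HatO κ μ →ₗ[ℂ] X}
    (h : ∀ a, ∃ N : ℤ, ∀ n, N ≤ n → T (mode κ μ n a) = 0) (x : Formal g) :
    ∃ N : ℤ, ∀ n, N ≤ n → T (modeP κ μ x n) = 0 := by
  induction x using formal_induction with
  | hadd x y hx hy =>
    obtain ⟨N, hN⟩ := hx
    obtain ⟨M, hM⟩ := hy
    exact ⟨max N M, fun n hn => by
      rw [map_add, Pi.add_apply, map_add, hN n (by omega), hM n (by omega), add_zero]⟩
  | hgen a => simpa only [modeP_gen] using h a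
  | hk c =>
    refine ⟨0, fun n hn => ?_⟩
    rw [map_smul, Pi.smul_apply, modeP_k0, if_neg (by omega), smul_zero, map_zero]
  | hD x hx =>
    obtain ⟨N, hN⟩ := hx
    exact ⟨N + 1, fun n hn => by rw [modeP_D, map_zsmul, hN _ (by omega), smul_zero]⟩

/-- If the high modes of all generators are killed, so are their brackets with a fixed mode. -/
theorem ope_trunc {X : Type*} [AddCommGroup X] [Module ℂ X] {T : HatO κ μ →ₗ[ℂ] X}
    (h : ∀ a, ∃ N : ℤ, ∀ n, N ≤ n → T (mode κ μ n a) = 0) (a b : GenSpace g) (m : ℤ) :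
    ∃ N : ℤ, ∀ n, N ≤ n → T ⁅mode κ μ n a, mode κ μ m b⁆ = 0 := by
  refine (ope_induction (κ := κ) (μ := μ)
    (P := fun a b => (∀ m, ∃ N : ℤ, ∀ n, N ≤ n → T ⁅mode κ μ n a, mode κ μ m b⁆ = 0) ∧
      ∀ m, ∃ N : ℤ, ∀ n, N ≤ n → T ⁅mode κ μ m a, mode κ μ n b⁆ = 0) ?_ ?_ ?_ ?_ a b).1 m
  · rintro a a' b ⟨h1, h2⟩ ⟨h1', h2'⟩
    constructor <;> intro m
    · obtain ⟨N, hN⟩ := h1 m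
      obtain ⟨M, hM⟩ := h1' m
      exact ⟨max N M, fun n hn => by
        rw [map_add, add_lie, map_add, hN n (by omega), hM n (by omega), add_zero]⟩
    · obtain ⟨N, hN⟩ := h2 m
      obtain ⟨M, hM⟩ := h2' m
      exact ⟨max N M, fun n hn => by
        rw [map_add, add_lie, map_add, hN n (by omega), hM n (by omega), add_zero]⟩
  · rintro c a b ⟨h1, h2⟩
    constructor <;> intro m
    · obtain ⟨N, hN⟩ := h1 m
      exact ⟨N, fun n hn => by rw [map_smul, smul_lie, map_smul, hN n hn, smul_zero]⟩
    · obtain ⟨N, hN⟩ := h2 m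
      exact ⟨N, fun n hn => by rw [map_smul, smul_lie, map_smul, hN n hn, smul_zero]⟩
  · rintro a b ⟨h1, h2⟩
    constructor <;> intro m
    · obtain ⟨N, hN⟩ := h2 m
      exact ⟨N, fun n hn => by rw [← lie_skew, map_neg, hN n hn, neg_zero]⟩
    · obtain ⟨N, hN⟩ := h1 m
      exact ⟨N, fun n hn => by rw [← lie_skew, map_neg, hN n hn, neg_zero]⟩
  · intro a b σ hσ
    choose N hN using fun t => modeP_trunc h (σ t)
    have key : ∀ m n : ℤ, (∀ t : ℕ, t < 4 → N t ≤ m + n - t) →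
        T ⁅mode κ μ m a, mode κ μ n b⁆ = 0 := fun m n hmn => by
      rw [hσ.lie_eq, map_sum]
      refine Finset.sum_eq_zero fun t ht => ?_
      rw [map_zsmul, hN t _ (hmn t (Finset.mem_range.1 ht)), smul_zero]
    have hb : ∀ m : ℤ, ∃ M : ℤ, ∀ n, M ≤ n → ∀ t : ℕ, t < 4 → N t ≤ m + n - t := fun m =>
      ⟨max (max (N 0) (N 1)) (max (N 2) (N 3)) + 3 - m, fun n hn t ht => by
        interval_cases t <;> push_cast <;> omega⟩
    constructor <;> intro m
    · obtain ⟨M, hM⟩ := hb m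
      exact ⟨M, fun n hn => key n m fun t ht => by have := hM n hn t ht; omega⟩
    · obtain ⟨M, hM⟩ := hb m
      exact ⟨M, fun n hn => key m n (hM n hn)⟩

/-- `V(ℓ)` is a restricted module. -/
theorem vRep_restricted : IsRestricted (vRep κ μ ℓ) := by
  refine isRestricted_of_trunc fun a v => ?_
  induction v using vspace_induction generalizing a with
  | h1 => exact ⟨0, fun n hn => mode_smul_one hn a⟩
  | hadd x y hx hy =>
    obtain ⟨N, hN⟩ := hx a
    obtain ⟨M, hM⟩ := hy a
    exact ⟨max N M, fun n hn => by rw [map_add, hN n (by omega), hM n (by omega), add_zero]⟩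
  | hsmul c x hx =>
    obtain ⟨N, hN⟩ := hx a
    exact ⟨N, fun n hn => by rw [map_smul, hN n hn, smul_zero]⟩
  | hm m b x hx =>
    obtain ⟨N, hN⟩ := hx a
    let T : HatO κ μ →ₗ[ℂ] VSpace κ μ ℓ :=
      LinearMap.applyₗ x ∘ₗ (vRep κ μ ℓ : HatO κ μ →ₗ[ℂ] Module.End ℂ (VSpace κ μ ℓ))
    obtain ⟨M, hM⟩ := ope_trunc (T := T) hx a b m
    refine ⟨max N M, fun n hn => ?_⟩
    have h1 : vRep κ μ ℓ ⁅mode κ μ n a, mode κ μ m b⁆ x = 0 := hM n (by omega)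
    rw [LieHom.map_lie] at h1
    have h2 : vRep κ μ ℓ (mode κ μ n a) (vRep κ μ ℓ (mode κ μ m b) x) -
      vRep κ μ ℓ (mode κ μ m b) (vRep κ μ ℓ (mode κ μ n a) x) = 0 := h1
    rwa [hN n (by omega), map_zero, sub_zero] at h2

section Lift

variable {X : Type*} [AddCommGroup X] [Module ℂ X] {ρ : HatRep κ μ X} {x₀ : X}

/-- The universal property of the induced module. -/
theorem vLift_aux (hl : HasLevel ρ ℓ) (h0 : ∀ n a, 0 ≤ n → ρ (mode κ μ n a) x₀ = 0) :
    ∃ φ : VSpace κ μ ℓ →ₗ[ℂ] X, φ (one κ μ ℓ) = x₀ ∧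
      ∀ x v, φ (emb κ μ x • v) = ρ x (φ v) := by
  let T : HatO κ μ →ₗ[ℂ] X := LinearMap.applyₗ x₀ ∘ₗ (ρ : HatO κ μ →ₗ[ℂ] Module.End ℂ X)
  have hp := (plusGens_iff T).2 fun n a hn => h0 n a hn
  let Φ : Env κ μ →ₐ[ℂ] Module.End ℂ X := UniversalEnvelopingAlgebra.lift ℂ ρ
  have hΦ : ∀ y, Φ (emb κ μ y) = ρ y := fun y => UniversalEnvelopingAlgebra.lift_ι_apply ℂ ρ y
  let ψ : Env κ μ →ₗ[ℂ] X := LinearMap.applyₗ x₀ ∘ₗ Φ.toLinearMap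
  have hψ : ∀ x y, ψ (x * y) = Φ x (ψ y) := fun x y => by
    change Φ (x * y) x₀ = Φ x (Φ y x₀)
    rw [map_mul]; rfl
  have hker : (inducedIdeal κ μ ℓ).restrictScalars ℂ ≤ LinearMap.ker ψ := by
    intro x hx
    rw [LinearMap.mem_ker]
    rw [Submodule.restrictScalars_mem] at hx
    induction hx using Submodule.span_induction with
    | mem x hx =>
      rcases hx with ⟨y, hy, rfl⟩ | rfl
      · change Φ (emb κ μ y) x₀ = 0
        rw [hΦ]
        exact hp y hy
      · change Φ (emb κ μ (hK0 κ μ) - algebraMap ℂ (Env κ μ) ℓ) x₀ = 0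
        rw [map_sub, hΦ, AlgHom.commutes, LinearMap.sub_apply, hl, Module.algebraMap_end_apply,
          sub_self]
    | zero => exact map_zero ψ
    | add x y _ _ hx hy => rw [map_add, hx, hy, add_zero]
    | smul a x _ hx => rw [smul_eq_mul, hψ, hx, map_zero]
  let φ : VSpace κ μ ℓ →ₗ[ℂ] X := (((inducedIdeal κ μ ℓ).restrictScalars ℂ).liftQ ψ hker) ∘ₗ
    (Submodule.Quotient.restrictScalarsEquiv ℂ (inducedIdeal κ μ ℓ)).symm.toLinearMap
  have hφ : ∀ x, φ ((inducedIdeal κ μ ℓ).mkQ x) = ψ x := fun x => rfl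
  refine ⟨φ, ?_, ?_⟩
  · rw [one, hφ]
    change Φ 1 x₀ = x₀
    rw [map_one]; rfl
  · intro y v
    obtain ⟨x, rfl⟩ := (inducedIdeal κ μ ℓ).mkQ_surjective v
    rw [← map_smul, hφ, hφ, smul_eq_mul, hψ, hΦ]

/-- The homomorphism from `V(ℓ)` to a module of level `ℓ` determined by a vector that is killed by
the nonnegative modes of the generators. -/
def vLift (hl : HasLevel ρ ℓ) (h0 : ∀ n a, 0 ≤ n → ρ (mode κ μ n a) x₀ = 0) :
    VSpace κ μ ℓ →ₗ[ℂ] X := (vLift_aux hl h0).choose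

theorem vLift_one (hl : HasLevel ρ ℓ) (h0 : ∀ n a, 0 ≤ n → ρ (mode κ μ n a) x₀ = 0) :
    vLift hl h0 (one κ μ ℓ) = x₀ := (vLift_aux hl h0).choose_spec.1

theorem vLift_smul (hl : HasLevel ρ ℓ) (h0 : ∀ n a, 0 ≤ n → ρ (mode κ μ n a) x₀ = 0)
    (x : HatO κ μ) (v : VSpace κ μ ℓ) : vLift hl h0 (emb κ μ x • v) = ρ x (vLift hl h0 v) :=
  (vLift_aux hl h0).choose_spec.2 x v

end Lift

end Universal

/-! ### The vertex algebra structure of the induced module -/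

section Transport

variable {X Y : Type*} [AddCommGroup X] [Module ℂ X] [AddCommGroup Y] [Module ℂ Y]

/-- Transport of a field along a linear isomorphism. -/
def conjField (e : X ≃ₗ[ℂ] Y) (F : VertexOperator ℂ X) : VertexOperator ℂ Y :=
  mkField (fun n => e.toLinearMap ∘ₗ ncoeff F n ∘ₗ e.symm.toLinearMap) fun w => by
    obtain ⟨N, hN⟩ := ncoeff_trunc F (e.symm w)
    exact ⟨N, fun n hn => (congrArg e (hN n hn)).trans (map_zero e)⟩

theorem ncoeff_conjField (e : X ≃ₗ[ℂ] Y) (F : VertexOperator ℂ X) (n : ℤ) (y : Y) :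
    ncoeff (conjField e F) n y = e (ncoeff F n (e.symm y)) := by
  rw [conjField, ncoeff_mkField]; rfl

/-- Transport of a vertex algebra structure along a linear isomorphism. -/
def VertexAlgebra.transport (A : VertexAlgebra X) (e : X ≃ₗ[ℂ] Y) : VertexAlgebra Y where
  vac := e A.vac
  Y :=
    { toFun := fun v => conjField e (A.Y (e.symm v))
      map_add' := fun u v => field_ext fun n w => by
        simp only [map_add, Pi.add_apply, LinearMap.add_apply, ncoeff_conjField]
      map_smul' := fun c v => field_ext fun n w => by
        simp only [map_smul, Pi.smul_apply, LinearMap.smul_apply, ncoeff_conjField,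
          RingHom.id_apply] }
  vac_mode n := by
    refine LinearMap.ext fun w => ?_
    change ncoeff (conjField e (A.Y (e.symm (e A.vac)))) n w = _
    rw [e.symm_apply_apply, ncoeff_conjField, A.vac_mode]
    split_ifs
    · exact e.apply_symm_apply w
    · exact map_zero e
  creation u n hn := by
    change ncoeff (conjField e _) n (e A.vac) = 0
    rw [ncoeff_conjField, e.symm_apply_apply, A.creation _ n hn, map_zero]
  creation_neg_one u := by
    change ncoeff (conjField e _) (-1) (e A.vac) = u
    rw [ncoeff_conjField, e.symm_apply_apply, A.creation_neg_one, e.apply_symm_apply]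
  borcherds u v w p q r := by
    have h := congrArg e.toAddEquiv
      (A.borcherds (e.symm u) (e.symm v) (e.symm w) p q r)
    rw [AddEquiv.map_finsum, AddEquiv.map_finsum] at h
    refine Eq.trans (finsum_congr fun i => ?_) (h.trans (finsum_congr fun i => ?_))
    · change _ • ncoeff (conjField e (A.Y (e.symm (ncoeff (conjField e _) _ v)))) _ w = e _
      rw [ncoeff_conjField, ncoeff_conjField, e.symm_apply_apply, map_zsmul]
    · change e _ = _ • (ncoeff (conjField e _) _ (ncoeff (conjField e _) _ _) -
        _ • ncoeff (conjField e _) _ (ncoeff (conjField e _) _ _))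
      simp only [ncoeff_conjField, e.symm_apply_apply, map_zsmul, map_sub]

theorem VertexAlgebra.ncoeff_transport (A : VertexAlgebra X) (e : X ≃ₗ[ℂ] Y) (u v : Y) (n : ℤ) :
    ncoeff ((A.transport e).Y u) n v = e (ncoeff (A.Y (e.symm u)) n (e.symm v)) :=
  ncoeff_conjField e _ n v

end Transport

section Induced

variable {g : Type*} [LieRing g] [LieAlgebra ℂ g] {κ : InvForm g} {μ : ℂ} {ℓ : ℂ}

/-- The map `a ↦ a(-1)𝟏` as a linear map. -/
def genVecL (κ : InvForm g) (μ ℓ : ℂ) : GenSpace g →ₗ[ℂ] VSpace κ μ ℓ :=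
  LinearMap.applyₗ (one κ μ ℓ) ∘ₗ
    (vRep κ μ ℓ : HatO κ μ →ₗ[ℂ] Module.End ℂ (VSpace κ μ ℓ)) ∘ₗ mode κ μ (-1)

theorem genVecL_apply (a : GenSpace g) : genVecL κ μ ℓ a = genVec κ μ ℓ a := rfl

section Hom

variable {X : Type*} [AddCommGroup X] [Module ℂ X] {A : VertexAlgebra X} {f : GenSpace g →ₗ[ℂ] X}

/-- The canonical map from `V(ℓ)` to a vertex algebra containing vectors with the operator products
of the generators. -/
def phi (hf : HasGenOPE κ μ A f ℓ) : VSpace κ μ ℓ →ₗ[ℂ] X :=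
  vLift (repOfModule_level hf A.adjoint) (x₀ := A.vac) fun n a hn => by
    rw [repOfModule_mode]
    exact A.creation _ n hn

theorem phi_one (hf : HasGenOPE κ μ A f ℓ) : phi hf (one κ μ ℓ) = A.vac := vLift_one _ _

/-- The canonical map intertwines the actions of the modes. -/
theorem phi_mode (hf : HasGenOPE κ μ A f ℓ) (n : ℤ) (a : GenSpace g) (v : VSpace κ μ ℓ) :
    phi hf (emb κ μ (mode κ μ n a) • v) = ncoeff (A.Y (f a)) n (phi hf v) := by
  rw [phi, vLift_smul, repOfModule_mode]
  rfl

theorem phi_genVec (hf : HasGenOPE κ μ A f ℓ) (a : GenSpace g) : phi hf (genVec κ μ ℓ a) = f a := by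
  rw [genVec, phi_mode, phi_one, A.creation_neg_one]

theorem IsCanonical.mode_smul {B : VertexAlgebra (VSpace κ μ ℓ)} (hB : IsCanonical κ μ B) (n : ℤ)
    (a : GenSpace g) (v : VSpace κ μ ℓ) :
    emb κ μ (mode κ μ n a) • v = ncoeff (B.Y (genVec κ μ ℓ a)) n v := (hB.2 a n v).symm

/-- The canonical map is a homomorphism of vertex algebras. -/
theorem phi_ncoeff (hf : HasGenOPE κ μ A f ℓ) {B : VertexAlgebra (VSpace κ μ ℓ)}
    (hB : IsCanonical κ μ B) (u v : VSpace κ μ ℓ) (n : ℤ) :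
    phi hf (ncoeff (B.Y u) n v) = ncoeff (A.Y (phi hf u)) n (phi hf v) := by
  induction u using vspace_induction generalizing n v with
  | h1 =>
    rw [← hB.1, B.vac_mode, hB.1, phi_one, A.vac_mode]
    split_ifs
    · rfl
    · exact map_zero _
  | hadd x y hx hy =>
    simp only [map_add, Pi.add_apply, LinearMap.add_apply, hx, hy]
  | hsmul c x hx =>
    simp only [map_smul, Pi.smul_apply, LinearMap.smul_apply, hx]
  | hm m a x hx =>
    rw [hB.mode_smul, B.Y_nprod, ← hB.mode_smul, phi_mode, A.Y_nprod, ncoeff_nprod, ncoeff_nprod,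
      bor, bor, bor2_map _ (trunc2_field _ _ _)]
    simp only [← hB.mode_smul, phi_mode, hx]

/-- If the canonical map to a vertex algebra has a left inverse `ev` compatible with the modes of
the generators, and the vertex algebra is generated by the vectors `f a`, then the canonical map is
bijective and the structure can be transported to `V(ℓ)`. -/
theorem exists_canonical_of (hf : HasGenOPE κ μ A f ℓ) (ev : X →ₗ[ℂ] VSpace κ μ ℓ)
    (h1 : ev A.vac = one κ μ ℓ)
    (hm : ∀ a n x, ev (ncoeff (A.Y (f a)) n x) = emb κ μ (mode κ μ n a) • ev x)
    (hgen : ∀ T : Submodule ℂ X, A.vac ∈ T → (∀ a, f a ∈ A.stabilizer T) → ∀ x, x ∈ T) :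
    ∃ B : VertexAlgebra (VSpace κ μ ℓ), IsCanonical κ μ B := by
  have e1 : ∀ v, ev (phi hf v) = v := fun v => by
    induction v using vspace_induction with
    | h1 => rw [phi_one, h1]
    | hadd x y hx hy => rw [map_add, map_add, hx, hy]
    | hsmul c x hx => rw [map_smul, map_smul, hx]
    | hm n a x hx => rw [phi_mode, hm, hx]
  have e2 : ∀ x, phi hf (ev x) = x := by
    refine hgen (LinearMap.eqLocus (phi hf ∘ₗ ev) LinearMap.id) ?_ fun a n x hx => ?_
    · change phi hf (ev A.vac) = A.vac
      rw [h1, phi_one]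
    · change phi hf (ev _) = ncoeff (A.Y (f a)) n x
      have hx : phi hf (ev x) = x := hx
      rw [hm, phi_mode, hx]
  let e : X ≃ₗ[ℂ] VSpace κ μ ℓ :=
    LinearEquiv.ofLinearMap ev (phi hf) (LinearMap.ext e1) (LinearMap.ext e2)
  refine ⟨A.transport e, h1, fun a n v => ?_⟩
  rw [A.ncoeff_transport]
  change ev (ncoeff (A.Y (phi hf (genVec κ μ ℓ a))) n (phi hf v)) = _
  rw [phi_genVec, hm, e1]

end Hom

theorem map_vecP {X Y : Type*} [AddCommGroup X] [Module ℂ X] [AddCommGroup Y] [Module ℂ Y]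
    {A : VertexAlgebra X} {f : GenSpace g →ₗ[ℂ] X} (T : X →ₗ[ℂ] Y) (D : Y →ₗ[ℂ] Y)
    {f' : GenSpace g →ₗ[ℂ] Y} {c : Y} (hD : ∀ x, T (A.D x) = D (T x)) (hf : ∀ a, T (f a) = f' a)
    (hc : ℓ • T A.vac = c) (h0 : D c = 0) (x : Formal g) :
    T (vecP A f ℓ x) = formalLift D f' c x := by
  have : T ∘ₗ vecP A f ℓ = formalLift D f' c := by
    refine formal_hom_ext (D := D) (fun x => ?_) (formalLift_D _ _ _ h0) (fun a => ?_) ?_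
    · rw [LinearMap.comp_apply, vecP_D, hD]; rfl
    · rw [LinearMap.comp_apply, vecP, formalLift_gen, formalLift_gen, hf]
    · rw [LinearMap.comp_apply, vecP, formalLift_k0, formalLift_k0, map_smul, hc]
  exact LinearMap.congr_fun this x

section FieldsVA

variable {W : Type*} [AddCommGroup W] [Module ℂ W] {ρ : HatRep κ μ W}

theorem isLocal_range_fld (hr : IsRestricted ρ) :
    ∀ F ∈ Set.range (fld hr), ∀ G ∈ Set.range (fld hr), IsLocal F G := by
  rintro _ ⟨a, rfl⟩ _ ⟨b, rfl⟩
  exact isLocal_fld hr a b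

/-- The space of fields generated by the fields `a(z)` on a restricted module. -/
def fieldSpace (hr : IsRestricted ρ) : Submodule ℂ (VertexOperator ℂ W) :=
  genAlg (Set.range (fld hr))

theorem isFieldAlgebra_fieldSpace (hr : IsRestricted ρ) : IsFieldAlgebra (fieldSpace hr) :=
  isFieldAlgebra_genAlg (isLocal_range_fld hr)

/-- The vertex algebra generated by the fields `a(z)` on a restricted module. -/
def fieldVA (hr : IsRestricted ρ) : VertexAlgebra (fieldSpace hr) :=
  (isFieldAlgebra_fieldSpace hr).vertexAlgebra

theorem fld_mem (hr : IsRestricted ρ) (a : GenSpace g) : fld hr a ∈ fieldSpace hr :=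
  Submodule.subset_span (.mem ⟨a, rfl⟩)

/-- The fields `a(z)` as elements of the vertex algebra they generate. -/
def fldU (hr : IsRestricted ρ) : GenSpace g →ₗ[ℂ] fieldSpace hr :=
  (fld hr).codRestrict (fieldSpace hr) (fld_mem hr)

theorem coe_fldU (hr : IsRestricted ρ) (a : GenSpace g) :
    (fldU hr a : VertexOperator ℂ W) = fld hr a := rfl

theorem coe_ncoeff_fieldVA (hr : IsRestricted ρ) (F G : fieldSpace hr) (n : ℤ) :
    (ncoeff ((fieldVA hr).Y F) n G : VertexOperator ℂ W) = nprod F.1 G.1 n :=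
  (isFieldAlgebra_fieldSpace hr).coe_ncoeff_Y F G n

theorem coe_vecP_fieldVA (hr : IsRestricted ρ) (ℓ : ℂ) (x : Formal g) :
    (fieldSpace hr).subtype (vecP (fieldVA hr) (fldU hr) ℓ x) = fldP hr ℓ x := by
  refine map_vecP (A := fieldVA hr) (f := fldU hr) (f' := fld hr) (fieldSpace hr).subtype
    (dFieldL W) (fun F => ?_) (fun a => coe_fldU hr a) ?_ (dFieldL_smul_idField W ℓ) x
  · exact (coe_ncoeff_fieldVA hr F _ (-2)).trans (nprod_idField_neg_two F.1)
  · rfl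

/-- The vertex algebra generated by the fields `a(z)` contains the generators with their operator
products. -/
theorem hasGenOPE_fieldVA (hr : IsRestricted ρ) (hl : HasLevel ρ ℓ) :
    HasGenOPE κ μ (fieldVA hr) (fldU hr) ℓ := by
  intro a b σ h i
  refine Subtype.ext ?_
  rw [coe_ncoeff_fieldVA]
  exact (nprod_fld hr hl h i).trans (coe_vecP_fieldVA hr ℓ (σ i)).symm

/-- A subspace that contains the identity field and is stable under the products with all `a(z)` is
everything. -/
theorem fieldSpace_generation (hr : IsRestricted ρ) (T : Submodule ℂ (fieldSpace hr))
    (h1 : (fieldVA hr).vac ∈ T) (hT : ∀ a, fldU hr a ∈ (fieldVA hr).stabilizer T)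
    (F : fieldSpace hr) : F ∈ T := by
  refine genAlg_generation (isLocal_range_fld hr) T h1 (fun F hF => ?_) F
  obtain ⟨a, ha⟩ := hF
  have : fldU hr a = F := Subtype.ext ha
  rw [← this]
  exact hT a

end FieldsVA

/-- The evaluation of fields on `𝟏`. -/
def evOne (κ : InvForm g) (μ ℓ : ℂ) :
    VertexOperator ℂ (VSpace κ μ ℓ) →ₗ[ℂ] VSpace κ μ ℓ :=
  LinearMap.applyₗ (one κ μ ℓ) ∘ₗ LinearMap.proj (-1) ∘ₗ ncoeff

theorem evOne_apply (F : VertexOperator ℂ (VSpace κ μ ℓ)) :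
    evOne κ μ ℓ F = ncoeff F (-1) (one κ μ ℓ) := rfl

/-- Evaluation at `𝟏` intertwines the products with `a(z)` and the modes of `a`, because the
nonnegative modes of all fields involved kill `𝟏`. -/
theorem evOne_nprod (a : GenSpace g) (F : VertexOperator ℂ (VSpace κ μ ℓ))
    (hF : F ∈ fieldSpace (vRep_restricted (κ := κ) (μ := μ) (ℓ := ℓ))) (n : ℤ) :
    evOne κ μ ℓ (nprod (fld vRep_restricted a) F n) = emb κ μ (mode κ μ n a) • evOne κ μ ℓ F := by
  have h0 : ∀ G ∈ Set.range (fld (vRep_restricted (κ := κ) (μ := μ) (ℓ := ℓ))), ∀ n : ℤ, 0 ≤ n →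
      ncoeff G n (one κ μ ℓ) = 0 := by
    rintro _ ⟨b, rfl⟩ n hn
    rw [ncoeff_fld]
    exact mode_smul_one hn b
  rw [evOne_apply, evOne_apply, ncoeff_nprod, bor, bor2, finsum_eq_single _ 0]
  · rw [h0 _ ⟨a, rfl⟩ _ (by simp), map_zero, smul_zero, sub_zero, cf_zero, one_smul, Nat.cast_zero,
      add_zero, sub_zero, zero_add, ncoeff_fld, vRep_apply]
  · intro i hi
    rw [h0 _ ⟨a, rfl⟩ _ (by omega), genAlg_creation h0 hF (by omega), map_zero, map_zero, smul_zero,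
      sub_zero, smul_zero]

/-- `V(ℓ)` carries a vertex algebra structure, transported from the fields generated by the `a(z)`
on `V(ℓ)` itself. -/
theorem exists_canonical : ∃ A : VertexAlgebra (VSpace κ μ ℓ), IsCanonical κ μ A := by
  refine exists_canonical_of (hasGenOPE_fieldVA vRep_restricted vRep_level)
    (evOne κ μ ℓ ∘ₗ (fieldSpace vRep_restricted).subtype) ?_ (fun a n F => ?_)
    (fieldSpace_generation vRep_restricted)
  · change evOne κ μ ℓ (idField _) = _
    rw [evOne_apply, ncoeff_idField, if_pos rfl]
    rfl
  · refine Eq.trans ?_ (evOne_nprod a F.1 F.2 n)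
    exact congrArg (evOne κ μ ℓ) (coe_ncoeff_fieldVA vRep_restricted _ F n)

/-- Linear maps into fields on a space that agree on the generators and on `𝟏` and are compatible
with the `n`-th products agree. -/
theorem field_map_ext {A : VertexAlgebra (VSpace κ μ ℓ)} (hA : IsCanonical κ μ A)
    {W : Type*} [AddCommGroup W] [Module ℂ W] {Y Y' : VSpace κ μ ℓ →ₗ[ℂ] VertexOperator ℂ W}
    (h1 : Y (one κ μ ℓ) = Y' (one κ μ ℓ)) (hg : ∀ a, Y (genVec κ μ ℓ a) = Y' (genVec κ μ ℓ a))
    (hY : ∀ u v n, Y (ncoeff (A.Y u) n v) = nprod (Y u) (Y v) n)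
    (hY' : ∀ u v n, Y' (ncoeff (A.Y u) n v) = nprod (Y' u) (Y' v) n) : Y = Y' := by
  refine LinearMap.ext fun v => ?_
  induction v using vspace_induction with
  | h1 => exact h1
  | hadd x y hx hy => rw [map_add, map_add, hx, hy]
  | hsmul c x hx => rw [map_smul, map_smul, hx]
  | hm n a x hx => rw [hA.mode_smul, hY, hY', hg, hx]

/-- The modes of the generators determine all vertex operators, since these are iterated
products. -/
theorem canonical_unique {A B : VertexAlgebra (VSpace κ μ ℓ)} (hA : IsCanonical κ μ A)
    (hB : IsCanonical κ μ B) : A = B := by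
  have hg : ∀ a, A.Y (genVec κ μ ℓ a) = B.Y (genVec κ μ ℓ a) := fun a =>
    field_ext fun n v => by rw [hA.2, hB.2]
  refine VertexAlgebra.ext (hA.1.trans hB.1.symm) (LinearMap.ext fun v => ?_)
  induction v using vspace_induction with
  | h1 => rw [← hA.1, A.Y_vac, hA.1, ← hB.1, B.Y_vac]
  | hadd x y hx hy => rw [map_add, map_add, hx, hy]
  | hsmul c x hx => rw [map_smul, map_smul, hx]
  | hm n a x hx =>
    have h1 := congrArg A.Y (hA.mode_smul n a x)
    have h2 := congrArg B.Y (hB.mode_smul n a x)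
    rw [A.Y_nprod] at h1
    rw [B.Y_nprod] at h2
    rw [h1, h2, hg, hx]

theorem IsCanonical.fld_eq {A : VertexAlgebra (VSpace κ μ ℓ)} (hA : IsCanonical κ μ A)
    (a : GenSpace g) : fld vRep_restricted a = A.Y (genVec κ μ ℓ a) :=
  field_ext fun n v => by rw [hA.2, ncoeff_fld, vRep_apply]

/-- The generators in `V(ℓ)` have the required operator products. -/
theorem IsCanonical.hasGenOPE {A : VertexAlgebra (VSpace κ μ ℓ)} (hA : IsCanonical κ μ A) :
    HasGenOPE κ μ A (genVecL κ μ ℓ) ℓ := by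
  have e : ∀ x, A.Y (vecP A (genVecL κ μ ℓ) ℓ x) = fldP vRep_restricted ℓ x :=
    map_vecP A.Y (dFieldL _) A.adjoint.Y_D (fun a => (hA.fld_eq a).symm) (by rw [A.Y_vac])
      (dFieldL_smul_idField _ ℓ)
  intro a b σ h i
  refine A.Y_injective ?_
  rw [A.Y_nprod, genVecL_apply, genVecL_apply, ← hA.fld_eq, ← hA.fld_eq,
    nprod_fld vRep_restricted vRep_level h, e]

section Modules

variable {W : Type*} [AddCommGroup W] [Module ℂ W]

/-- The vertex operator map of `V(ℓ)` on a restricted module of level `ℓ`. -/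
def fieldMap {ρ : HatRep κ μ W} (hr : IsRestricted ρ) (hl : HasLevel ρ ℓ) :
    VSpace κ μ ℓ →ₗ[ℂ] VertexOperator ℂ W :=
  (fieldSpace hr).subtype ∘ₗ phi (hasGenOPE_fieldVA hr hl)

theorem fieldMap_genVec {ρ : HatRep κ μ W} (hr : IsRestricted ρ) (hl : HasLevel ρ ℓ)
    (a : GenSpace g) : fieldMap hr hl (genVec κ μ ℓ a) = fld hr a :=
  congrArg Subtype.val (phi_genVec (hasGenOPE_fieldVA hr hl) a)

/-- The `V(ℓ)`-module structure on a restricted module of level `ℓ`. -/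
def moduleOfRep {A : VertexAlgebra (VSpace κ μ ℓ)} (hA : IsCanonical κ μ A) {ρ : HatRep κ μ W}
    (hr : IsRestricted ρ) (hl : HasLevel ρ ℓ) : VAModule A W :=
  VAModule.ofFields A (fieldMap hr hl)
    (by rw [hA.1]; exact congrArg Subtype.val (phi_one (hasGenOPE_fieldVA hr hl)))
    (fun _ _ => (isFieldAlgebra_fieldSpace hr).isLocal _ (Subtype.prop _) _ (Subtype.prop _))
    (fun u v n => (congrArg Subtype.val (phi_ncoeff (hasGenOPE_fieldVA hr hl) hA u v n)).trans
      (coe_ncoeff_fieldVA hr _ _ n))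

theorem moduleOfRep_genVec {A : VertexAlgebra (VSpace κ μ ℓ)} (hA : IsCanonical κ μ A)
    {ρ : HatRep κ μ W} (hr : IsRestricted ρ) (hl : HasLevel ρ ℓ) (a : GenSpace g) (n : ℤ) :
    ncoeff ((moduleOfRep hA hr hl).Y (genVec κ μ ℓ a)) n = ρ (mode κ μ n a) := by
  have : (moduleOfRep hA hr hl).Y (genVec κ μ ℓ a) = fld hr a := fieldMap_genVec hr hl a
  rw [this, ncoeff_fld]

/-- A module over `V(ℓ)` is determined by the modes of the generators. -/
theorem vaModule_ext {A : VertexAlgebra (VSpace κ μ ℓ)} (hA : IsCanonical κ μ A)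
    {M M' : VAModule A W}
    (h : ∀ a n, ncoeff (M.Y (genVec κ μ ℓ a)) n = ncoeff (M'.Y (genVec κ μ ℓ a)) n) : M = M' := by
  refine VAModule.ext (field_map_ext hA ?_ (fun a => field_ext fun n w => by rw [h])
    M.Y_nprod M'.Y_nprod)
  rw [← hA.1, M.Y_vac, M'.Y_vac]

/-- Restricted modules of level `ℓ` are the same as `V(ℓ)`-modules. -/
def repEquivModule {A : VertexAlgebra (VSpace κ μ ℓ)} (hA : IsCanonical κ μ A) (W : Type*)
    [AddCommGroup W] [Module ℂ W] :
    {ρ : HatRep κ μ W // IsRestricted ρ ∧ HasLevel ρ ℓ} ≃ VAModule A W where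
  toFun ρ := moduleOfRep hA ρ.2.1 ρ.2.2
  invFun M := ⟨repOfModule hA.hasGenOPE M, repOfModule_restricted hA.hasGenOPE M,
    repOfModule_level hA.hasGenOPE M⟩
  left_inv ρ := Subtype.ext <| hatRep_ext (repOfModule_level hA.hasGenOPE _) ρ.2.2 fun n a => by
    rw [repOfModule_mode, genVecL_apply, moduleOfRep_genVec]
  right_inv M := vaModule_ext hA fun a n => by
    rw [moduleOfRep_genVec, repOfModule_mode, genVecL_apply]

theorem repEquivModule_genVec {A : VertexAlgebra (VSpace κ μ ℓ)} (hA : IsCanonical κ μ A)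
    (ρ : {ρ : HatRep κ μ W // IsRestricted ρ ∧ HasLevel ρ ℓ}) (a : GenSpace g) (n : ℤ) :
    ncoeff ((repEquivModule hA W ρ).Y (genVec κ μ ℓ a)) n = ρ.1 (mode κ μ n a) :=
  moduleOfRep_genVec hA ρ.2.1 ρ.2.2 a n

end Modules

end Induced

/-! ### Locally nilpotent operators and `sl₂`-triples -/

section Nilpotent

variable {X : Type*} [AddCommGroup X] [Module ℂ X]

/-- The Leibniz rule for powers: if `[T, x] = y` commutes with `x` then
`[T, x^{r+1}] = (r + 1) x^r y`. -/
theorem map_pow_succ_of_comm {T x y : Module.End ℂ X} (hx : ∀ u, T (x u) = x (T u) + y u)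
    (hxy : Commute x y) (r : ℕ) (u : X) :
    T ((x ^ (r + 1)) u) = (x ^ (r + 1)) (T u) + (r + 1 : ℂ) • (x ^ r) (y u) := by
  induction r generalizing u with
  | zero => simp [hx]
  | succ r ih =>
    have h : (x ^ r) (y (x u)) = (x ^ (r + 1)) (y u) := by
      rw [pow_succ, Module.End.mul_apply, ← Module.End.mul_apply y x, ← hxy.eq,
        Module.End.mul_apply]
    rw [pow_succ, Module.End.mul_apply, ih, hx, map_add, h, Module.End.mul_apply]
    push_cast
    module

/-- The radical of a differential ideal is differential: if a derivation `[T, ·]` maps `x` to `y`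
and `y` to `z`, where `x`, `y`, `z` commute, and `T w = 0`, then nilpotency of `x` on `w` implies
nilpotency of `y` on `w`. -/
theorem pow_eq_zero_of_derivation {T x y z : Module.End ℂ X} {w : X} (hT : T w = 0)
    (hx : ∀ u, T (x u) = x (T u) + y u) (hy : ∀ u, T (y u) = y (T u) + z u)
    (hxy : Commute x y) (hxz : Commute x z) (hyz : Commute y z) {p : ℕ} (hp : (x ^ p) w = 0) :
    (y ^ (2 * p)) w = 0 := by
  have step : ∀ r s, (x ^ (r + 1)) ((y ^ s) w) = 0 → (x ^ r) ((y ^ (s + 2)) w) = 0 := by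
    intro r s h
    have h1 := map_pow_succ_of_comm hx hxy r ((y ^ s) w)
    rw [h, map_zero] at h1
    have h2 : y ((x ^ (r + 1)) (T ((y ^ s) w))) = 0 := by
      cases s with
      | zero => rw [pow_zero, Module.End.one_apply, hT, map_zero, map_zero]
      | succ s =>
        have e : y * x ^ (r + 1) * y ^ s * z = z * x ^ (r + 1) * y ^ (s + 1) := by
          rw [mul_assoc, (hyz.pow_left s).eq, mul_assoc y, ← mul_assoc (x ^ (r + 1)),
            (hxz.pow_left (r + 1)).eq, ← mul_assoc, ← mul_assoc, hyz.eq, mul_assoc z,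
            ← (hxy.pow_left (r + 1)).eq, mul_assoc, mul_assoc, ← pow_succ', ← mul_assoc]
        have e' := LinearMap.congr_fun e w
        simp only [Module.End.mul_apply] at e'
        rw [map_pow_succ_of_comm hy hyz, hT, map_zero, zero_add, map_smul, map_smul, e', h,
          map_zero, smul_zero]
    have h3 := congrArg y h1
    rw [map_zero, map_add, h2, zero_add, map_smul] at h3
    have h4 : (r + 1 : ℂ) ≠ 0 := by exact_mod_cast Nat.succ_ne_zero r
    have h5 := (smul_eq_zero.1 h3.symm).resolve_left h4
    have e : y * x ^ r * y * y ^ s = x ^ r * y ^ (s + 2) := by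
      rw [← (hxy.pow_left r).eq, mul_assoc, mul_assoc, ← pow_succ', ← pow_succ']
    have e' := LinearMap.congr_fun e w
    simp only [Module.End.mul_apply] at e'
    rw [← e', h5]
  have main : ∀ k r, k + r = p → (x ^ r) ((y ^ (2 * k)) w) = 0 := by
    intro k
    induction k with
    | zero => rintro r rfl; simpa using hp
    | succ k ih =>
      intro r hr
      exact step r (2 * k) (ih (r + 1) (by omega))
  simpa using main p 0 rfl

variable {e f h : Module.End ℂ X}

/-- The action of `e` on the vectors `f^k v`, for a primitive vector `v`; no weight is assumed. -/
theorem sl2_e_f_pow (hef : ∀ u, e (f u) = f (e u) + h u)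
    (hf : ∀ u, h (f u) = f (h u) - (2 : ℂ) • f u) {v : X} (hv : e v = 0) (k : ℕ) :
    e ((f ^ (k + 1)) v) = (k + 1 : ℂ) • (f ^ k) (h v - (k : ℂ) • v) := by
  have hfk : ∀ k : ℕ, ∀ u, h ((f ^ k) u) = (f ^ k) (h u) - (2 * k : ℂ) • (f ^ k) u := by
    intro k
    induction k with
    | zero => intro u; simp
    | succ k ih =>
      intro u
      rw [pow_succ', Module.End.mul_apply, hf, ih, map_sub, map_smul, Module.End.mul_apply]
      push_cast
      module
  induction k with
  | zero => simp [hef, hv]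
  | succ k ih =>
    have h1 : f ((f ^ k) (h v - (k : ℂ) • v)) = (f ^ (k + 1)) (h v - (k : ℂ) • v) := by
      rw [pow_succ', Module.End.mul_apply]
    rw [pow_succ' f (k + 1), Module.End.mul_apply, hef, ih, hfk, map_smul, h1, map_sub, map_sub,
      map_smul, map_smul]
    push_cast
    module

/-- A primitive vector on which `f` is nilpotent can be replaced by one of natural weight inside any
given `h`-stable subspace. -/
theorem exists_primitive (hef : ∀ u, e (f u) = f (e u) + h u)
    (he : ∀ u, h (e u) = e (h u) + (2 : ℂ) • e u)
    (hf : ∀ u, h (f u) = f (h u) - (2 : ℂ) • f u) {S : Submodule ℂ X} (hS : ∀ u ∈ S, h u ∈ S)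
    {v : X} (hvS : v ∈ S) (hv0 : v ≠ 0) (hv : e v = 0) {p : ℕ} (hp : (f ^ p) v = 0) :
    ∃ u ∈ S, u ≠ 0 ∧ e u = 0 ∧ ∃ k : ℕ, h u = (k : ℂ) • u := by
  induction p generalizing v with
  | zero => exact absurd hp hv0
  | succ p ih =>
    by_cases h0 : h v - (p : ℂ) • v = 0
    · exact ⟨v, hvS, hv0, hv, p, sub_eq_zero.1 h0⟩
    · refine ih (S.sub_mem (hS v hvS) (S.smul_mem _ hvS)) h0 ?_ ?_
      · rw [map_sub, map_smul, hv, smul_zero, sub_zero]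
        have := he v
        rw [hv, map_zero, smul_zero, add_zero] at this
        exact this.symm
      · have := sl2_e_f_pow hef hf hv p
        rw [hp, map_zero] at this
        have h4 : (p + 1 : ℂ) ≠ 0 := by exact_mod_cast Nat.succ_ne_zero p
        exact (smul_eq_zero.1 this.symm).resolve_left h4

/-- The weight of a primitive vector on which `f` is nilpotent is a natural number. -/
theorem primitive_weight_nat (hef : ∀ u, e (f u) = f (e u) + h u)
    (hf : ∀ u, h (f u) = f (h u) - (2 : ℂ) • f u) {v : X} (hv0 : v ≠ 0) (hv : e v = 0) {l : ℂ}
    (hl : h v = l • v) {p : ℕ} (hp : (f ^ p) v = 0) : ∃ k : ℕ, l = k := by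
  induction p with
  | zero => exact absurd hp hv0
  | succ p ih =>
    by_cases h0 : (f ^ p) v = 0
    · exact ih h0
    · have := sl2_e_f_pow hef hf hv p
      rw [hp, map_zero, hl, ← sub_smul, map_smul, smul_smul] at this
      have h5 := (smul_eq_zero.1 this.symm).resolve_right h0
      have h4 : (p + 1 : ℂ) ≠ 0 := by exact_mod_cast Nat.succ_ne_zero p
      exact ⟨p, sub_eq_zero.1 ((mul_eq_zero.1 h5).resolve_left h4)⟩

/-- A locally nilpotent operator on a nonzero stable subspace has a nonzero kernel there. -/
theorem exists_ker_of_nilpotent {S : Submodule ℂ X} (hS : ∀ u ∈ S, f u ∈ S) {v : X} (hvS : v ∈ S)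
    (hv0 : v ≠ 0) {p : ℕ} (hp : (f ^ p) v = 0) : ∃ k, (f ^ k) v ∈ S ∧ (f ^ k) v ≠ 0 ∧
      f ((f ^ k) v) = 0 := by
  induction p with
  | zero => exact absurd hp hv0
  | succ p ih =>
    by_cases h0 : (f ^ p) v = 0
    · exact ih h0
    · refine ⟨p, ?_, h0, ?_⟩
      · clear hp h0 ih
        induction p with
        | zero => exact hvS
        | succ p ih => rw [pow_succ', Module.End.mul_apply]; exact hS _ ih
      · rw [← Module.End.mul_apply, ← pow_succ']; exact hp

end Nilpotent

/-! ### Integrable modules of affine `sl₂` -/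

/-- A restricted integrable module of level `c` for the affine Lie algebra of `sl₂`. -/
structure AffineSl2 (W : Type*) [AddCommGroup W] [Module ℂ W] (c : ℂ) where
  /-- the modes of `e` -/
  e : ℤ → Module.End ℂ W
  /-- the modes of `f` -/
  f : ℤ → Module.End ℂ W
  /-- the modes of `h` -/
  h : ℤ → Module.End ℂ W
  ee : ∀ i j w, e i (e j w) = e j (e i w)
  ff : ∀ i j w, f i (f j w) = f j (f i w)
  ef : ∀ i j w, e i (f j w) = f j (e i w) + h (i + j) w + (if i + j = 0 then i * c else 0) • w
  he : ∀ i j w, h i (e j w) = e j (h i w) + (2 : ℂ) • e (i + j) w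
  hf : ∀ i j w, h i (f j w) = f j (h i w) - (2 : ℂ) • f (i + j) w
  hh : ∀ i j w, h i (h j w) = h j (h i w) + (if i + j = 0 then 2 * i * c else 0) • w
  trunc : ∀ w, ∃ N : ℤ, ∀ n, N ≤ n → e n w = 0 ∧ f n w = 0 ∧ h n w = 0
  nil_e : ∀ n w, ∃ p, (e n ^ p) w = 0
  nil_f : ∀ n w, ∃ p, (f n ^ p) w = 0

namespace AffineSl2

variable {W : Type*} [AddCommGroup W] [Module ℂ W] {c : ℂ} (T : AffineSl2 W c)

/-- The vectors killed by all modes of index at least `n`. -/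
def omega (n : ℤ) : Submodule ℂ W where
  carrier := {w | ∀ k, n ≤ k → T.e k w = 0 ∧ T.f k w = 0 ∧ T.h k w = 0}
  add_mem' h1 h2 k hk := by
    obtain ⟨a, b, c⟩ := h1 k hk
    obtain ⟨a', b', c'⟩ := h2 k hk
    simp [a, b, c, a', b', c']
  zero_mem' k _ := by simp
  smul_mem' s w h1 k hk := by
    obtain ⟨a, b, c⟩ := h1 k hk
    simp [a, b, c]

theorem omega_e {n j : ℤ} (hn : 1 ≤ n) (hj : 0 ≤ j) {w : W} (hw : w ∈ T.omega n) :
    T.e j w ∈ T.omega n := fun k hk => by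
  obtain ⟨h1, h2, h3⟩ := hw k hk
  obtain ⟨h1', h2', h3'⟩ := hw (j + k) (by omega)
  refine ⟨?_, ?_, ?_⟩
  · rw [T.ee, h1, map_zero]
  · have := T.ef j k w
    rw [h2, h3', map_zero, if_neg (by omega), zero_smul, add_zero, add_zero] at this
    exact this.symm
  · rw [T.he, h3, add_comm k, h1', map_zero, smul_zero, add_zero]

theorem omega_f {n j : ℤ} (hn : 1 ≤ n) (hj : 0 ≤ j) {w : W} (hw : w ∈ T.omega n) :
    T.f j w ∈ T.omega n := fun k hk => by
  obtain ⟨h1, h2, h3⟩ := hw k hk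
  obtain ⟨h1', h2', h3'⟩ := hw (k + j) (by omega)
  refine ⟨?_, ?_, ?_⟩
  · rw [T.ef, h1, h3', map_zero, if_neg (by omega), zero_smul, add_zero, add_zero]
  · rw [T.ff, h2, map_zero]
  · rw [T.hf, h3, h2', map_zero, smul_zero, sub_zero]

theorem omega_h {n j : ℤ} (hn : 1 ≤ n) (hj : 0 ≤ j) {w : W} (hw : w ∈ T.omega n) :
    T.h j w ∈ T.omega n := fun k hk => by
  obtain ⟨h1, h2, h3⟩ := hw k hk
  obtain ⟨h1', h2', h3'⟩ := hw (j + k) (by omega)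
  refine ⟨?_, ?_, ?_⟩
  · have := T.he j k w
    rw [h1, h1', map_zero, smul_zero, add_zero] at this
    exact this.symm
  · have := T.hf j k w
    rw [h2, h2', map_zero, smul_zero, sub_zero] at this
    exact this.symm
  · rw [T.hh, h3, map_zero, if_neg (by omega), zero_smul, add_zero]

/-- If some vector is killed by all modes of index `≥ m + 1`, where `m ≥ 1`, then some vector is
killed by all modes of index `≥ m`. -/
theorem omega_descend {m : ℤ} (hm : 1 ≤ m) {w : W} (hw : w ∈ T.omega (m + 1)) (hw0 : w ≠ 0) :
    ∃ u ∈ T.omega m, u ≠ 0 := by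
  -- a vector of the subspace killed by `f(0)`
  obtain ⟨p, hp⟩ := T.nil_f 0 w
  obtain ⟨k, hwS, hw0, hfw⟩ :=
    exists_ker_of_nilpotent (fun u hu => T.omega_f (by omega) le_rfl hu) hw hw0 hp
  generalize (T.f 0 ^ k) w = w at hwS hw0 hfw
  clear hw hp
  -- the modes of index `m` commute on the subspace
  have He : ∀ j, 0 ≤ j → ∀ u ∈ T.omega (m + 1), T.e j u ∈ T.omega (m + 1) := fun j hj u hu =>
    T.omega_e (by omega) hj hu
  have Hf : ∀ j, 0 ≤ j → ∀ u ∈ T.omega (m + 1), T.f j u ∈ T.omega (m + 1) := fun j hj u hu =>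
    T.omega_f (by omega) hj hu
  have Hh : ∀ j, 0 ≤ j → ∀ u ∈ T.omega (m + 1), T.h j u ∈ T.omega (m + 1) := fun j hj u hu =>
    T.omega_h (by omega) hj hu
  let E : Module.End ℂ (T.omega (m + 1)) := (T.e m).restrict (He m (by omega))
  let F : Module.End ℂ (T.omega (m + 1)) := (T.f m).restrict (Hf m (by omega))
  let A : Module.End ℂ (T.omega (m + 1)) := (T.h m).restrict (Hh m (by omega))
  let D : Module.End ℂ (T.omega (m + 1)) := (T.f 0).restrict (Hf 0 le_rfl)
  have cEA : Commute E A := by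
    refine LinearMap.ext fun u => Subtype.ext ?_
    have := T.he m m u.1
    rw [(u.2 (m + m) (by omega)).1, smul_zero, add_zero] at this
    exact this.symm
  have cEF : Commute E F := by
    refine LinearMap.ext fun u => Subtype.ext ?_
    have := T.ef m m u.1
    rw [(u.2 (m + m) (by omega)).2.2, if_neg (by omega), zero_smul, add_zero, add_zero] at this
    exact this
  have cAF : Commute A F := by
    refine LinearMap.ext fun u => Subtype.ext ?_
    have := T.hf m m u.1
    rw [(u.2 (m + m) (by omega)).2.1, smul_zero, sub_zero] at this
    exact this
  let v : T.omega (m + 1) := ⟨w, hwS⟩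
  have coe_pow : ∀ (G : Module.End ℂ W) (hG : ∀ u ∈ T.omega (m + 1), G u ∈ T.omega (m + 1)) (k : ℕ)
      (u : T.omega (m + 1)), (((G.restrict hG) ^ k) u : W) = (G ^ k) u.1 := by
    intro G hG k u
    induction k with
    | zero => rfl
    | succ k ih => rw [pow_succ', pow_succ', Module.End.mul_apply, Module.End.mul_apply, ← ih]; rfl
  have nE : ∀ u, ∃ p, (E ^ p) u = 0 := fun u => by
    obtain ⟨p, hp⟩ := T.nil_e m u.1
    exact ⟨p, Subtype.ext ((coe_pow _ _ p u).trans hp)⟩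
  have nF : ∀ u, ∃ p, (F ^ p) u = 0 := fun u => by
    obtain ⟨p, hp⟩ := T.nil_f m u.1
    exact ⟨p, Subtype.ext ((coe_pow _ _ p u).trans hp)⟩
  -- `h(m)` is nilpotent on `v` because it is a derivative of `e(m)`
  have nA : ∃ p, (A ^ p) v = 0 := by
    obtain ⟨p, hp⟩ := nE v
    refine ⟨2 * p, ?_⟩
    have := pow_eq_zero_of_derivation (T := D) (x := E) (y := -A) (z := (-2 : ℂ) • F) (w := v)
      (Subtype.ext hfw) (fun u => Subtype.ext ?_) (fun u => Subtype.ext ?_) cEA.neg_right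
      (cEF.smul_right _) (cAF.neg_left.smul_right _) hp
    · exact (LinearMap.congr_fun ((even_two_mul p).neg_pow A) v).symm.trans this
    · have := T.ef m 0 u.1
      rw [add_zero, if_neg (by omega), zero_smul, add_zero] at this
      change T.f 0 (T.e m u.1) = T.e m (T.f 0 u.1) + -T.h m u.1
      rw [this]
      abel
    · have := T.hf m 0 u.1
      rw [add_zero] at this
      change T.f 0 (-T.h m u.1) = -T.h m (T.f 0 u.1) + (-2 : ℂ) • T.f m u.1
      rw [this, map_neg]
      module
  have hv0 : v ≠ 0 := fun h => hw0 (congrArg Subtype.val h)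
  -- a common kernel vector
  obtain ⟨p, hp⟩ := nA
  obtain ⟨i, -, h1, h2⟩ := exists_ker_of_nilpotent (S := ⊤) (fun _ _ => trivial) trivial hv0 hp
  obtain ⟨q, hq⟩ := nE ((A ^ i) v)
  obtain ⟨j, -, h3, h4⟩ := exists_ker_of_nilpotent (S := ⊤) (fun _ _ => trivial) trivial h1 hq
  have h5 : A ((E ^ j) ((A ^ i) v)) = 0 := by
    rw [← Module.End.mul_apply, ← (cEA.pow_left j).eq, Module.End.mul_apply, h2, map_zero]
  generalize (E ^ j) ((A ^ i) v) = u at h3 h4 h5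
  obtain ⟨r, hr⟩ := nF u
  obtain ⟨l, -, h6, h7⟩ := exists_ker_of_nilpotent (S := ⊤) (fun _ _ => trivial) trivial h3 hr
  have h8 : A ((F ^ l) u) = 0 := by
    rw [← Module.End.mul_apply, (cAF.pow_right l).eq, Module.End.mul_apply, h5, map_zero]
  have h9 : E ((F ^ l) u) = 0 := by
    rw [← Module.End.mul_apply, (cEF.pow_right l).eq, Module.End.mul_apply, h4, map_zero]
  generalize (F ^ l) u = x at h6 h7 h8 h9
  refine ⟨x.1, fun k hk => ?_, fun h => h6 (Subtype.ext h)⟩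
  rcases hk.eq_or_lt with rfl | hk
  · exact ⟨congrArg Subtype.val h9, congrArg Subtype.val h7, congrArg Subtype.val h8⟩
  · exact x.2 k (by omega)

/-- A nonzero module contains a nonzero vector killed by all positive modes. -/
theorem exists_omega_one [Nontrivial W] : ∃ u ∈ T.omega 1, u ≠ 0 := by
  obtain ⟨w, hw0⟩ := exists_ne (0 : W)
  obtain ⟨N, hN⟩ := T.trunc w
  have key : ∀ (m : ℕ) (w : W), w ∈ T.omega (m + 1) → w ≠ 0 → ∃ u ∈ T.omega 1, u ≠ 0 := by
    intro m
    induction m with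
    | zero => intro w hw hw0; exact ⟨w, by simpa using hw, hw0⟩
    | succ m ih =>
      intro w hw hw0
      obtain ⟨u, hu, hu0⟩ := T.omega_descend (m := m + 1) (by omega) (by exact_mod_cast hw) hw0
      exact ih u hu hu0
  exact key N.toNat w (fun k hk => hN k (by omega)) hw0

/-- A nonzero restricted integrable module contains a vector killed by all positive modes and by
`f(0)`, of weight `-l` with natural `l`. -/
theorem exists_lowest [Nontrivial W] :
    ∃ u ∈ T.omega 1, u ≠ 0 ∧ T.f 0 u = 0 ∧ ∃ l : ℕ, T.h 0 u = -(l : ℂ) • u := by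
  obtain ⟨w, hw, hw0⟩ := T.exists_omega_one
  obtain ⟨p, hp⟩ := T.nil_f 0 w
  obtain ⟨k, hwS, hw0, hfw⟩ :=
    exists_ker_of_nilpotent (fun u hu => T.omega_f le_rfl le_rfl hu) hw hw0 hp
  obtain ⟨q, hq⟩ := T.nil_e 0 ((T.f 0 ^ k) w)
  have h1 : ∀ u, T.f 0 (T.e 0 u) = T.e 0 (T.f 0 u) + (-T.h 0) u := fun u => by
    have := T.ef 0 0 u
    rw [add_zero, if_pos rfl, Int.cast_zero, zero_mul, zero_smul, add_zero] at this
    rw [this, LinearMap.neg_apply]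
    abel
  have h2 : ∀ u, (-T.h 0) (T.f 0 u) = T.f 0 ((-T.h 0) u) + (2 : ℂ) • T.f 0 u := fun u => by
    have := T.hf 0 0 u
    rw [add_zero] at this
    rw [LinearMap.neg_apply, LinearMap.neg_apply, this, map_neg]
    module
  have h3 : ∀ u, (-T.h 0) (T.e 0 u) = T.e 0 ((-T.h 0) u) - (2 : ℂ) • T.e 0 u := fun u => by
    have := T.he 0 0 u
    rw [add_zero] at this
    rw [LinearMap.neg_apply, LinearMap.neg_apply, this, map_neg]
    module
  obtain ⟨u, huS, hu0, hfu, l, hl⟩ := exists_primitive h1 h2 h3 (S := T.omega 1)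
    (fun u hu => neg_mem (T.omega_h le_rfl le_rfl hu)) hwS hw0 hfw hq
  refine ⟨u, huS, hu0, hfu, l, ?_⟩
  rw [neg_smul, ← hl, LinearMap.neg_apply, neg_neg]

/-- The weight of a vector killed by `e(1)` plus the level is a natural number. -/
theorem weight_add_level {u : W} (hu0 : u ≠ 0) (hu : T.e 1 u = 0) {l : ℂ} (hl : T.h 0 u = l • u) :
    ∃ k : ℕ, l + c = k := by
  obtain ⟨p, hp⟩ := T.nil_f (-1) u
  refine primitive_weight_nat (e := T.e 1) (f := T.f (-1)) (h := T.h 0 + c • 1) (fun u => ?_)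
    (fun u => ?_) hu0 hu ?_ hp
  · have := T.ef 1 (-1) u
    rw [add_neg_cancel, if_pos rfl, Int.cast_one, one_mul] at this
    rw [this, add_assoc]
    rfl
  · have := T.hf 0 (-1) u
    rw [zero_add] at this
    simp only [LinearMap.add_apply, LinearMap.smul_apply, Module.End.one_apply, this, map_add,
      map_smul]
    module
  · simp only [LinearMap.add_apply, LinearMap.smul_apply, Module.End.one_apply, hl]
    module

/-- The level minus the weight of a vector killed by `f(1)` is a natural number. -/
theorem level_sub_weight {u : W} (hu0 : u ≠ 0) (hu : T.f 1 u = 0) {l : ℂ} (hl : T.h 0 u = l • u) :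
    ∃ k : ℕ, c - l = k := by
  obtain ⟨p, hp⟩ := T.nil_e (-1) u
  refine primitive_weight_nat (e := T.f 1) (f := T.e (-1)) (h := c • 1 - T.h 0) (fun u => ?_)
    (fun u => ?_) hu0 hu ?_ hp
  · have := T.ef (-1) 1 u
    rw [neg_add_cancel, if_pos rfl] at this
    rw [this]
    simp only [LinearMap.sub_apply, LinearMap.smul_apply, Module.End.one_apply]
    push_cast
    module
  · have := T.he 0 (-1) u
    rw [zero_add] at this
    simp only [LinearMap.sub_apply, LinearMap.smul_apply, Module.End.one_apply, this, map_sub,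
      map_smul]
    module
  · simp only [LinearMap.sub_apply, LinearMap.smul_apply, Module.End.one_apply, hl]
    module

end AffineSl2

namespace AffineSl2

variable {W : Type*} [AddCommGroup W] [Module ℂ W] {c : ℂ} (T : AffineSl2 W c)

/-- The quotient by a subspace that is stable under all modes. -/
def quotient (K : Submodule ℂ W) (he : ∀ n, ∀ u ∈ K, T.e n u ∈ K) (hf : ∀ n, ∀ u ∈ K, T.f n u ∈ K)
    (hh : ∀ n, ∀ u ∈ K, T.h n u ∈ K) : AffineSl2 (W ⧸ K) c where
  e n := K.mapQ K (T.e n) (he n)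
  f n := K.mapQ K (T.f n) (hf n)
  h n := K.mapQ K (T.h n) (hh n)
  ee i j w := by
    obtain ⟨w, rfl⟩ := K.mkQ_surjective w
    exact congrArg K.mkQ (T.ee i j w)
  ff i j w := by
    obtain ⟨w, rfl⟩ := K.mkQ_surjective w
    exact congrArg K.mkQ (T.ff i j w)
  ef i j w := by
    obtain ⟨w, rfl⟩ := K.mkQ_surjective w
    exact congrArg K.mkQ (T.ef i j w)
  he i j w := by
    obtain ⟨w, rfl⟩ := K.mkQ_surjective w
    exact congrArg K.mkQ (T.he i j w)
  hf i j w := by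
    obtain ⟨w, rfl⟩ := K.mkQ_surjective w
    exact congrArg K.mkQ (T.hf i j w)
  hh i j w := by
    obtain ⟨w, rfl⟩ := K.mkQ_surjective w
    exact congrArg K.mkQ (T.hh i j w)
  trunc w := by
    obtain ⟨w, rfl⟩ := K.mkQ_surjective w
    obtain ⟨N, hN⟩ := T.trunc w
    refine ⟨N, fun n hn => ?_⟩
    obtain ⟨h1, h2, h3⟩ := hN n hn
    exact ⟨(congrArg K.mkQ h1).trans (map_zero _), (congrArg K.mkQ h2).trans (map_zero _),
      (congrArg K.mkQ h3).trans (map_zero _)⟩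
  nil_e n w := by
    obtain ⟨w, rfl⟩ := K.mkQ_surjective w
    obtain ⟨p, hp⟩ := T.nil_e n w
    refine ⟨p, ?_⟩
    rw [← K.mapQ_pow (he n)]
    exact (congrArg K.mkQ hp).trans (map_zero _)
  nil_f n w := by
    obtain ⟨w, rfl⟩ := K.mkQ_surjective w
    obtain ⟨p, hp⟩ := T.nil_f n w
    refine ⟨p, ?_⟩
    rw [← K.mapQ_pow (hf n)]
    exact (congrArg K.mkQ hp).trans (map_zero _)

/-- The iterated commutators `(ad f(0))^k E`. -/
def descend (E : ℤ → Module.End ℂ W) : ℕ → ℤ → Module.End ℂ W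
  | 0 => E
  | k + 1 => fun s => T.f 0 * descend E k s - descend E k s * T.f 0

variable {E : ℤ → Module.End ℂ W}

theorem descend_succ (k : ℕ) (s : ℤ) (w : W) :
    T.descend E (k + 1) s w = T.f 0 (T.descend E k s w) - T.descend E k s (T.f 0 w) := rfl

/-- If `[f(j), E(s)] = [f(0), E(s + j)]`, the iterated commutators have the same property: the
bracket with `f(j)` raises their order by one and shifts the index by `j`. -/
theorem f_descend (hf : ∀ j s w, T.f j (E s w) - E s (T.f j w) =
      T.f 0 (E (s + j) w) - E (s + j) (T.f 0 w)) (k : ℕ) (j s : ℤ) (w : W) :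
    T.f j (T.descend E k s w) = T.descend E k s (T.f j w) + T.descend E (k + 1) (s + j) w := by
  induction k generalizing w with
  | zero => rw [descend_succ]; exact sub_eq_iff_eq_add'.1 (hf j s w)
  | succ k ih =>
    rw [descend_succ, map_sub, T.ff, ih, ih, map_add, T.ff j 0 w, T.descend_succ k s (T.f j w),
      T.descend_succ (k + 1) (s + j) w]
    abel

/-- If `E` has weight `2 N`, then `(ad f(0))^k E` has weight `2 N - 2 k`. -/
theorem h_descend {N : ℂ} (hf : ∀ j s w, T.f j (E s w) - E s (T.f j w) =
      T.f 0 (E (s + j) w) - E (s + j) (T.f 0 w))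
    (hh : ∀ j s w, T.h j (E s w) = E s (T.h j w) + (2 * N) • E (s + j) w)
    (k : ℕ) (j s : ℤ) (w : W) :
    T.h j (T.descend E k s w) =
      T.descend E k s (T.h j w) + (2 * N - 2 * k) • T.descend E k (s + j) w := by
  induction k generalizing w with
  | zero => rw [Nat.cast_zero, mul_zero, sub_zero]; exact hh j s w
  | succ k ih =>
    rw [descend_succ, map_sub, T.hf, ih, ih, descend_succ, T.hf, map_add, map_sub, map_smul,
      map_smul, add_zero, T.f_descend hf k j s w]
    simp only [descend_succ]
    push_cast
    module

/-- If `E` is a highest weight family, then `e(j)` lowers the order `k + 1` of the iterated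
commutator by one. -/
theorem e_descend {N : ℂ} (hf : ∀ j s w, T.f j (E s w) - E s (T.f j w) =
      T.f 0 (E (s + j) w) - E (s + j) (T.f 0 w))
    (hh : ∀ j s w, T.h j (E s w) = E s (T.h j w) + (2 * N) • E (s + j) w)
    (he : ∀ j s w, T.e j (E s w) = E s (T.e j w)) (k : ℕ) (j s : ℤ) (w : W) :
    T.e j (T.descend E (k + 1) s w) = T.descend E (k + 1) s (T.e j w) +
      ((k + 1) * (2 * N - k)) • T.descend E k (s + j) w := by
  induction k generalizing w with
  | zero =>
    rw [descend_succ, descend_succ, map_sub, T.ef, add_zero]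
    change T.f 0 (T.e j (E s w)) + T.h j (E s w) + _ • (E s w) - T.e j (E s (T.f 0 w)) =
      T.f 0 (E s (T.e j w)) - E s (T.f 0 (T.e j w)) + _ • E (s + j) w
    rw [he, he, T.ef, hh, add_zero, map_add, map_add, map_smul]
    push_cast
    module
  | succ k ih =>
    rw [descend_succ, map_sub, T.ef, ih, ih, add_zero, T.h_descend hf hh, T.ef, add_zero, map_add,
      map_add, map_add, map_smul, map_smul, descend_succ (k := k + 1), descend_succ (k := k)]
    simp only [descend_succ]
    push_cast
    module

/-- The key to integrability at level `c`: a truncated family `E` that behaves under the modes of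
affine `sl₂` like the modes of `e(z)^{c + 1}` vanishes. The common kernel `K` of all `(ad f(0))^k E`
is a submodule; in a nonzero quotient by it there would be a vector of weight `-l` killed by all
positive modes and by `f(0)`, and the highest nonvanishing `E_s` on it would produce a vector killed
by `f(1)` whose weight `2 (c + 1) - l` exceeds the level. -/
theorem eq_zero_of_power_like {N : ℕ} (hc : c + 1 = N)
    (he : ∀ j s w, T.e j (E s w) = E s (T.e j w))
    (hh : ∀ j s w, T.h j (E s w) = E s (T.h j w) + (2 * N : ℂ) • E (s + j) w)
    (hf : ∀ j s w, T.f j (E s w) - E s (T.f j w) =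
      T.f 0 (E (s + j) w) - E (s + j) (T.f 0 w))
    (ht : ∀ w, ∃ M : ℤ, ∀ s, M ≤ s → E s w = 0) (s : ℤ) (w : W) : E s w = 0 := by
  let K : Submodule ℂ W := ⨅ k : ℕ, ⨅ s : ℤ, LinearMap.ker (T.descend E k s)
  have hK : ∀ u, u ∈ K ↔ ∀ k s, T.descend E k s u = 0 := fun u => by
    simp only [K, Submodule.mem_iInf, LinearMap.mem_ker]
  have Kf : ∀ j, ∀ u ∈ K, T.f j u ∈ K := fun j u hu => (hK _).2 fun k s => by
    have := T.f_descend hf k j s u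
    rw [(hK u).1 hu, (hK u).1 hu, map_zero, add_zero] at this
    exact this.symm
  have Kh : ∀ j, ∀ u ∈ K, T.h j u ∈ K := fun j u hu => (hK _).2 fun k s => by
    have := T.h_descend hf hh k j s u
    rw [(hK u).1 hu, (hK u).1 hu, map_zero, smul_zero, add_zero] at this
    exact this.symm
  have Ke : ∀ j, ∀ u ∈ K, T.e j u ∈ K := fun j u hu => (hK _).2 fun k s => by
    cases k with
    | zero =>
      have h0 : E s u = 0 := (hK u).1 hu 0 s
      change E s (T.e j u) = 0
      rw [← he, h0, map_zero]
    | succ k =>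
      have := T.e_descend hf hh he k j s u
      rw [(hK u).1 hu, (hK u).1 hu, map_zero, smul_zero, add_zero] at this
      exact this.symm
  suffices h : K = ⊤ by
    have : w ∈ K := h ▸ trivial
    exact (hK w).1 this 0 s
  by_contra hKt
  have : Nontrivial (W ⧸ K) := Submodule.Quotient.nontrivial_iff.2 hKt
  let Q := T.quotient K Ke Kf Kh
  obtain ⟨u, hu1, hu0, hfu, l, hl⟩ := Q.exists_lowest
  obtain ⟨k, hk⟩ := Q.weight_add_level hu0 (hu1 1 le_rfl).1 hl
  obtain ⟨u, rfl⟩ := K.mkQ_surjective u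
  have mem : ∀ v, K.mkQ v = 0 → v ∈ K := fun v => (Submodule.Quotient.mk_eq_zero K).1
  have e1 : T.e 1 u ∈ K := mem _ (hu1 1 le_rfl).1
  have f1 : T.f 1 u ∈ K := mem _ (hu1 1 le_rfl).2.1
  have f0 : T.f 0 u ∈ K := mem _ hfu
  have h0 : T.h 0 u + (l : ℂ) • u ∈ K := mem _ <| by
    have : K.mkQ (T.h 0 u) = -(l : ℂ) • K.mkQ u := hl
    rw [map_add, map_smul, this]
    module
  have zero : ∀ v ∈ K, ∀ s, E s v = 0 := fun v hv s => (hK v).1 hv 0 s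
  obtain ⟨s, hs⟩ : ∃ s, E s u ≠ 0 := by
    by_contra! hE
    refine hu0 ((Submodule.Quotient.mk_eq_zero K).2 ((hK u).2 fun k => ?_))
    induction k with
    | zero => exact hE
    | succ k ih => intro s; rw [descend_succ, ih, (hK _).1 f0, map_zero, sub_zero]
  obtain ⟨M, hM⟩ := ht u
  obtain ⟨s, hs, hmax⟩ := Int.exists_greatest_of_bdd (P := fun s => E s u ≠ 0)
    ⟨M, fun s hs => by_contra fun h => hs (hM s (by omega))⟩ ⟨s, hs⟩
  have hy1 : T.f 1 (E s u) = 0 := by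
    have h1 : E (s + 1) u = 0 := by_contra fun h => absurd (hmax _ h) (by omega)
    have := hf 1 s u
    rwa [zero _ f1, h1, zero _ f0, map_zero, sub_zero, sub_zero] at this
  have hy0 : T.h 0 (E s u) = (2 * N - l : ℂ) • E s u := by
    have h1 := zero _ h0 s
    rw [map_add, map_smul] at h1
    rw [hh, add_zero, eq_neg_of_add_eq_zero_left h1]
    module
  obtain ⟨k', hk'⟩ := T.level_sub_weight hs hy1 hy0
  have : ((k + k' + 2 : ℕ) : ℂ) = 0 := by
    push_cast
    linear_combination -hk - hk' + 2 * hc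
  exact absurd (Nat.cast_eq_zero.1 this) (by omega)

end AffineSl2

/-! ### Nilpotent fields with commuting modes -/

section Power

variable {W : Type*} [AddCommGroup W] [Module ℂ W]

/-- The normally ordered power `F(z)^N`, defined by `F^0 = 1` and `F^{N+1} = F_{-1} F^N`. -/
def fieldPow (F : VertexOperator ℂ W) : ℕ → VertexOperator ℂ W
  | 0 => idField W
  | N + 1 => nprod F (fieldPow F N) (-1)

/-- The modes of the normally ordered product. -/
theorem ncoeff_nprod_neg_one (F G : VertexOperator ℂ W) (k : ℤ) (w : W) :
    ncoeff (nprod F G (-1)) k w = ∑ᶠ i : ℕ, ncoeff F (-1 - i) (ncoeff G (k + i) w) +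
      ∑ᶠ i : ℕ, ncoeff G (k - 1 - i) (ncoeff F i w) := by
  rw [ncoeff_nprod_split]
  simp only [cf_neg_one, one_smul, Int.negOnePow_neg, Int.negOnePow_one, Units.val_neg,
    Units.val_one, neg_smul, sub_neg_eq_add]
  rfl

/-- If `F_i` kills `U` for `i > n` then the highest possibly nonzero mode of `F^N` on `U` is
`F_n^N`. -/
theorem ncoeff_fieldPow {F : VertexOperator ℂ W} {n : ℤ} {U : Submodule ℂ W}
    (hU : ∀ i, ∀ u ∈ U, ncoeff F i u ∈ U) (h0 : ∀ i, n < i → ∀ u ∈ U, ncoeff F i u = 0) (N : ℕ) :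
    (∀ k, ∀ u ∈ U, ncoeff (fieldPow F N) k u ∈ U) ∧
      (∀ k, N * (n + 1) - 1 < k → ∀ u ∈ U, ncoeff (fieldPow F N) k u = 0) ∧
      ∀ u ∈ U, ncoeff (fieldPow F N) (N * (n + 1) - 1) u = (ncoeff F n ^ N) u := by
  induction N with
  | zero =>
    refine ⟨fun k u hu => ?_, fun k hk u _ => ?_, fun u _ => ?_⟩
    · rw [fieldPow, ncoeff_idField]
      split_ifs
      · exact hu
      · exact zero_mem _
    · rw [fieldPow, ncoeff_idField, if_neg (by simp at hk; omega)]; rfl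
    · rw [fieldPow, ncoeff_idField, if_pos (by simp)]; rfl
  | succ N ih =>
    obtain ⟨ih1, ih2, ih3⟩ := ih
    have hb : ((N + 1 : ℕ) : ℤ) * (n + 1) - 1 = (N * (n + 1) - 1) + n + 1 := by push_cast; ring
    rw [hb]
    generalize (N : ℤ) * (n + 1) - 1 = b at ih2 ih3
    refine ⟨fun k u hu => ?_, fun k hk u hu => ?_, fun u hu => ?_⟩
    · rw [fieldPow, ncoeff_nprod_neg_one]
      exact add_mem (finsum_mem_submodule U fun i => hU _ _ (ih1 _ _ hu))
        (finsum_mem_submodule U fun i => ih1 _ _ (hU _ _ hu))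
    · rw [fieldPow, ncoeff_nprod_neg_one]
      have e1 : ∀ i : ℕ, ncoeff F (-1 - i) (ncoeff (fieldPow F N) (k + i) u) = 0 := fun i => by
        by_cases h : b < k + i
        · rw [ih2 _ h _ hu, map_zero]
        · exact h0 _ (by omega) _ (ih1 _ _ hu)
      have e2 : ∀ i : ℕ, ncoeff (fieldPow F N) (k - 1 - i) (ncoeff F i u) = 0 := fun i => by
        by_cases h : n < i
        · rw [h0 _ h _ hu, map_zero]
        · exact ih2 _ (by omega) _ (hU _ _ hu)
      rw [finsum_congr e1, finsum_congr e2, finsum_zero, add_zero]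
    · rw [fieldPow, ncoeff_nprod_neg_one]
      have e1 : ∀ i : ℕ, (i : ℤ) ≠ -1 - n →
          ncoeff F (-1 - i) (ncoeff (fieldPow F N) (b + n + 1 + i) u) = 0 := fun i hi => by
        by_cases h : b < b + n + 1 + i
        · rw [ih2 _ h _ hu, map_zero]
        · exact h0 _ (by omega) _ (ih1 _ _ hu)
      have e2 : ∀ i : ℕ, (i : ℤ) ≠ n →
          ncoeff (fieldPow F N) (b + n + 1 - 1 - i) (ncoeff F i u) = 0 := fun i hi => by
        by_cases h : n < i
        · rw [h0 _ h _ hu, map_zero]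
        · exact ih2 _ (by omega) _ (hU _ _ hu)
      rcases lt_or_ge n 0 with hn | hn
      · obtain ⟨j, hj⟩ := Int.eq_ofNat_of_zero_le (show 0 ≤ -1 - n by omega)
        rw [finsum_eq_single _ j fun i hi => e1 i (by omega),
          finsum_congr fun i : ℕ => e2 i (by omega), finsum_zero, add_zero,
          show (-1 - (j : ℤ)) = n by omega, show b + n + 1 + j = b by omega, ih3 _ hu, pow_succ',
          Module.End.mul_apply]
      · obtain ⟨j, rfl⟩ := Int.eq_ofNat_of_zero_le hn
        rw [finsum_eq_single _ j fun i hi => e2 i (by omega),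
          finsum_congr fun i : ℕ => e1 i (by omega), finsum_zero, zero_add,
          show b + (j : ℤ) + 1 - 1 - j = b by omega, ih3 _ (hU _ _ hu), pow_succ,
          Module.End.mul_apply]

/-- If the modes of `F` commute and `F(z)^N = 0`, then every mode is locally nilpotent. -/
theorem nilpotent_of_fieldPow_eq_zero {F : VertexOperator ℂ W}
    (hF : ∀ i j w, ncoeff F i (ncoeff F j w) = ncoeff F j (ncoeff F i w)) {N : ℕ}
    (hN : fieldPow F N = 0) (n : ℤ) (w : W) : ∃ p, (ncoeff F n ^ p) w = 0 := by
  have hc : ∀ i j, Commute (ncoeff F i) (ncoeff F j) := fun i j => LinearMap.ext (hF i j)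
  -- the vectors killed by all modes of index at least `K`
  let U : ℤ → Submodule ℂ W := fun K => ⨅ i : {i : ℤ // K ≤ i}, LinearMap.ker (ncoeff F i)
  have hU : ∀ K u, u ∈ U K ↔ ∀ i, K ≤ i → ncoeff F i u = 0 := fun K u => by
    simp [U]
  have hUF : ∀ K i, ∀ u ∈ U K, ncoeff F i u ∈ U K := fun K i u hu => (hU _ _).2 fun j hj => by
    rw [hF, (hU _ _).1 hu j hj, map_zero]
  have hUP : ∀ K i (p : ℕ), ∀ u ∈ U K, (ncoeff F i ^ p) u ∈ U K := fun K i p u hu => by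
    induction p with
    | zero => exact hu
    | succ p ih => rw [pow_succ', Module.End.mul_apply]; exact hUF _ _ _ ih
  obtain ⟨K, hK⟩ := ncoeff_trunc F w
  -- downward induction on the index, for all vectors killed from index `K` on
  suffices h : ∀ (d : ℕ) (n : ℤ), K - n ≤ d → ∀ u ∈ U K, ∃ p, (ncoeff F n ^ p) u = 0 from
    h (K - n).toNat n (by omega) w ((hU _ _).2 hK)
  intro d
  induction d using Nat.strong_induction_on with
  | _ d ih =>
  intro n hn w hw
  by_contra! hw0
  -- kill the modes of index between `n` and `K` one by one, keeping `F_n` non-nilpotent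
  have step : ∀ j : ℕ, n + 1 ≤ K - j →
      ∃ u ∈ U (K - j), u ∈ U K ∧ ∀ p, (ncoeff F n ^ p) u ≠ 0 := by
    intro j
    induction j with
    | zero => intro _; exact ⟨w, by simpa using hw, hw, hw0⟩
    | succ j ihj =>
      intro hj
      obtain ⟨u, hu, huK, hu0⟩ := ihj (by push_cast at hj; omega)
      obtain ⟨p, hp⟩ := ih (j + 1) (by push_cast at hj; omega) (K - (j + 1)) (by push_cast; omega)
        u huK
      -- the last power of the mode that keeps `F_n` non-nilpotent
      obtain ⟨a, ha, ha'⟩ : ∃ a, (∀ q, (ncoeff F n ^ q) ((ncoeff F (K - (j + 1)) ^ a) u) ≠ 0) ∧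
          ∃ q, (ncoeff F n ^ q) ((ncoeff F (K - (j + 1)) ^ (a + 1)) u) = 0 := by
        by_contra! h
        have : ∀ a q, (ncoeff F n ^ q) ((ncoeff F (K - (j + 1)) ^ a) u) ≠ 0 := by
          intro a
          induction a with
          | zero => exact hu0
          | succ a iha => exact h a iha
        exact this p 0 hp
      obtain ⟨q, hq⟩ := ha'
      refine ⟨(ncoeff F n ^ q) ((ncoeff F (K - (j + 1)) ^ a) u), (hU _ _).2 fun i hi => ?_,
        hUP _ _ _ _ (hUP _ _ _ _ huK), fun p => ?_⟩
      · push_cast at hi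
        rcases hi.eq_or_lt with rfl | hi
        · rw [← Module.End.mul_apply, ((hc _ n).pow_right q).eq, Module.End.mul_apply,
            ← Module.End.mul_apply (ncoeff F _), ← pow_succ']
          exact hq
        · exact (hU _ _).1 (hUP _ _ _ _ (hUP _ _ _ _ hu)) i (by omega)
      · rw [← Module.End.mul_apply, ← pow_add]
        exact ha _
  rcases lt_or_ge n K with hnK | hnK
  · obtain ⟨u, hu, -, hu0⟩ := step (K - (n + 1)).toNat (by omega)
    have := (ncoeff_fieldPow (n := n) (hUF _) (fun i hi v hv => (hU _ _).1 hv i (by omega)) N).2.2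
      u hu
    rw [hN] at this
    exact hu0 N (this.symm.trans (by simp))
  · exact hw0 1 (by rw [pow_one]; exact (hU _ _).1 hw n hnK)

end Power

/-! ### Root lengths and `sl₂`-triples -/

section Roots

open LieAlgebra LieAlgebra.IsKilling

variable {g : Type*} [LieRing g] [LieAlgebra ℂ g] [FiniteDimensional ℂ g] [LieAlgebra.IsSimple ℂ g]
  (H : LieSubalgebra ℂ g) [H.IsCartanSubalgebra]

theorem nonempty_root : Nonempty H.root := by
  by_contra h
  rw [not_nonempty_iff] at h
  have h1 := RootPairing.IsRootSystem.span_root_eq_top (P := rootSystem H)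
  rw [Set.range_eq_empty, Submodule.span_empty] at h1
  have : Nontrivial (Module.Dual ℂ H) := RootPairing.IsIrreducible.nontrivial (P := rootSystem H)
  exact bot_ne_top h1

/-- `⟨α, α⟩ ⟨α^∨, α^∨⟩ = 4`. -/
theorem killingSq_mul (α : H.root) :
    killingSq H α * (rootSystem H).CorootForm (coroot α.1) (coroot α.1) = 4 := by
  have h0 : killingSq H α ≠ 0 :=
    root_apply_cartanEquivDual_symm_ne_zero (LieSubalgebra.isNonZero_coe_root α)
  have h1 : (rootSystem H).CorootForm (coroot α.1) (coroot α.1) =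
      LieModule.traceForm ℂ H g (coroot α.1) (coroot α.1) := by
    rw [corootForm_rootSystem_eq_killing]; rfl
  rw [h1, traceForm_coroot, root_apply_coroot (LieSubalgebra.isNonZero_coe_root α)]
  change killingSq H α * (2 • (killingSq H α)⁻¹ • (2 : ℂ)) = 4
  rw [nsmul_eq_mul, smul_eq_mul]
  field_simp
  norm_num

/-- The Killing form takes positive integral values on coroots, being the sum of the squares of all
roots at the coroot. This identifies the relevant complex numbers as positive reals. -/
theorem exists_corootForm_eq (α : H.root) :
    ∃ n : ℕ, 0 < n ∧ (rootSystem H).CorootForm (coroot α.1) (coroot α.1) = n := by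
  have h : (rootSystem H).CorootForm (coroot α.1) (coroot α.1) =
      ((∑ β, (rootSystem H).pairingIn ℤ β α ^ 2 : ℤ) : ℂ) := by
    rw [RootPairing.corootForm_apply_apply, Int.cast_sum]
    refine Finset.sum_congr rfl fun β _ => ?_
    have := (rootSystem H).algebraMap_pairingIn ℤ β α
    rw [Int.cast_pow, sq]
    change (rootSystem H).pairing β α * (rootSystem H).pairing β α = _
    rw [← this]
    rfl
  obtain ⟨n, hn⟩ := Int.eq_ofNat_of_zero_le
    (Finset.sum_nonneg fun β _ => sq_nonneg ((rootSystem H).pairingIn ℤ β α))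
  rw [hn] at h
  refine ⟨n, Nat.pos_of_ne_zero ?_, by simpa using h⟩
  rintro rfl
  have := killingSq_mul H α
  rw [h] at this
  norm_num at this

/-- `ε_α ∈ {1, 2, 3}`, and the value `1` is attained, namely by the roots with the shortest
coroots. -/
theorem eps_spec : (∀ α ∈ H.root, eps H α = 1 ∨ eps H α = 2 ∨ eps H α = 3) ∧
    ∃ α ∈ H.root, eps H α = 1 := by
  have := nonempty_root H
  choose n hn hn' using exists_corootForm_eq H
  have hk : ∀ α : H.root, killingSq H α = ((4 / n α : ℝ) : ℂ) := fun α => by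
    have h1 := killingSq_mul H α
    have h2 : (n α : ℂ) ≠ 0 := Nat.cast_ne_zero.2 (hn α).ne'
    rw [hn'] at h1
    push_cast
    rw [eq_div_iff h2, h1]
  have hre : ∀ α : H.root, (killingSq H α).re = 4 / n α := fun α => by rw [hk, Complex.ofReal_re]
  obtain ⟨α₀, h₀⟩ := exists_eq_ciSup_of_finite (f := fun α : H.root => (killingSq H α).re)
  have hl : longSq H = 4 / n α₀ := h₀.symm.trans (hre α₀)
  have hp : ∀ α, (0 : ℝ) < n α := fun α => Nat.cast_pos.2 (hn α)
  have hmin : ∀ α, n α₀ ≤ n α := fun α => by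
    have h1 : (killingSq H α).re ≤ longSq H :=
      le_ciSup (f := fun α : H.root => (killingSq H α).re) (Set.finite_range _).bddAbove α
    rw [hre, hl, div_le_div_iff_of_pos_left (by norm_num) (hp _) (hp _)] at h1
    exact_mod_cast h1
  have he : ∀ α : H.root, eps H α = n α / n α₀ := fun α => by
    have h2 : (n α : ℂ) ≠ 0 := Nat.cast_ne_zero.2 (hn α).ne'
    have h3 : (n α₀ : ℂ) ≠ 0 := Nat.cast_ne_zero.2 (hn α₀).ne'
    rw [eps, rootSq, hk, hl]
    push_cast
    field_simp
    try norm_num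
  have h3 : (n α₀ : ℂ) ≠ 0 := Nat.cast_ne_zero.2 (hn α₀).ne'
  refine ⟨fun α hα => ?_, α₀, α₀.2, by rw [he, div_self h3]⟩
  have h4 := RootPairing.InvariantForm.apply_eq_or (rootSystem H).flip.toInvariantForm ⟨α, hα⟩ α₀
  -- the invariant form in `h4` is the form on the coroots
  change (rootSystem H).CorootForm (coroot α) (coroot α) =
      (rootSystem H).CorootForm (coroot α₀.1) (coroot α₀.1) ∨
    (rootSystem H).CorootForm (coroot α) (coroot α) =
      2 * (rootSystem H).CorootForm (coroot α₀.1) (coroot α₀.1) ∨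
    (rootSystem H).CorootForm (coroot α) (coroot α) =
      3 * (rootSystem H).CorootForm (coroot α₀.1) (coroot α₀.1) ∨
    (rootSystem H).CorootForm (coroot α₀.1) (coroot α₀.1) =
      2 * (rootSystem H).CorootForm (coroot α) (coroot α) ∨
    (rootSystem H).CorootForm (coroot α₀.1) (coroot α₀.1) =
      3 * (rootSystem H).CorootForm (coroot α) (coroot α) at h4
  have h5 := hn' ⟨α, hα⟩
  have h6 := hmin ⟨α, hα⟩
  have h7 := hn ⟨α, hα⟩
  have h8 := he ⟨α, hα⟩
  generalize n ⟨α, hα⟩ = k at h5 h6 h7 h8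
  simp only at h5 h8
  rw [h5, hn' α₀] at h4
  rw [h8]
  norm_cast at h4
  rcases h4 with h4 | h4 | h4 | h4 | h4
  · left; rw [h4, div_self h3]
  · right; left; rw [h4]; push_cast; field_simp
  · right; right; rw [h4]; push_cast; field_simp
  · omega
  · omega

theorem exists_nat_eps {α : LieModule.Weight ℂ H g} (hα : α ∈ H.root) : ∃ k : ℕ, eps H α = k := by
  rcases (eps_spec H).1 α hα with h | h | h
  · exact ⟨1, by simpa using h⟩
  · exact ⟨2, by simpa using h⟩
  · exact ⟨3, by simpa using h⟩

/-- An `sl₂`-triple attached to a root, with the values of the normalized form on it. -/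
structure RootTriple (α : LieModule.Weight ℂ H g) where
  /-- the raising element -/
  e : g
  /-- the lowering element -/
  f : g
  /-- the coroot -/
  h : g
  e_mem : e ∈ rootSpace H α
  f_mem : f ∈ rootSpace H (-α)
  lie_ef : ⁅e, f⁆ = h
  lie_he : ⁅h, e⁆ = (2 : ℂ) • e
  lie_hf : ⁅h, f⁆ = -((2 : ℂ) • f)
  form_ef : (normalizedForm H).form e f = eps H α

/-- Scaled `sl₂`-triples exist for all roots; the normalization `⟨e, f⟩ = ε_α` is automatic. -/
theorem exists_rootTriple {α : LieModule.Weight ℂ H g} (hα : α ∈ H.root) :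
    Nonempty (RootTriple H α) := by
  have hα0 : α.IsNonZero := LieSubalgebra.isNonZero_coe_root ⟨α, hα⟩
  obtain ⟨h, e, f, t, he, hf⟩ := exists_isSl2Triple_of_weight_isNonZero hα0
  have h1 := lie_eq_killingForm_smul_of_mem_rootSpace_of_mem_rootSpace_neg he hf
  have h2 : ⁅h, e⁆ = (2 : ℂ) • e := by rw [t.lie_h_e_nsmul, ofNat_smul_eq_nsmul ℂ 2 e]
  refine ⟨⟨e, f, h, he, hf, t.lie_e_f, h2, ?_, ?_⟩⟩
  · rw [t.lie_h_f_nsmul, ofNat_smul_eq_nsmul ℂ 2 f]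
  · have h3 : killingForm ℂ g e f * killingSq H α = 2 := by
      have h4 : ⁅(cartanEquivDual H).symm α, e⁆ = killingSq H α • e :=
        lie_eq_smul_of_mem_rootSpace he _
      rw [← t.lie_e_f, h1, smul_lie] at h2
      change killingForm ℂ g e f • ⁅(cartanEquivDual H).symm α, e⁆ = _ at h2
      rw [h4, smul_smul] at h2
      exact smul_left_injective ℂ t.e_ne_zero h2
    have h5 : killingSq H α ≠ 0 := fun h => by rw [h, mul_zero] at h3; norm_num at h3
    change ((longSq H / 2 : ℝ) : ℂ) * killingForm ℂ g e f = 2 / (killingSq H α / (longSq H / 2 : ℝ))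
    rw [div_div_eq_mul_div, eq_div_iff h5]
    linear_combination ((longSq H / 2 : ℝ) : ℂ) * h3

namespace RootTriple

variable {H} {α : LieModule.Weight ℂ H g} (t : RootTriple H α)

theorem form_ee : (normalizedForm H).form t.e t.e = 0 := by
  have h := (normalizedForm H).inv t.h t.e t.e
  rw [t.lie_he, lie_self, map_zero, map_smul, LinearMap.smul_apply, smul_eq_mul] at h
  simpa using h

theorem form_ff : (normalizedForm H).form t.f t.f = 0 := by
  have h := (normalizedForm H).inv t.h t.f t.f
  rw [t.lie_hf, lie_self, map_zero, map_neg, map_smul, LinearMap.neg_apply, LinearMap.smul_apply,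
    smul_eq_mul] at h
  simpa using h

theorem form_he : (normalizedForm H).form t.h t.e = 0 := by
  have h := (normalizedForm H).inv t.h t.h t.e
  rw [t.lie_he, lie_self, map_zero, LinearMap.zero_apply, map_smul, smul_eq_mul] at h
  simpa using h.symm

theorem form_hf : (normalizedForm H).form t.h t.f = 0 := by
  have h := (normalizedForm H).inv t.h t.h t.f
  rw [t.lie_hf, lie_self, map_zero, LinearMap.zero_apply, map_neg, map_smul, smul_eq_mul] at h
  simpa using h.symm

theorem form_hh : (normalizedForm H).form t.h t.h = 2 * eps H α := by
  have h := (normalizedForm H).inv t.h t.e t.f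
  rw [t.lie_he, t.lie_ef, map_smul, LinearMap.smul_apply, smul_eq_mul, t.form_ef] at h
  exact h.symm

theorem e_ne_zero (hα : α ∈ H.root) : t.e ≠ 0 := by
  intro h
  have h1 := t.form_ef
  rw [h, map_zero, LinearMap.zero_apply] at h1
  rcases (eps_spec H).1 α hα with h | h | h <;> rw [h] at h1 <;> norm_num at h1

/-- Every root vector is a multiple of `e`. -/
theorem exists_smul (hα : α ∈ H.root) {a : g} (ha : a ∈ rootSpace H α) : ∃ c : ℂ, a = c • t.e := by
  have h0 : (⟨t.e, t.e_mem⟩ : rootSpace H α) ≠ 0 := fun h =>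
    t.e_ne_zero hα (congrArg Subtype.val h)
  obtain ⟨c, hc⟩ := (finrank_eq_one_iff_of_nonzero' _ h0).1
    (finrank_rootSpace_eq_one α (LieSubalgebra.isNonZero_coe_root ⟨α, hα⟩)) ⟨a, ha⟩
  exact ⟨c, (congrArg Subtype.val hc).symm⟩

end RootTriple

end Roots

/-! ### The affine `sl₂` subalgebras attached to the real roots -/

section Brackets

variable {g : Type*} [LieRing g] [LieAlgebra ℂ g] (κ : InvForm g) (μ : ℂ)

theorem lie_hLoop_hLoop_of_form_eq_zero {u v : g} (h : κ.form u v = 0) (i j p q : ℤ) :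
    ⁅hLoop κ μ i p u, hLoop κ μ j q v⁆ = hLoop κ μ (i + j) (p + q) ⁅u, v⁆ := by
  refine Subtype.ext ((hom_bracket κ μ (i, p) (j, q) _ _).trans ?_)
  refine congrArg (hom κ μ (i + j, p + q)) ?_
  ext <;> simp [compBracket, dot, pair, vec, h]

/-- The bracket in opposite powers of `t₁`. The term with `k₀` only survives in degree zero, because
`t₀^m k₀` is exact for `m ≠ 0`. -/
theorem lie_hLoop_hLoop_neg (u v : g) (i j p : ℤ) :
    ⁅hLoop κ μ i p u, hLoop κ μ j (-p) v⁆ = hLoop κ μ (i + j) 0 ⁅u, v⁆ +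
      κ.form u v • ((if i + j = 0 then (i : ℂ) else 0) • hK0 κ μ + (p : ℂ) • hK1 κ μ (i + j)) := by
  refine Subtype.ext ((hom_bracket κ μ (i, p) (j, -p) _ _).trans ?_)
  rw [Prod.mk_add_mk, add_neg_cancel]
  change _ = hom κ μ (i + j, 0) (⁅u, v⁆, 0, 0) + κ.form u v •
    ((if i + j = 0 then (i : ℂ) else 0) • kform κ μ 0 0 1 0 + (p : ℂ) • kform κ μ (i + j) 0 0 1)
  have h : ((if i + j = 0 then (i : ℂ) else 0) • kform κ μ 0 0 1 0 : Full κ μ) =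
      (i : ℂ) • kform κ μ (i + j) 0 1 0 := by
    split_ifs with h
    · rw [h]
    · rw [kform_zero_mem κ μ _ h, smul_zero, zero_smul]
  rw [h, kform, kform, ← hom_smul, ← hom_smul, ← hom_add, ← hom_smul, ← hom_add]
  refine congrArg (hom κ μ (i + j, 0)) ?_
  ext <;> simp [compBracket, dot, pair, vec]

theorem lie_hK1_hLoop (u : g) (i j p : ℤ) : ⁅hK1 κ μ i, hLoop κ μ j p u⁆ = 0 := by
  refine Subtype.ext ((hom_bracket κ μ (i, 0) (j, p) _ _).trans ?_)
  refine (congrArg (hom κ μ _) ?_).trans (hom_zero κ μ _)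
  ext <;> simp [compBracket, dot, pair, vec]

theorem lie_hK1_hK1 (i j : ℤ) : ⁅hK1 κ μ i, hK1 κ μ j⁆ = 0 := by
  refine Subtype.ext ((hom_bracket κ μ (i, 0) (j, 0) _ _).trans ?_)
  refine (congrArg (hom κ μ _) ?_).trans (hom_zero κ μ _)
  ext <;> simp [compBracket, dot, pair, vec]

end Brackets

section Affine

open LieAlgebra

variable {g : Type*} [LieRing g] [LieAlgebra ℂ g] [FiniteDimensional ℂ g] [LieAlgebra.IsSimple ℂ g]
  {H : LieSubalgebra ℂ g} [H.IsCartanSubalgebra] {μ : ℂ} {α : LieModule.Weight ℂ H g}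

/-- The modes of the coroot in the affine `sl₂` attached to the root `α + m δ₁`; the term with `k₁`
is produced by the bracket of `t₁^m ⊗ e` and `t₁^{-m} ⊗ f`. -/
def RootTriple.hMode (t : RootTriple H α) (μ : ℂ) (m n : ℤ) : HatO (normalizedForm H) μ :=
  hLoop _ μ n 0 t.h + (eps H α * m) • hK1 _ μ n

namespace RootTriple

variable (t : RootTriple H α) (m i j : ℤ)

theorem lie_ee :
    ⁅hLoop (normalizedForm H) μ i m t.e, hLoop (normalizedForm H) μ j m t.e⁆ = 0 := by
  rw [lie_hLoop_hLoop_of_form_eq_zero _ _ t.form_ee, lie_self, map_zero]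

theorem lie_ff :
    ⁅hLoop (normalizedForm H) μ i m t.f, hLoop (normalizedForm H) μ j m t.f⁆ = 0 := by
  rw [lie_hLoop_hLoop_of_form_eq_zero _ _ t.form_ff, lie_self, map_zero]

theorem lie_e_f :
    ⁅hLoop (normalizedForm H) μ i m t.e, hLoop (normalizedForm H) μ j (-m) t.f⁆ =
      t.hMode μ m (i + j) + (if i + j = 0 then i * eps H α else 0) • hK0 _ μ := by
  rw [lie_hLoop_hLoop_neg, t.lie_ef, t.form_ef, hMode]
  split_ifs <;> module

theorem lie_h_e :
    ⁅t.hMode μ m i, hLoop (normalizedForm H) μ j m t.e⁆ =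
      (2 : ℂ) • hLoop (normalizedForm H) μ (i + j) m t.e := by
  rw [hMode, add_lie, smul_lie, lie_hK1_hLoop, smul_zero, add_zero,
    lie_hLoop_hLoop_of_form_eq_zero _ _ t.form_he, t.lie_he, map_smul, zero_add]

theorem lie_h_f :
    ⁅t.hMode μ m i, hLoop (normalizedForm H) μ j (-m) t.f⁆ =
      -((2 : ℂ) • hLoop (normalizedForm H) μ (i + j) (-m) t.f) := by
  rw [hMode, add_lie, smul_lie, lie_hK1_hLoop, smul_zero, add_zero,
    lie_hLoop_hLoop_of_form_eq_zero _ _ t.form_hf, t.lie_hf, map_neg, map_smul, zero_add]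

theorem lie_h_h :
    ⁅t.hMode μ m i, t.hMode μ m j⁆ =
      (if i + j = 0 then 2 * i * eps H α else 0) • hK0 (normalizedForm H) μ := by
  have h1 : ⁅hLoop (normalizedForm H) μ i 0 t.h, hK1 (normalizedForm H) μ j⁆ = 0 := by
    rw [← lie_skew, lie_hK1_hLoop, neg_zero]
  have h2 := lie_hLoop_hLoop_neg (normalizedForm H) μ t.h t.h i j 0
  rw [neg_zero, lie_self, map_zero, zero_add, Int.cast_zero, zero_smul, add_zero, t.form_hh,
    smul_smul] at h2
  rw [hMode, hMode, add_lie, lie_add, lie_add, smul_lie, smul_lie, lie_smul, lie_smul,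
    lie_hK1_hLoop, lie_hK1_hK1, h1, h2]
  simp only [smul_zero, add_zero]
  congr 1
  split_ifs <;> ring

variable {W : Type*} [AddCommGroup W] [Module ℂ W] {ρ : HatRep (normalizedForm H) μ W}

theorem neg_mem_root (hα : α ∈ H.root) : -α ∈ H.root := by
  have h : α.IsNonZero := LieSubalgebra.isNonZero_coe_root ⟨α, hα⟩
  simpa [LieSubalgebra.root] using h

theorem rep_lie (ρ : HatRep (normalizedForm H) μ W) (x y : HatO (normalizedForm H) μ) (w : W) :
    ρ x (ρ y w) = ρ y (ρ x w) + ρ ⁅x, y⁆ w := by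
  rw [LieHom.map_lie]
  exact (add_sub_cancel (ρ y (ρ x w)) (ρ x (ρ y w))).symm

/-- The structure of a module over affine `sl₂` of level `ε_α ℓ` on a restricted integrable module
of level `ℓ`, given by a real root. -/
def affine (t : RootTriple H α) (hα : α ∈ H.root) (m : ℤ) {ℓ : ℂ} (hr : IsRestricted ρ)
    (hl : HasLevel ρ ℓ) (hi : IsIntegrable H ρ) : AffineSl2 W (eps H α * ℓ) where
  e n := ρ (hLoop _ μ n m t.e)
  f n := ρ (hLoop _ μ n (-m) t.f)
  h n := ρ (t.hMode μ m n)
  ee i j w := by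
    rw [rep_lie, t.lie_ee, map_zero, LinearMap.zero_apply, add_zero]
  ff i j w := by
    rw [rep_lie, t.lie_ff, map_zero, LinearMap.zero_apply, add_zero]
  ef i j w := by
    rw [rep_lie, t.lie_e_f, map_add, LinearMap.add_apply, map_smul, LinearMap.smul_apply, hl,
      smul_smul, add_assoc, ite_mul, zero_mul, mul_assoc]
  he i j w := by
    rw [rep_lie, t.lie_h_e, map_smul, LinearMap.smul_apply]
  hf i j w := by
    rw [rep_lie, t.lie_h_f, map_neg, map_smul, LinearMap.neg_apply, LinearMap.smul_apply,
      ← sub_eq_add_neg]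
  hh i j w := by
    rw [rep_lie, t.lie_h_h, map_smul, LinearMap.smul_apply, hl, smul_smul, ite_mul, zero_mul,
      mul_assoc]
  trunc w := by
    obtain ⟨N1, h1⟩ := hr.trunc (genL m t.e) w
    obtain ⟨N2, h2⟩ := hr.trunc (genL (-m) t.f) w
    obtain ⟨N3, h3⟩ := hr.trunc (genL 0 t.h) w
    obtain ⟨N4, h4⟩ := hr.trunc genK1 w
    refine ⟨max (max N1 N2) (max N3 N4), fun n hn => ⟨?_, ?_, ?_⟩⟩
    · rw [← mode_genL]; exact h1 n (by omega)
    · rw [← mode_genL]; exact h2 n (by omega)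
    · rw [hMode, map_add, map_smul, ← mode_genL, ← mode_genK1, LinearMap.add_apply,
        LinearMap.smul_apply, h3 n (by omega), h4 n (by omega), smul_zero, add_zero]
  nil_e n w := hi n m α hα t.e t.e_mem w
  nil_f n w := hi n (-m) (-α) (neg_mem_root hα) t.f (by simpa using t.f_mem) w

end RootTriple

end Affine

/-! ### Quotients of vertex algebras -/

theorem VAModule.isLocal {V W : Type*} [AddCommGroup V] [Module ℂ V] [AddCommGroup W] [Module ℂ W]
    {A : VertexAlgebra V} (M : VAModule A W) (u v : V) : IsLocal (M.Y u) (M.Y v) := by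
  obtain ⟨N, hN⟩ := ncoeff_trunc (A.Y u) v
  refine ⟨N.toNat, fun p q w => (M.borcherds u v w p q N.toNat).symm.trans ?_⟩
  refine (finsum_congr fun i : ℕ => ?_).trans finsum_zero
  rw [hN _ (by omega), map_zero, map_zero]
  exact smul_zero _

section Quotient

variable {V Q : Type*} [AddCommGroup V] [Module ℂ V] [AddCommGroup Q] [Module ℂ Q]
  {π : V →ₗ[ℂ] Q} (hπ : Function.Surjective π)

include hπ in
/-- An endomorphism preserving the kernel of a surjection descends to the target. -/
theorem exists_descend (T : Module.End ℂ V) (hT : ∀ v, π v = 0 → π (T v) = 0) :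
    ∃ S : Module.End ℂ Q, ∀ v, S (π v) = π (T v) := by
  have h : ∀ u v, π u = π v → π (T u) = π (T v) := fun u v h => by
    have := hT (u - v) (by rw [map_sub, h, sub_self])
    rwa [map_sub, map_sub, sub_eq_zero] at this
  have hs : ∀ q, π (Function.surjInv hπ q) = q := Function.surjInv_eq hπ
  refine ⟨{ toFun := fun q => π (T (Function.surjInv hπ q)), map_add' := fun p q => ?_,
            map_smul' := fun c q => ?_ }, fun v => h _ _ (hs _)⟩
  · rw [← map_add, ← map_add]
    exact h _ _ (by rw [map_add, hs, hs, hs])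
  · rw [RingHom.id_apply, ← map_smul, ← map_smul]
    exact h _ _ (by rw [map_smul, hs, hs])

/-- The field induced on a quotient by a field whose modes preserve the kernel. -/
def quotField (F : VertexOperator ℂ V) (hF : ∀ n v, π v = 0 → π (ncoeff F n v) = 0) :
    VertexOperator ℂ Q :=
  mkField (fun n => (exists_descend hπ (ncoeff F n) (hF n)).choose) fun q => by
    obtain ⟨v, rfl⟩ := hπ q
    obtain ⟨N, hN⟩ := ncoeff_trunc F v
    refine ⟨N, fun n hn => ?_⟩
    rw [(exists_descend hπ (ncoeff F n) (hF n)).choose_spec, hN n hn, map_zero]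

theorem ncoeff_quotField (F : VertexOperator ℂ V) (hF) (n : ℤ) (v : V) :
    ncoeff (quotField hπ F hF) n (π v) = π (ncoeff F n v) := by
  rw [quotField, ncoeff_mkField, (exists_descend hπ (ncoeff F n) (hF n)).choose_spec]

theorem bor_map {F G : VertexOperator ℂ V} {F' G' : VertexOperator ℂ Q}
    (hF : ∀ n v, ncoeff F' n (π v) = π (ncoeff F n v))
    (hG : ∀ n v, ncoeff G' n (π v) = π (ncoeff G n v)) (p q r : ℤ) (v : V) :
    bor F' G' p q r (π v) = π (bor F G p q r v) := by
  rw [bor, bor, bor2_map π (trunc2_field F G v)]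
  simp only [hF, hG]

variable (A : VertexAlgebra V)

/-- The module structure on a quotient of the adjoint module. -/
def quotModule (hA : ∀ u n v, π v = 0 → π (ncoeff (A.Y u) n v) = 0) : VAModule A Q :=
  VAModule.ofFields A
    { toFun := fun u => quotField hπ (A.Y u) (hA u)
      map_add' := fun u v => field_ext fun n w => by
        obtain ⟨w, rfl⟩ := hπ w
        simp only [map_add, Pi.add_apply, LinearMap.add_apply, ncoeff_quotField]
      map_smul' := fun c u => field_ext fun n w => by
        obtain ⟨w, rfl⟩ := hπ w
        simp only [map_smul, Pi.smul_apply, LinearMap.smul_apply, ncoeff_quotField,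
          RingHom.id_apply] }
    (field_ext fun n w => by
      obtain ⟨w, rfl⟩ := hπ w
      refine (ncoeff_quotField hπ (A.Y A.vac) (hA A.vac) n w).trans ?_
      rw [A.vac_mode, ncoeff_idField]
      split_ifs
      · rfl
      · exact map_zero π)
    (fun u v => by
      obtain ⟨N, hN⟩ := A.adjoint.isLocal u v
      refine ⟨N, fun p q w => ?_⟩
      obtain ⟨w, rfl⟩ := hπ w
      refine (bor_map (ncoeff_quotField hπ (A.Y u) (hA u)) (ncoeff_quotField hπ (A.Y v) (hA v))
        p q N w).trans ?_
      exact (congrArg π (hN p q w)).trans (map_zero π))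
    (fun u v n => field_ext fun k w => by
      obtain ⟨w, rfl⟩ := hπ w
      refine (ncoeff_quotField hπ _ (hA _) k w).trans ?_
      rw [A.Y_nprod, ncoeff_nprod, ncoeff_nprod]
      exact (bor_map (ncoeff_quotField hπ (A.Y u) (hA u)) (ncoeff_quotField hπ (A.Y v) (hA v))
        0 k n w).symm)

theorem ncoeff_quotModule (hA : ∀ u n v, π v = 0 → π (ncoeff (A.Y u) n v) = 0) (u v : V) (n : ℤ) :
    ncoeff ((quotModule hπ A hA).Y u) n (π v) = π (ncoeff (A.Y u) n v) :=
  ncoeff_quotField hπ (A.Y u) (hA u) n v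

/-- A linear map factored through a surjection. -/
def factor {X : Type*} [AddCommGroup X] [Module ℂ X] (T : V →ₗ[ℂ] X)
    (hT : ∀ v, π v = 0 → T v = 0) : Q →ₗ[ℂ] X where
  toFun q := T (Function.surjInv hπ q)
  map_add' p q := by
    have hs : ∀ q, π (Function.surjInv hπ q) = q := Function.surjInv_eq hπ
    rw [← sub_eq_zero, ← map_add, ← map_sub]
    exact hT _ (by rw [map_sub, map_add, hs, hs, hs, sub_self])
  map_smul' c q := by
    have hs : ∀ q, π (Function.surjInv hπ q) = q := Function.surjInv_eq hπ
    rw [RingHom.id_apply, ← sub_eq_zero, ← map_smul, ← map_sub]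
    exact hT _ (by rw [map_sub, map_smul, hs, hs, sub_self])

theorem factor_apply {X : Type*} [AddCommGroup X] [Module ℂ X] (T : V →ₗ[ℂ] X)
    (hT : ∀ v, π v = 0 → T v = 0) (v : V) : factor hπ T hT (π v) = T v := by
  change T (Function.surjInv hπ (π v)) = T v
  rw [← sub_eq_zero, ← map_sub]
  exact hT _ (by rw [map_sub, Function.surjInv_eq hπ, sub_self])

/-- The condition on `B` to be the quotient vertex algebra structure along `π`. -/
def IsQuotientAlong (π : V →ₗ[ℂ] Q) (A : VertexAlgebra V) (B : VertexAlgebra Q) : Prop :=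
  B.vac = π A.vac ∧ ∀ u v n, ncoeff (B.Y (π u)) n (π v) = π (ncoeff (A.Y u) n v)

include hπ in
/-- The quotient of a vertex algebra by an ideal. -/
theorem exists_quotient (hA : ∀ u n v, π v = 0 → π (ncoeff (A.Y u) n v) = 0)
    (hA' : ∀ u, π u = 0 → (quotModule hπ A hA).Y u = 0) :
    ∃ B : VertexAlgebra Q, IsQuotientAlong π A B := by
  let M := quotModule hπ A hA
  have hM : ∀ u v n, ncoeff (M.Y u) n (π v) = π (ncoeff (A.Y u) n v) := fun u v n =>
    ncoeff_quotModule hπ A hA u v n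
  have hY : ∀ u, factor hπ M.Y hA' (π u) = M.Y u := factor_apply hπ M.Y hA'
  refine ⟨⟨π A.vac, factor hπ M.Y hA', fun n => ?_, fun u n hn => ?_, fun u => ?_,
    fun u v w p q r => ?_⟩, rfl, fun u v n => ?_⟩
  · rw [hY]; exact M.vac_mode n
  · obtain ⟨u, rfl⟩ := hπ u
    rw [hY, hM, A.creation u n hn, map_zero]
  · obtain ⟨u, rfl⟩ := hπ u
    rw [hY, hM, A.creation_neg_one]
  · obtain ⟨u, rfl⟩ := hπ u
    obtain ⟨v, rfl⟩ := hπ v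
    simp only [hY, hM]
    exact M.borcherds u v w p q r
  · change ncoeff (factor hπ M.Y hA' (π u)) n (π v) = _
    rw [hY, hM]

include hπ in
/-- The vertex algebra structure of a quotient is unique. -/
theorem quotient_unique {A : VertexAlgebra V} {B B' : VertexAlgebra Q} (h : IsQuotientAlong π A B)
    (h' : IsQuotientAlong π A B') : B = B' := by
  refine VertexAlgebra.ext (h.1.trans h'.1.symm) (LinearMap.ext fun u => field_ext fun n v => ?_)
  obtain ⟨u, rfl⟩ := hπ u
  obtain ⟨v, rfl⟩ := hπ v
  rw [h.2, h'.2]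

variable {A} {B : VertexAlgebra Q} {W : Type*} [AddCommGroup W] [Module ℂ W]

/-- Modules for a quotient are the modules on which the kernel acts by zero. -/
def quotientModuleEquiv (h : IsQuotientAlong π A B) :
    {M : VAModule A W // ∀ u, π u = 0 → M.Y u = 0} ≃ VAModule B W where
  toFun M :=
    { Y := factor hπ M.1.Y M.2
      vac_mode := fun n => by
        rw [h.1, factor_apply]; exact M.1.vac_mode n
      borcherds := fun u v w p q r => by
        obtain ⟨u, rfl⟩ := hπ u
        obtain ⟨v, rfl⟩ := hπ v
        simp only [h.2, factor_apply]
        exact M.1.borcherds u v w p q r }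
  invFun N := ⟨
    { Y := N.Y ∘ₗ π
      vac_mode := fun n => by
        rw [LinearMap.comp_apply, ← h.1]; exact N.vac_mode n
      borcherds := fun u v w p q r => by
        simp only [LinearMap.comp_apply, ← h.2]
        exact N.borcherds (π u) (π v) w p q r },
    fun u hu => by rw [LinearMap.comp_apply, hu, map_zero]⟩
  left_inv M := Subtype.ext (VAModule.ext (LinearMap.ext fun u => factor_apply hπ M.1.Y M.2 u))
  right_inv N := VAModule.ext (LinearMap.ext fun u => by
    obtain ⟨u, rfl⟩ := hπ u
    exact factor_apply hπ (N.Y ∘ₗ π) (fun u hu => by rw [LinearMap.comp_apply, hu, map_zero]) u)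

theorem quotientModuleEquiv_Y (h : IsQuotientAlong π A B)
    (M : {M : VAModule A W // ∀ u, π u = 0 → M.Y u = 0}) (u : V) :
    (quotientModuleEquiv hπ h M).Y (π u) = M.1.Y u := factor_apply hπ M.1.Y M.2 u

end Quotient

/-! ### The vanishing of `e(z)^{c + 1}` on integrable modules -/

section Power

open LieAlgebra

variable {g : Type*} [LieRing g] [LieAlgebra ℂ g] [FiniteDimensional ℂ g] [LieAlgebra.IsSimple ℂ g]
  {H : LieSubalgebra ℂ g} [H.IsCartanSubalgebra] {μ ℓ : ℂ} {α : LieModule.Weight ℂ H g}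
  {X : Type*} [AddCommGroup X] [Module ℂ X]

namespace RootTriple

variable {ρ : HatRep (normalizedForm H) μ X} {x₀ : X} (t : RootTriple H α) (m : ℤ)

/-- The element `h + ε_α m k₁` of `𝒜_g`, whose modes are the coroot modes `hMode`. -/
def hGen : GenSpace g := genL 0 t.h + (eps H α * m) • genK1

theorem mode_hGen (n : ℤ) : mode (normalizedForm H) μ n (t.hGen m) = t.hMode μ m n := by
  rw [hGen, map_add, map_smul, mode_genL, mode_genK1, hMode]

/-- The nonnegative modes of `e` kill all powers `e(-1)^N 𝟏`. -/
theorem e_pow (h0 : ∀ n a, 0 ≤ n → ρ (mode _ μ n a) x₀ = 0) (N : ℕ) {i : ℤ} (hi : 0 ≤ i) :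
    ρ (hLoop _ μ i m t.e) ((ρ (hLoop _ μ (-1) m t.e) ^ N) x₀) = 0 := by
  induction N with
  | zero => rw [← mode_genL]; exact h0 i _ hi
  | succ N ih =>
    rw [pow_succ', Module.End.mul_apply, rep_lie, t.lie_ee, ih, map_zero, map_zero,
      LinearMap.zero_apply, add_zero]

/-- The vector `e(-1)^N 𝟏` is killed by the positive coroot modes and has weight `2 N`. -/
theorem h_pow (h0 : ∀ n a, 0 ≤ n → ρ (mode _ μ n a) x₀ = 0) (N : ℕ) {i : ℤ} (hi : 0 ≤ i) :
    ρ (t.hMode μ m i) ((ρ (hLoop _ μ (-1) m t.e) ^ N) x₀) =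
      (if i = 0 then (2 * N : ℂ) else 0) • (ρ (hLoop _ μ (-1) m t.e) ^ N) x₀ := by
  induction N with
  | zero =>
    rw [← mode_hGen, pow_zero, Module.End.one_apply, h0 i _ hi]
    simp
  | succ N ih =>
    rw [pow_succ', Module.End.mul_apply, rep_lie, t.lie_h_e, ih, map_smul, map_smul,
      LinearMap.smul_apply]
    split_ifs with h
    · rw [h, zero_add]
      push_cast
      module
    · rw [t.e_pow m h0 N (i := i + -1) (by omega)]
      simp

/-- The modes of `f` of index at least two kill `e(-1)^N 𝟏`. -/
theorem f_pow (h0 : ∀ n a, 0 ≤ n → ρ (mode _ μ n a) x₀ = 0) (N : ℕ) {i : ℤ} (hi : 2 ≤ i) :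
    ρ (hLoop _ μ i (-m) t.f) ((ρ (hLoop _ μ (-1) m t.e) ^ N) x₀) = 0 := by
  induction N with
  | zero => rw [← mode_genL]; exact h0 i _ (by omega)
  | succ N ih =>
    have h := rep_lie ρ (hLoop _ μ (-1) m t.e) (hLoop _ μ i (-m) t.f)
      ((ρ (hLoop _ μ (-1) m t.e) ^ N) x₀)
    rw [t.lie_e_f, if_neg (by omega), zero_smul, add_zero, ih, map_zero,
      t.h_pow m h0 N (by omega), if_neg (by omega), zero_smul, add_zero] at h
    rw [pow_succ', Module.End.mul_apply]
    exact h.symm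

/-- The vector `e(-1)^{N+1} 𝟏` is singular at level `N`: the mode `f(1)` kills it. -/
theorem f_one_pow (h0 : ∀ n a, 0 ≤ n → ρ (mode _ μ n a) x₀ = 0) (hl : HasLevel ρ ℓ) {N : ℕ}
    (hN : eps H α * ℓ = N) :
    ρ (hLoop _ μ 1 (-m) t.f) ((ρ (hLoop _ μ (-1) m t.e) ^ (N + 1)) x₀) = 0 := by
  have hef : ∀ u, ρ (hLoop _ μ 1 (-m) t.f) (ρ (hLoop _ μ (-1) m t.e) u) =
      ρ (hLoop _ μ (-1) m t.e) (ρ (hLoop _ μ 1 (-m) t.f) u) +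
        ((N : ℂ) • 1 - ρ (t.hMode μ m 0)) u := fun u => by
    have h := rep_lie ρ (hLoop _ μ (-1) m t.e) (hLoop _ μ 1 (-m) t.f) u
    rw [t.lie_e_f, neg_add_cancel, if_pos rfl, map_add, LinearMap.add_apply, map_smul,
      LinearMap.smul_apply, hl, smul_smul, mul_assoc, hN] at h
    rw [h]
    simp only [LinearMap.sub_apply, LinearMap.smul_apply, Module.End.one_apply]
    push_cast
    module
  have hf : ∀ u, ((N : ℂ) • 1 - ρ (t.hMode μ m 0)) (ρ (hLoop _ μ (-1) m t.e) u) =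
      ρ (hLoop _ μ (-1) m t.e) (((N : ℂ) • 1 - ρ (t.hMode μ m 0)) u) -
        (2 : ℂ) • ρ (hLoop _ μ (-1) m t.e) u := fun u => by
    have h := rep_lie ρ (t.hMode μ m 0) (hLoop _ μ (-1) m t.e) u
    rw [t.lie_h_e, zero_add, map_smul, LinearMap.smul_apply] at h
    simp only [LinearMap.sub_apply, LinearMap.smul_apply, Module.End.one_apply, h, map_sub,
      map_smul]
    module
  have hv : ρ (hLoop _ μ 1 (-m) t.f) x₀ = 0 := by rw [← mode_genL]; exact h0 1 _ (by omega)
  have hh : ρ (t.hMode μ m 0) x₀ = 0 := by rw [← mode_hGen]; exact h0 0 _ le_rfl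
  rw [sl2_e_f_pow hef hf hv]
  simp [hh]

end RootTriple

variable {A : VertexAlgebra (VSpace (normalizedForm H) μ ℓ)} {W : Type*} [AddCommGroup W]
  [Module ℂ W]

theorem IsCanonical.ncoeff_genVec (hA : IsCanonical _ μ A) (n : ℤ) (a : GenSpace g)
    (v : VSpace (normalizedForm H) μ ℓ) :
    ncoeff (A.Y (genVec _ μ ℓ a)) n v = vRep _ μ ℓ (mode _ μ n a) v := hA.2 a n v

/-- The commutator of a generator with a field of a module. -/
theorem mode_commutator (hA : IsCanonical _ μ A) (M : VAModule A W)
    {ρ : HatRep (normalizedForm H) μ W}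
    (hρ : ∀ a n, ncoeff (M.Y (genVec _ μ ℓ a)) n = ρ (mode _ μ n a)) (a : GenSpace g)
    (v : VSpace (normalizedForm H) μ ℓ) (p q : ℤ)
    (h : ∀ i : ℤ, 1 ≤ i → vRep _ μ ℓ (mode _ μ i a) v = 0) (w : W) :
    ρ (mode _ μ p a) (ncoeff (M.Y v) q w) - ncoeff (M.Y v) q (ρ (mode _ μ p a) w) =
      ncoeff (M.Y (vRep _ μ ℓ (mode _ μ 0 a) v)) (p + q) w := by
  rw [← hρ, M.commutator, finsum_eq_single _ 0 fun i hi => ?_]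
  · rw [hA.ncoeff_genVec]
    simp
  · rw [hA.ncoeff_genVec, h i (by omega), map_zero, map_zero]
    exact smul_zero _

/-- On an integrable module the field attached to `e(-1)^{ε_α ℓ + 1} 𝟏` vanishes. -/
theorem Y_pow_eq_zero (hA : IsCanonical _ μ A) (M : VAModule A W)
    {ρ : HatRep (normalizedForm H) μ W}
    (hρ : ∀ a n, ncoeff (M.Y (genVec _ μ ℓ a)) n = ρ (mode _ μ n a)) (hr : IsRestricted ρ)
    (hl : HasLevel ρ ℓ) (hi : IsIntegrable H ρ) (hα : α ∈ H.root) (t : RootTriple H α) (m : ℤ)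
    {N : ℕ} (hN : eps H α * ℓ = N) :
    M.Y ((vRep _ μ ℓ (hLoop _ μ (-1) m t.e) ^ (N + 1)) (one _ μ ℓ)) = 0 := by
  have h0 : ∀ n a, 0 ≤ n → vRep _ μ ℓ (mode (normalizedForm H) μ n a) (one _ μ ℓ) = 0 :=
    fun n a hn => mode_smul_one hn a
  have he := fun i hi => t.e_pow m h0 (N + 1) (i := i) hi
  have hh := fun i hi => t.h_pow m h0 (N + 1) (i := i) hi
  have hf : ∀ i : ℤ, 1 ≤ i → vRep _ μ ℓ (hLoop _ μ i (-m) t.f)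
      ((vRep _ μ ℓ (hLoop _ μ (-1) m t.e) ^ (N + 1)) (one _ μ ℓ)) = 0 := fun i hi => by
    rcases hi.eq_or_lt with rfl | hi
    · exact t.f_one_pow m h0 vRep_level hN
    · exact t.f_pow m h0 (N + 1) (by omega)
  generalize (vRep _ μ ℓ (hLoop _ μ (-1) m t.e) ^ (N + 1)) (one _ μ ℓ) = v at he hh hf
  refine field_ext fun s w => ?_
  rw [map_zero, Pi.zero_apply, LinearMap.zero_apply]
  refine (t.affine hα m hr hl hi).eq_zero_of_power_like (E := ncoeff (M.Y v)) (N := N + 1)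
    (by rw [hN]; push_cast; rfl) (fun j s w => ?_) (fun j s w => ?_) (fun j s w => ?_)
    (ncoeff_trunc _) s w
  · have h := mode_commutator hA M hρ (genL m t.e) v j s
      (fun i hi => by rw [mode_genL]; exact he i (by omega)) w
    rw [mode_genL, mode_genL, he 0 le_rfl, map_zero, map_zero] at h
    exact sub_eq_zero.1 h
  · have h := mode_commutator hA M hρ (t.hGen m) v j s
      (fun i hi => by rw [t.mode_hGen, hh i (by omega), if_neg (by omega), zero_smul]) w
    rw [t.mode_hGen, t.mode_hGen, hh 0 le_rfl, if_pos rfl, map_smul, map_smul, add_comm j] at h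
    exact sub_eq_iff_eq_add'.1 h
  · have h := fun j s => mode_commutator hA M hρ (genL (-m) t.f) v j s
      (fun i hi => by rw [mode_genL]; exact hf i hi) w
    simp only [mode_genL] at h
    have h1 := h 0 (s + j)
    rw [zero_add, add_comm s, ← h j s, add_comm j] at h1
    exact h1.symm

end Power

/-! ### Local nilpotency on highest weight modules -/

section AdNilpotent

variable {L X : Type*} [LieRing L] [LieAlgebra ℂ L] [AddCommGroup X] [Module ℂ X]

/-- If `ad x` is nilpotent on `y` and `x` is nilpotent on the vector `w`, then `x` is nilpotent
on `y w`. -/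
theorem exists_pow_lie_eq_zero (ρ : L →ₗ⁅ℂ⁆ Module.End ℂ X) (x : L) {p : ℕ} :
    ∀ (k : ℕ) (y : L) (w : X), ((LieAlgebra.ad ℂ L x) ^ k) y = 0 → (ρ x ^ p) w = 0 →
      ∃ q, (ρ x ^ q) (ρ y w) = 0 := by
  induction p with
  | zero => intro k y w _ hw; exact ⟨0, by rw [pow_zero, Module.End.one_apply] at hw; rw [hw]; simp⟩
  | succ p ihp =>
    intro k
    induction k with
    | zero =>
      intro y w hy _
      rw [pow_zero, Module.End.one_apply] at hy
      exact ⟨0, by rw [hy]; simp⟩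
    | succ k ihk =>
      intro y w hy hw
      obtain ⟨q1, h1⟩ := ihp (k + 1) y (ρ x w) hy (by rw [← Module.End.mul_apply, ← pow_succ, hw])
      obtain ⟨q2, h2⟩ := ihk ⁅x, y⁆ w (by
        rw [pow_succ, Module.End.mul_apply] at hy; exact hy) hw
      refine ⟨max q1 q2 + 1, ?_⟩
      have h : ρ x (ρ y w) = ρ y (ρ x w) + ρ ⁅x, y⁆ w := by
        rw [LieHom.map_lie]
        exact (add_sub_cancel (ρ y (ρ x w)) (ρ x (ρ y w))).symm
      rw [pow_succ, Module.End.mul_apply, h, map_add, Module.End.pow_map_zero_of_le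
        (le_max_left _ _) h1, Module.End.pow_map_zero_of_le (le_max_right _ _) h2, add_zero]

theorem exists_pow_add_eq_zero {T : Module.End ℂ X} {u v : X} (hu : ∃ p, (T ^ p) u = 0)
    (hv : ∃ p, (T ^ p) v = 0) : ∃ p, (T ^ p) (u + v) = 0 := by
  obtain ⟨p, hp⟩ := hu
  obtain ⟨q, hq⟩ := hv
  refine ⟨max p q, ?_⟩
  rw [map_add, Module.End.pow_map_zero_of_le (le_max_left _ _) hp,
    Module.End.pow_map_zero_of_le (le_max_right _ _) hq, add_zero]

end AdNilpotent

section Loop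

variable {g : Type*} [LieRing g] [LieAlgebra ℂ g] (κ : InvForm g) (μ : ℂ)

/-- `ad (t^m ⊗ a)` is locally nilpotent if `ad a` is. -/
theorem ad_hLoop_nilpotent {a : g}
    (hn : ∀ u, ∃ k, ((LieAlgebra.ad ℂ g a) ^ k) u = 0) (n m : ℤ) (y : HatO κ μ) :
    ∃ k, ((LieAlgebra.ad ℂ (HatO κ μ) (hLoop κ μ n m a)) ^ k) y = 0 := by
  -- the computation takes place in the full toroidal Lie algebra
  let x : Full κ μ := hom κ μ (n, m) (a, 0, 0)
  have hb : ∀ (i : ℤ × ℤ) (Y : Comp g), ⁅x, hom κ μ i Y⁆ =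
      hom κ μ ((n, m) + i) (⁅a, Y.1⁆ - dot Y.2.2 (n, m) • a, κ.form a Y.1 • vec (n, m), 0) := by
    intro i Y
    refine (hom_bracket κ μ (n, m) i _ _).trans (congrArg _ ?_)
    ext <;> simp [compBracket, dot, pair, vec]
  have step : ∀ y : Full κ μ, (∃ k, ((LieAlgebra.ad ℂ (Full κ μ) x) ^ k) ⁅x, y⁆ = 0) →
      ∃ k, ((LieAlgebra.ad ℂ (Full κ μ) x) ^ k) y = 0 := fun y ⟨k, hk⟩ =>
    ⟨k + 1, by rw [pow_succ, Module.End.mul_apply, LieAlgebra.ad_apply, hk]⟩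
  have h1 : ∀ (i : ℤ × ℤ) (u : g) (b : ℂ × ℂ) (k : ℕ), ((LieAlgebra.ad ℂ g a) ^ k) u = 0 →
      ∃ k, ((LieAlgebra.ad ℂ (Full κ μ) x) ^ k) (hom κ μ i (u, b, 0)) = 0 := by
    intro i u b k hk
    induction k generalizing i u b with
    | zero =>
      rw [pow_zero, Module.End.one_apply] at hk
      refine ⟨1, ?_⟩
      rw [pow_one, LieAlgebra.ad_apply, hb]
      refine (congrArg _ ?_).trans (hom_zero κ μ _)
      ext <;> simp [hk, dot]
    | succ k ih =>
      refine step _ ?_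
      rw [hb]
      refine ih _ _ _ ?_
      rw [pow_succ, Module.End.mul_apply, LieAlgebra.ad_apply] at hk
      simpa [dot] using hk
  have h2 : ∀ y : Full κ μ, ∃ k, ((LieAlgebra.ad ℂ (Full κ μ) x) ^ k) y = 0 := fun y => by
    induction y using full_induction with
    | h0 => exact ⟨0, by simp⟩
    | ha y z hy hz => exact exists_pow_add_eq_zero hy hz
    | hs i Y =>
      refine step _ ?_
      rw [hb]
      obtain ⟨k, hk⟩ := hn (⁅a, Y.1⁆ - dot Y.2.2 (n, m) • a)
      exact h1 _ _ _ k hk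
  obtain ⟨k, hk⟩ := h2 y
  refine ⟨k, Subtype.ext (Eq.trans ?_ hk)⟩
  clear hk
  induction k with
  | zero => rfl
  | succ k ih =>
    rw [pow_succ', pow_succ', Module.End.mul_apply, Module.End.mul_apply, ← ih]
    rfl

/-- `d_{-1,1}` lowers the power of `t₀`. -/
theorem lie_hDD_hLoop (n m : ℤ) (a : g) :
    ⁅hDD κ μ (-1) 1, hLoop κ μ n m a⁆ = (-n : ℂ) • hLoop κ μ (n - 1) (m + 1) a := by
  refine Subtype.ext ?_
  change ⁅dbar κ μ (-1) 1 + kform κ μ (-1) 1 _ 0, loop κ μ n m a⁆ = (-n : ℂ) • loop κ μ _ _ a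
  rw [← map_smul, dbar, der, kform, ← hom_add]
  refine (hom_bracket κ μ (-1, 1) (n, m) _ _).trans ?_
  rw [Prod.mk_add_mk, show -1 + n = n - 1 by ring, add_comm 1 m]
  refine congrArg (hom κ μ (n - 1, m + 1)) ?_
  ext <;> simp [dot, pair, vec, compBracket]

variable {κ μ} {X : Type*} [AddCommGroup X] [Module ℂ X] {ρ : HatRep κ μ X} {x₀ : X}

/-- Nilpotency of all `t₀⁻¹ t₁^m ⊗ a` on the vacuum implies nilpotency of all `t₀^n t₁^m ⊗ a`: the
element `d_{-1,1}` kills the vacuum and maps `t₀^n t₁^m ⊗ a` to a multiple of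
`t₀^{n-1} t₁^{m+1} ⊗ a`. -/
theorem loop_nilpotent_vac {a : g} (ha : κ.form a a = 0)
    (h0 : ∀ n a, 0 ≤ n → ρ (mode κ μ n a) x₀ = 0)
    (hn : ∀ m, ∃ p, (ρ (hLoop κ μ (-1) m a) ^ p) x₀ = 0) (n m : ℤ) :
    ∃ p, (ρ (hLoop κ μ n m a) ^ p) x₀ = 0 := by
  have hT : ρ (hDD κ μ (-1) 1) x₀ = 0 := by
    have := h0 0 (genD ⟨1, one_ne_zero⟩) le_rfl
    rwa [mode_genD] at this
  have hb : ∀ i j p q : ℤ, Commute (ρ (hLoop κ μ i p a)) (ρ (hLoop κ μ j q a)) := fun i j p q => by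
    have h := lie_hLoop_hLoop_of_form_eq_zero κ μ ha i j p q
    rw [lie_self, map_zero] at h
    have h' := (LieHom.map_lie ρ _ _).symm.trans ((congrArg ρ h).trans (map_zero ρ))
    exact sub_eq_zero.1 h'
  have hd : ∀ (c : ℂ) (i j : ℤ) (u : X), ρ (hDD κ μ (-1) 1) ((c • ρ (hLoop κ μ i j a)) u) =
      (c • ρ (hLoop κ μ i j a)) (ρ (hDD κ μ (-1) 1) u) +
        ((c * (-i)) • ρ (hLoop κ μ (i - 1) (j + 1) a)) u := fun c i j u => by
    have h := LinearMap.congr_fun (LieHom.map_lie ρ (hDD κ μ (-1) 1) (hLoop κ μ i j a)) u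
    rw [lie_hDD_hLoop, map_smul] at h
    have h' : ρ (hDD κ μ (-1) 1) (ρ (hLoop κ μ i j a) u) =
        ρ (hLoop κ μ i j a) (ρ (hDD κ μ (-1) 1) u) +
          ((-i : ℂ) • ρ (hLoop κ μ (i - 1) (j + 1) a)) u := by
      rw [h]
      exact (add_sub_cancel _ _).symm
    rw [LinearMap.smul_apply, map_smul, h', smul_add, LinearMap.smul_apply, LinearMap.smul_apply,
      LinearMap.smul_apply, smul_smul]
  have key : ∀ (k : ℕ) (m : ℤ), ∃ p, (ρ (hLoop κ μ (-1 - k) m a) ^ p) x₀ = 0 := by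
    intro k
    induction k with
    | zero => intro m; simpa using hn m
    | succ k ih =>
      intro m
      obtain ⟨p, hp⟩ := ih (m - 1)
      have h1 := hd 1 (-1 - k) (m - 1)
      have h2 := hd (1 * (-((-1 - k : ℤ) : ℂ))) (-1 - k - 1) (m - 1 + 1)
      rw [one_smul] at h1
      have h3 := pow_eq_zero_of_derivation hT h1 h2 ((hb _ _ _ _).smul_right _)
        ((hb _ _ _ _).smul_right _) (((hb _ _ _ _).smul_left _).smul_right _) hp
      rw [smul_pow, LinearMap.smul_apply] at h3
      have hc : (1 * (-((-1 - k : ℤ) : ℂ))) ≠ 0 := by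
        have : (-1 - k : ℤ) ≠ 0 := by omega
        rw [one_mul]
        exact neg_ne_zero.2 (Int.cast_ne_zero.2 this)
      refine ⟨2 * p, ?_⟩
      have h4 := (smul_eq_zero.1 h3).resolve_left (pow_ne_zero _ hc)
      rwa [sub_add_cancel, show (-1 - k - 1 : ℤ) = -1 - (k + 1 : ℕ) by push_cast; ring] at h4
  rcases lt_or_ge n 0 with h | h
  · obtain ⟨p, hp⟩ := key (-1 - n).toNat m
    rw [show -1 - ((-1 - n).toNat : ℤ) = n by omega] at hp
    exact ⟨p, hp⟩
  · exact ⟨1, by rw [pow_one, ← mode_genL]; exact h0 n _ h⟩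

end Loop

/-! ### The integrable quotient -/

section Integrable

open LieAlgebra

variable {g : Type*} [LieRing g] [LieAlgebra ℂ g] [FiniteDimensional ℂ g] [LieAlgebra.IsSimple ℂ g]
  {H : LieSubalgebra ℂ g} [H.IsCartanSubalgebra] {μ : ℂ}

/-- The level of a nonzero restricted integrable module is a natural number. -/
theorem exists_nat_level {W : Type*} [AddCommGroup W] [Module ℂ W] [Nontrivial W]
    {ρ : HatRep (normalizedForm H) μ W} {ℓ : ℂ} (hr : IsRestricted ρ) (hl : HasLevel ρ ℓ)
    (hi : IsIntegrable H ρ) : ∃ k : ℕ, ℓ = k := by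
  obtain ⟨α, hα, h1⟩ := (eps_spec H).2
  obtain ⟨t⟩ := exists_rootTriple H hα
  obtain ⟨u, hu, hu0, -, l, h⟩ := (t.affine hα 0 hr hl hi).exists_lowest
  obtain ⟨k, hk⟩ := (t.affine hα 0 hr hl hi).weight_add_level hu0 (hu 1 le_rfl).1 h
  refine ⟨k + l, ?_⟩
  rw [h1, one_mul] at hk
  push_cast
  linear_combination hk

/-- Root vectors are isotropic. -/
theorem form_rootVector {α : LieModule.Weight ℂ H g} (hα : α ∈ H.root) {a : g}
    (ha : a ∈ rootSpace H α) : (normalizedForm H).form a a = 0 := by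
  obtain ⟨t⟩ := exists_rootTriple H hα
  obtain ⟨c, rfl⟩ := t.exists_smul hα ha
  rw [map_smul, map_smul, LinearMap.smul_apply, t.form_ee, smul_zero, smul_zero]

theorem emb_pow_smul {κ : InvForm g} {ℓ : ℂ} (x : HatO κ μ) (N : ℕ) (v : VSpace κ μ ℓ) :
    emb κ μ x ^ N • v = (vRep κ μ ℓ x ^ N) v := by
  induction N with
  | zero => rw [pow_zero, pow_zero, one_smul, Module.End.one_apply]
  | succ N ih => rw [pow_succ', pow_succ', mul_smul, ih, Module.End.mul_apply, vRep_apply]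

variable {ℓ : ℕ} {W : Type*} [AddCommGroup W] [Module ℂ W]
  {A : VertexAlgebra (VSpace (normalizedForm H) μ (ℓ : ℂ))}

/-- Each `t₀⁻¹ t₁^m ⊗ a` with a root vector `a` is nilpotent on `𝟏` modulo `J(ℓ)`. -/
theorem pow_mem_JSub {α : LieModule.Weight ℂ H g} (hα : α ∈ H.root) {a : g}
    (ha : a ∈ rootSpace H α) (m : ℤ) :
    ∃ N : ℕ, (vRep (normalizedForm H) μ ℓ (hLoop _ μ (-1) m a) ^ N) (one _ μ _) ∈ JSub μ H ℓ := by
  obtain ⟨k, hk⟩ := exists_nat_eps H hα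
  refine ⟨k * ℓ + 1, ?_⟩
  rw [← emb_pow_smul]
  exact Submodule.subset_span ⟨α, hα, a, ha, m, _, by rw [hk]; push_cast; rfl, rfl⟩

/-- Restricted integrable modules are annihilated by `J(ℓ)`. -/
theorem Y_JSub_eq_zero (hA : IsCanonical _ μ A) (M : VAModule A W)
    {ρ : HatRep (normalizedForm H) μ W}
    (hρ : ∀ a n, ncoeff (M.Y (genVec _ μ _ a)) n = ρ (mode _ μ n a)) (hr : IsRestricted ρ)
    (hl : HasLevel ρ ℓ) (hi : IsIntegrable H ρ) {u : VSpace (normalizedForm H) μ (ℓ : ℂ)}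
    (hu : u ∈ JSub μ H ℓ) : M.Y u = 0 := by
  induction hu using Submodule.span_induction with
  | mem v hv =>
    obtain ⟨α, hα, a, ha, m, N, hN, rfl⟩ := hv
    obtain ⟨t⟩ := exists_rootTriple H hα
    obtain ⟨c, rfl⟩ := t.exists_smul hα ha
    obtain ⟨k, hk⟩ := exists_nat_eps H hα
    have hk' : eps H α * ℓ = (k * ℓ : ℕ) := by rw [hk]; push_cast; rfl
    obtain rfl : N = k * ℓ + 1 := by
      rw [hk'] at hN
      exact_mod_cast hN
    rw [emb_pow_smul, map_smul, map_smul, smul_pow, LinearMap.smul_apply, map_smul,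
      Y_pow_eq_zero hA M hρ hr hl hi hα t m hk', smul_zero]
  | zero => exact map_zero _
  | add x y _ _ hx hy => rw [map_add, hx, hy, add_zero]
  | smul x v _ hv =>
    refine env_smul_induction (p := fun v => M.Y v = 0) (fun x y hx hy => ?_) (fun c x hx => ?_)
      (fun y x hx => ?_) x hv
    · rw [map_add, hx, hy, add_zero]
    · rw [map_smul, hx, smul_zero]
    · induction y using hat_induction with
      | hadd y y' h h' => rw [emb_add, add_smul, map_add, h, h', add_zero]
      | hsmul c y h => rw [emb_smul, smul_assoc, map_smul, h, smul_zero]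
      | hm n a =>
        rw [hA.mode_smul, M.Y_nprod, hx]
        exact map_zero (nprodL n _)
      | h0 => rw [hK0_smul, map_smul, hx, smul_zero]

/-- A `V(ℓ)`-module annihilated by `J(ℓ)` is integrable. -/
theorem isIntegrable_of_Y_JSub (hA : IsCanonical _ μ A) (M : VAModule A W)
    {ρ : HatRep (normalizedForm H) μ W}
    (hρ : ∀ a n, ncoeff (M.Y (genVec _ μ _ a)) n = ρ (mode _ μ n a))
    (hM : ∀ u ∈ JSub μ H ℓ, M.Y u = 0) : IsIntegrable H ρ := by
  intro n m α hα a ha w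
  obtain ⟨N, hN⟩ := pow_mem_JSub (μ := μ) (ℓ := ℓ) hα ha m
  have hF : ∀ N : ℕ, M.Y ((vRep _ μ ℓ (hLoop _ μ (-1) m a) ^ N) (one _ μ _)) =
      fieldPow (M.Y (genVec _ μ _ (genL m a))) N := fun N => by
    induction N with
    | zero => rw [pow_zero, Module.End.one_apply, fieldPow, ← hA.1, M.Y_vac]
    | succ N ih =>
      rw [pow_succ', Module.End.mul_apply, fieldPow, ← ih, ← M.Y_nprod, hA.ncoeff_genVec,
        mode_genL]
  have h := nilpotent_of_fieldPow_eq_zero (F := M.Y (genVec _ μ _ (genL m a))) (fun i j w => ?_)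
    ((hF N).symm.trans (hM _ hN)) n w
  · rwa [hρ, mode_genL] at h
  · rw [hρ, hρ, mode_genL, mode_genL, RootTriple.rep_lie,
      lie_hLoop_hLoop_of_form_eq_zero _ _ (form_rootVector hα ha), lie_self, map_zero, map_zero,
      LinearMap.zero_apply, add_zero]

/-- The quotient map `V(ℓ) → V^int(ℓ)` as a complex linear map. -/
def toVInt (μ : ℂ) (H : LieSubalgebra ℂ g) [H.IsCartanSubalgebra] (ℓ : ℕ) :
    VSpace (normalizedForm H) μ (ℓ : ℂ) →ₗ[ℂ] VInt μ H ℓ :=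
  (JSub μ H ℓ).mkQ.restrictScalars ℂ

theorem toVInt_surjective : Function.Surjective (toVInt μ H ℓ) := (JSub μ H ℓ).mkQ_surjective

theorem toVInt_eq_zero {v : VSpace (normalizedForm H) μ (ℓ : ℂ)} :
    toVInt μ H ℓ v = 0 ↔ v ∈ JSub μ H ℓ := Submodule.Quotient.mk_eq_zero _

/-- `J(ℓ)` is stable under the modes of all vectors of `V(ℓ)`, since it is stable under those of the
generators. -/
theorem toVInt_ncoeff (hA : IsCanonical _ μ A) (u : VSpace (normalizedForm H) μ (ℓ : ℂ)) (n : ℤ)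
    (v : VSpace (normalizedForm H) μ (ℓ : ℂ)) (hv : toVInt μ H ℓ v = 0) :
    toVInt μ H ℓ (ncoeff (A.Y u) n v) = 0 := by
  rw [toVInt_eq_zero] at hv ⊢
  have hg : ∀ a, genVec _ μ _ a ∈ A.stabilizer ((JSub μ H ℓ).restrictScalars ℂ) := by
    intro a n w hw
    rw [hA.2]
    exact (JSub μ H ℓ).smul_mem _ hw
  have hu : u ∈ A.stabilizer ((JSub μ H ℓ).restrictScalars ℂ) := by
    induction u using vspace_induction with
    | h1 => rw [← hA.1]; exact A.vac_mem_stabilizer _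
    | hadd x y hx hy => exact add_mem hx hy
    | hsmul c x hx => exact Submodule.smul_mem _ c hx
    | hm n a x hx => rw [hA.mode_smul]; exact A.mode_mem_stabilizer _ (hg a) hx n
  exact hu n v hv

/-- `V^int(ℓ)` as a `V(ℓ)`-module. -/
def vIntModule (hA : IsCanonical _ μ A) : VAModule A (VInt μ H ℓ) :=
  quotModule toVInt_surjective A (toVInt_ncoeff hA)

theorem vIntModule_mode (hA : IsCanonical _ μ A) (n : ℤ) (a : GenSpace g)
    (v : VSpace (normalizedForm H) μ (ℓ : ℂ)) :
    repOfModule hA.hasGenOPE (vIntModule hA) (mode _ μ n a) (toVInt μ H ℓ v) =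
      toVInt μ H ℓ (vRep _ μ _ (mode _ μ n a) v) := by
  rw [repOfModule_mode, ← hA.ncoeff_genVec]
  exact ncoeff_quotModule toVInt_surjective A (toVInt_ncoeff hA) _ v n

/-- `V^int(ℓ)` is an integrable module. -/
theorem isIntegrable_vInt (hA : IsCanonical _ μ A) :
    IsIntegrable H (repOfModule hA.hasGenOPE (vIntModule hA)) := by
  intro n m α hα a ha w
  obtain ⟨v, rfl⟩ := toVInt_surjective w
  have had : ∀ u, ∃ k, ((LieAlgebra.ad ℂ g a) ^ k) u = 0 := fun u => by
    have h0 : (α : H → ℂ) ≠ 0 := LieSubalgebra.isNonZero_coe_root ⟨α, hα⟩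
    obtain ⟨k, hk⟩ := isNilpotent_ad_of_mem_rootSpace H h0 ha
    exact ⟨k, by rw [hk]; rfl⟩
  induction v using vspace_induction with
  | h1 =>
    refine loop_nilpotent_vac (form_rootVector hα ha) (fun n b hn => ?_) (fun m => ?_) n m
    · rw [vIntModule_mode, vRep_apply, mode_smul_one hn, map_zero]
    · obtain ⟨N, hN⟩ := pow_mem_JSub (μ := μ) (ℓ := ℓ) hα ha m
      refine ⟨N, Eq.trans ?_ (toVInt_eq_zero.2 hN)⟩
      clear hN
      induction N with
      | zero => rfl
      | succ N ih =>
        rw [pow_succ', pow_succ', Module.End.mul_apply, Module.End.mul_apply, ih, ← mode_genL,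
          vIntModule_mode]
  | hadd x y hx hy => rw [map_add]; exact exists_pow_add_eq_zero hx hy
  | hsmul c x hx =>
    obtain ⟨p, hp⟩ := hx
    exact ⟨p, by rw [map_smul, map_smul, hp, smul_zero]⟩
  | hm i b x hx =>
    obtain ⟨p, hp⟩ := hx
    obtain ⟨k, hk⟩ := ad_hLoop_nilpotent (normalizedForm H) μ had n m (mode _ μ i b)
    obtain ⟨q, hq⟩ := exists_pow_lie_eq_zero _ _ k _ _ hk hp
    rw [vIntModule_mode] at hq
    exact ⟨q, hq⟩

/-- `J(ℓ)` is an ideal: by integrability of the quotient module, its vertex operators act as zero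
there. -/
theorem exists_vInt (hA : IsCanonical _ μ A) : ∃ B : VertexAlgebra (VInt μ H ℓ),
    IsQuotientAlong (toVInt μ H ℓ) A B :=
  exists_quotient toVInt_surjective A (toVInt_ncoeff hA) fun _ hu =>
    Y_JSub_eq_zero hA (vIntModule hA) (fun a n => (repOfModule_mode hA.hasGenOPE _ n a).symm)
      (repOfModule_restricted _ _) (repOfModule_level _ _) (isIntegrable_vInt hA)
      (toVInt_eq_zero.1 hu)

/-- Restricted integrable modules of level `ℓ` are the same as `V^int(ℓ)`-modules. -/
def integrableEquivModule (hA : IsCanonical _ μ A) {B : VertexAlgebra (VInt μ H ℓ)}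
    (hB : IsQuotientAlong (toVInt μ H ℓ) A B) (W : Type*) [AddCommGroup W] [Module ℂ W] :
    {ρ : HatRep (normalizedForm H) μ W //
      IsRestricted ρ ∧ HasLevel ρ (ℓ : ℂ) ∧ IsIntegrable H ρ} ≃ VAModule B W where
  toFun ρ := quotientModuleEquiv toVInt_surjective hB ⟨repEquivModule hA W ⟨ρ.1, ρ.2.1, ρ.2.2.1⟩,
    fun _ hu => Y_JSub_eq_zero hA _ (repEquivModule_genVec hA ⟨ρ.1, ρ.2.1, ρ.2.2.1⟩) ρ.2.1 ρ.2.2.1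
      ρ.2.2.2 (toVInt_eq_zero.1 hu)⟩
  invFun N :=
    let M := (quotientModuleEquiv toVInt_surjective hB).symm N
    let ρ := (repEquivModule hA W).symm M.1
    ⟨ρ.1, ρ.2.1, ρ.2.2, isIntegrable_of_Y_JSub hA M.1
      (fun a n => by rw [← repEquivModule_genVec hA ρ a n, Equiv.apply_symm_apply])
      fun u hu => M.2 u (toVInt_eq_zero.2 hu)⟩
  left_inv ρ := by
    refine Subtype.ext ?_
    simp only [Equiv.symm_apply_apply]
  right_inv N := by
    simp only [Subtype.coe_eta, Equiv.apply_symm_apply]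

end Integrable

end Toroidal

end

theorem mainTheorem10 {g : Type u} [LieRing g] [LieAlgebra ℂ g] [FiniteDimensional ℂ g]
    [LieAlgebra.IsSimple ℂ g] (H : LieSubalgebra ℂ g) [H.IsCartanSubalgebra] (μ : ℂ) :
    (∀ ℓ : ℂ,
      (∃! A : VertexAlgebra (VSpace (normalizedForm H) μ ℓ), IsCanonical _ μ A) ∧
      ∀ A : VertexAlgebra (VSpace (normalizedForm H) μ ℓ), IsCanonical _ μ A →
        ∀ (W : Type w) [AddCommGroup W] [Module ℂ W],
          ∃ e : {ρ : HatRep (normalizedForm H) μ W //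
                IsRestricted ρ ∧ HasLevel ρ ℓ} ≃ VAModule A W,
            ∀ ρ (a : GenSpace g) (n : ℤ),
              VertexOperator.ncoeff ((e ρ).Y (genVec _ μ ℓ a)) n = ρ.1 (mode _ μ n a)) ∧
    (∀ (ℓ : ℂ) (W : Type w) [AddCommGroup W] [Module ℂ W] [Nontrivial W]
      (ρ : HatRep (normalizedForm H) μ W),
      IsRestricted ρ → HasLevel ρ ℓ → IsIntegrable H ρ → ∃ k : ℕ, ℓ = k) ∧
    (∀ (ℓ : ℕ) (A : VertexAlgebra (VSpace (normalizedForm H) μ (ℓ : ℂ))), IsCanonical _ μ A →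
      (∃! B : VertexAlgebra (VInt μ H ℓ), IsQuotientStructure A B) ∧
      ∀ B : VertexAlgebra (VInt μ H ℓ), IsQuotientStructure A B →
        ∀ (W : Type w) [AddCommGroup W] [Module ℂ W],
          ∃ e : {ρ : HatRep (normalizedForm H) μ W //
                IsRestricted ρ ∧ HasLevel ρ (ℓ : ℂ) ∧ IsIntegrable H ρ} ≃ VAModule B W,
            ∀ ρ (a : GenSpace g) (n : ℤ),
              VertexOperator.ncoeff
                ((e ρ).Y ((JSub μ H ℓ).mkQ (genVec _ μ (ℓ : ℂ) a))) n =
                ρ.1 (mode _ μ n a)) := by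
  refine ⟨fun ℓ => ⟨?_, fun A hA W _ _ => ?_⟩, fun ℓ W _ _ _ ρ hr hl hi => ?_,
    fun ℓ A hA => ⟨?_, fun B hB W _ _ => ?_⟩⟩
  · obtain ⟨A, hA⟩ := exists_canonical (κ := normalizedForm H) (μ := μ) (ℓ := ℓ)
    exact ⟨A, hA, fun B hB => canonical_unique hB hA⟩
  · exact ⟨repEquivModule hA W, repEquivModule_genVec hA⟩
  · exact exists_nat_level hr hl hi
  · obtain ⟨B, hB⟩ := exists_vInt hA
    exact ⟨B, hB, fun B' hB' => quotient_unique toVInt_surjective hB' hB⟩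
  · refine ⟨integrableEquivModule hA hB W, fun ρ a n => ?_⟩
    refine Eq.trans (congrArg (fun F => VertexOperator.ncoeff F n)
      (quotientModuleEquiv_Y toVInt_surjective hB _ (genVec _ μ _ a))) ?_
    exact repEquivModule_genVec hA ⟨ρ.1, ρ.2.1, ρ.2.2.1⟩ a n
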